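/- Let $p\ge 5$ be a prime and let $\mathbb{Z}_{(p)}\subset\mathbb{Q}$ be the ring of $p$-integral rational numbers. For an integer $k\ge 0$ let $\mathrm{M}_k$ be the set of holomorphic modular forms of weight $k$ on $\operatorname{SL}_2(\mathbb{Z})$ whose Fourier coefficients lie in $\mathbb{Z}_{(p)}$; identify such a form with its Fourier expansion $\sum a(j)q^j\in\mathbb{Z}_{(p)}[[q]]$. For $m\ge 1$ and $g\in\mathbb{Z}_{(p)}[[q]]$ let the weight filtration be $$\omega_{p^m}(g)=\inf\{w\ge 0 : g\equiv h \pmod{p^m}\text{ for some } h\in \mathrm{M}_w\},$$ where congruences are coefficientwise and $\inf\emptyset=\infty$. Let $\theta=q\,\frac{d}{dq}$, so that $\theta\sum a(j)q^j=\sum j\,a(j)q^j$. Let $0<k<p$ and let $f\in \mathrm{M}_k$ satisfy $\omega_p(f)=k$. Let $1\le n<p$ and $np\le i\le np+p-k+1$, and put $i'=i-np$. Call $i$ exceptional if $i^2+(k-1)i-n^2\equiv 0\pmod p$. 1. If $i$ is exceptional, then $\omega_{p^2}(\theta^i f)\le k+2i+p(p-1)$. 2. If $i$ is not exceptional, then: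 - if $i'=0$, then $\omega_{p^2}(\theta^i f)\le k+2i+p(p-1)$; - if $0<i'<n$ and $i'\le p-k+1-n$, then $\omega_{p^2}(\theta^i f)= k+2i+p(p-1)$; - if $n\le i'\le p-k+1-n$, then $\omega_{p^2}(\theta^i f)= k+2i+2p(p-1)$; - if $p-k+1-n<i'<p-k+1$, then $\omega_{p^2}(\theta^i f)\le k+2i+p(p-1)$; - if $i'=p-k+1$, then $\omega_{p^2}(\theta^i f)\le k+2i+p(p-1)$. -/

import Mathlib

open PowerSeries
open scoped MatrixGroups

/-- The ring `ℤ_(p)` of `p`-integral rational numbers, as a subring of `ℚ`. -/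
def pIntegral (p : ℕ) [hp : Fact p.Prime] : Subring ℚ where
  carrier := {x | ¬ p ∣ x.den}
  one_mem' := by simpa using hp.out.one_lt.ne'
  zero_mem' := by simpa using hp.out.one_lt.ne'
  mul_mem' {x y} hx hy h :=
    (hp.out.dvd_mul.1 (h.trans (Rat.mul_den_dvd x y))).elim hx hy
  add_mem' {x y} hx hy h :=
    (hp.out.dvd_mul.1 (h.trans (Rat.add_den_dvd x y))).elim hx hy
  neg_mem' {x} hx := by simpa using hx

/-- The embedding `ℤ_(p) → ℂ`. -/
noncomputable def pIntegralToComplex (p : ℕ) [Fact p.Prime] : pIntegral p →+* ℂ :=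
  (Rat.castHom ℂ).comp (pIntegral p).subtype

/-- `M_k`: the Fourier expansions at infinity of the weight `k` modular forms on `SL₂(ℤ)`
whose Fourier coefficients are `p`-integral rational numbers. A modular form is identified
with its expansion. -/
def modularExpansions (p : ℕ) [Fact p.Prime] (k : ℕ) : Set (pIntegral p)⟦X⟧ :=
  {f | ∃ F : ModularForm 𝒮ℒ (k : ℤ),
    UpperHalfPlane.qExpansion 1 F = PowerSeries.map (pIntegralToComplex p) f}

/-- `f ≡ g (mod p ^ m)`, coefficient by coefficient, in `ℤ_(p)⟦q⟧`. -/
def CongModPow (p : ℕ) [Fact p.Prime] (m : ℕ) (f g : (pIntegral p)⟦X⟧) : Prop :=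
  ∀ n : ℕ, (p : pIntegral p) ^ m ∣ coeff n f - coeff n g

/-- The weight filtration modulo `p ^ m`: the least weight `k` for which `f` is congruent
modulo `p ^ m` to an element of `M_k`. It is `⊤` when `f` is not congruent to a modular form
of any weight. -/
noncomputable def weightFiltration (p : ℕ) [Fact p.Prime] (m : ℕ) (f : (pIntegral p)⟦X⟧) : ℕ∞ :=
  ⨅ k ∈ {k : ℕ | ∃ g ∈ modularExpansions p k, CongModPow p m f g}, (k : ℕ∞)

/-- The theta operator `q d/dq`, sending `∑ a(n) qⁿ` to `∑ n a(n) qⁿ`. -/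
noncomputable def thetaOp {R : Type*} [Semiring R] (f : R⟦X⟧) : R⟦X⟧ :=
  PowerSeries.mk fun n => (n : R) * coeff n f

/-- An index `i` in the `n`-th segment is exceptional when
`i ^ 2 + (k - 1) i - n ^ 2 ≡ 0 (mod p)`. -/
def IsExceptionalIndex (p k n i : ℕ) : Prop :=
  (i : ℤ) ^ 2 + ((k : ℤ) - 1) * i - (n : ℤ) ^ 2 ≡ 0 [ZMOD p]

/-! Write y = E₂/12, k = d + 1, n = m + 1, and E = E_{p-1} = 1 + pκ. Since θy = y² - E₄/144, there
is an exact expansion θ^i f = ∑_s c(i,s) y^s F_{i-s}, where c(i,s) is C(i,s) times the falling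
factorial of d + i of length s, and F_r is a modular form of weight k + 2r
(`iterate_thetaOp_eq_sum`). Only y fails to be modular. Because θκ ≡ y - y^p (mod p), the Serre
derivative of E shows that y^s is, modulo p² and for s ≤ p, a form of weight 2s + p(p-1) plus p s
y^(s-1+p) (`sq_dvd_twelfthE2_pow_sub`).

Upper bounds. For 0 < i' < p - d, inserting this and evaluating the coefficients with the theorems
of Lucas and Wilson gives, modulo p², θ^i f = (form of weight k + 2i + p(p-1)) + p (i(d+i) - n²) y^p
θ^a f with a = n + i' - 1 (`thetaExpansion_eq`, `exists_isFormModPow_add`). The index is exceptional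
exactly when the correction vanishes modulo p². Otherwise y^p θ^a f matters only modulo p, where it
has weight k + 2i + p(p-1) + (i'-n+1)(p-1). This fits if i' < n. It also fits if a ≥ p - d, because
θ^(p-d) f is congruent to a form of much smaller weight. In the remaining case the weight has to
grow by another p(p-1). At i' = 0 and i' = p - d the coefficients c(i,s) are divisible enough for a
direct argument.

Lower bounds. Forms modulo p are polynomials in E₄ and E₆ modulo A - 1, with A the Hasse invariant.
A is squarefree, and its Serre derivative, which represents y, is prime to it. The hypothesis on f
provides a prime π dividing A but not the polynomial of f, and π continues not to divide the
polynomial of y^p θ^a f as long as no weight divisible by p is met; so the weight of the correction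
cannot be lowered (`not_isFormModPow_twelfthE2_pow_mul`). Moreover the possible weights of a given
series modulo p², not zero modulo p, differ by multiples of p(p-1) (`dvd_of_congruent_mod_sq`). A
smaller weight for θ^i f would thus be smaller by at least p(p-1), and would force too small a
weight on the correction. For i' < n this uses that the forms F_{np+j} with j < n themselves have
lower weight modulo p (`isFormModPow_modularDerivative_of_le`). -/

open UpperHalfPlane ModularForm EisensteinSeries Derivative in
/-- `F` is the sum of the power series `g` in `q = exp (2πiτ)`. -/
def HasQSeries (F : UpperHalfPlane → ℂ) (g : ℂ⟦X⟧) : Prop :=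
  ∀ τ : UpperHalfPlane,
    HasSum (fun m : ℕ => coeff m g * Function.Periodic.qParam 1 τ ^ m) (F τ)

/-! ### Analytic input: q-series, Serre derivative and quasimodularity of E₂ -/

section Analytic
open UpperHalfPlane ModularForm EisensteinSeries Derivative
open scoped Manifold

theorem HasQSeries.sub {F G : ℍ → ℂ} {f g : ℂ⟦X⟧} (hF : HasQSeries F f) (hG : HasQSeries G g) :
    HasQSeries (F - G) (f - g) := fun τ => by
  simpa [sub_mul] using (hF τ).sub (hG τ)

theorem HasQSeries.smul {F : ℍ → ℂ} {f : ℂ⟦X⟧} (hF : HasQSeries F f) (c : ℂ) :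
    HasQSeries (c • F) (c • f) := fun τ => by
  simpa [mul_assoc] using (hF τ).mul_left c

theorem HasQSeries.mul {F G : ℍ → ℂ} {f g : ℂ⟦X⟧} (hF : HasQSeries F f) (hG : HasQSeries G g) :
    HasQSeries (F * G) (f * g) := fun τ => by
  have h1 := (hF τ).summable.norm
  have h2 := (hG τ).summable.norm
  have h3 := (summable_norm_sum_mul_antidiagonal_of_summable_norm h1 h2).of_norm
  have h4 := tsum_mul_tsum_eq_tsum_sum_antidiagonal_of_summable_norm h1 h2
  rw [(hF τ).tsum_eq, (hG τ).tsum_eq] at h4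
  rw [Pi.mul_apply, h4]
  convert! h3.hasSum using 2 with m
  rw [coeff_mul, Finset.sum_mul]
  refine Finset.sum_congr rfl fun x hx => ?_
  rw [← Finset.HasAntidiagonal.mem_antidiagonal.1 hx, pow_add]
  ring

theorem HasQSeries.normalizedDeriv {F : ℍ → ℂ} {f : ℂ⟦X⟧} (hF : HasQSeries F f) :
    HasQSeries (normalizedDerivOfComplex F) (thetaOp f) := fun τ => by
  set q : ℂ → ℂ := fun z => Complex.exp (2 * Real.pi * Complex.I * z) with hq
  have hqp : ∀ z : ℂ, Function.Periodic.qParam 1 z = q z := fun z => by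
    simp [Function.Periodic.qParam, hq]
  have hqd : ∀ z, HasDerivAt q (2 * Real.pi * Complex.I * q z) z := fun z => by
    have := ((hasDerivAt_id z).const_mul (2 * Real.pi * Complex.I)).cexp
    simpa [hq, mul_comm, mul_left_comm, mul_assoc] using this
  -- On the half plane above height Im τ / 2 every term is dominated by its absolute value at the
  -- point σ of that height, so the series can be differentiated termwise.
  set U : Set ℂ := {w | (τ : ℂ).im / 2 < w.im}
  have hU : IsOpen U := isOpen_lt continuous_const Complex.continuous_im
  have hτ0 : 0 < (τ : ℂ).im := τ.im_pos
  have hτ : (τ : ℂ) ∈ U := half_lt_self hτ0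
  let σ : ℍ := ⟨⟨0, (τ : ℂ).im / 2⟩, half_pos hτ0⟩
  have hs := (hF σ).summable.norm
  have hnq : ∀ z, ‖q z‖ = Real.exp (-(2 * Real.pi * z.im)) := fun z => by
    rw [hq, Complex.norm_exp]
    simp
  have key := Complex.hasSum_deriv_of_summable_norm (F := fun (m : ℕ) w => coeff m f * q w ^ m)
    hs (fun m w _ => (((hqd w).differentiableAt.pow m).const_mul _).differentiableWithinAt) hU
    (fun m w hw => by
      rw [hqp, norm_mul, norm_mul, norm_pow, norm_pow, hnq, hnq]
      gcongr
      exact le_of_lt hw) hτ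
  have hd : deriv (fun w : ℂ => ∑' m : ℕ, coeff m f * q w ^ m) τ = deriv (F ∘ ofComplex) τ := by
    apply Filter.EventuallyEq.deriv_eq
    filter_upwards [hU.mem_nhds hτ] with w hw
    have hw0 : 0 < w.im := (half_pos hτ0).trans hw
    have := (hF ⟨w, hw0⟩).tsum_eq
    simp only [hqp] at this
    rw [Function.comp_apply, ofComplex_apply_of_im_pos hw0]
    exact this
  rw [hd] at key
  have := key.mul_left (2 * Real.pi * Complex.I)⁻¹
  convert! this using 2 with m
  · have h2 : (2 * Real.pi * Complex.I : ℂ) ≠ 0 := Complex.two_pi_I_ne_zero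
    have h3 : deriv (fun w => coeff m f * q w ^ m) τ = _ :=
      (((hqd τ).fun_pow m).const_mul (coeff m f)).deriv
    rw [hqp, h3, thetaOp, coeff_mk]
    rcases m with _ | m
    · simp
    · rw [Nat.add_sub_cancel]
      field_simp
      ring

/-- A holomorphic function on the upper half plane that is invariant under `SL₂(ℤ)` and has a
power series expansion in `q` is a modular form with that expansion. -/
theorem exists_modularForm_of_hasQSeries {k : ℤ} {F : ℍ → ℂ} {f : ℂ⟦X⟧} (hF : HasQSeries F f)
    (hd : MDiff F) (hs : ∀ γ : SL(2, ℤ), F ∣[k] γ = F) :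
    ∃ G : ModularForm 𝒮ℒ k, ⇑G = F ∧ qExpansion 1 G = f := by
  let G : ModularForm 𝒮ℒ k :=
    { toFun := F
      slash_action_eq' := by
        rintro _ ⟨γ, rfl⟩
        exact hs γ
      holo' := hd
      bdd_at_cusps' := by
        intro c hc
        rw [Subgroup.IsArithmetic.isCusp_iff_isCusp_SL2Z] at hc
        rw [OnePoint.isBoundedAt_iff_forall_SL2Z hc]
        intro γ _
        rw [hs γ]
        exact isBoundedAtImInfty_of_hasSum_qExpansion one_pos hF }
  refine ⟨G, rfl, ?_⟩
  ext m
  exact (ModularFormClass.qExpansion_coeff_unique (f := G) one_pos one_mem_strictPeriods_SL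
    hF m).symm

theorem ModularForm.hasQSeries {k : ℤ} (G : ModularForm 𝒮ℒ k) :
    HasQSeries G (qExpansion 1 G) := fun τ =>
  ModularForm.hasSum_qExpansion G one_pos one_mem_strictPeriods_SL τ

/-- The power series of the weight two Eisenstein series. -/
noncomputable def eisensteinTwoSeries (R : Type*) [Ring R] : R⟦X⟧ :=
  PowerSeries.mk fun m => if m = 0 then 1 else -24 * (ArithmeticFunction.sigma 1 m : R)

theorem hasQSeries_E2 : HasQSeries E2 (eisensteinTwoSeries ℂ) := fun τ => by
  simpa [eisensteinTwoSeries, Function.Periodic.qParam] using hasSum_qExpansion_E2 (z := τ)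

theorem exists_modularForm_serreDerivative {k : ℤ} (G : ModularForm 𝒮ℒ k) :
    ∃ H : ModularForm 𝒮ℒ (k + 2), qExpansion 1 H = thetaOp (qExpansion 1 G) -
      ((k : ℂ) / 12) • (eisensteinTwoSeries ℂ * qExpansion 1 G) := by
  have hG : MDiff (G : ℍ → ℂ) := ModularFormClass.holo G
  have h1 := G.hasQSeries.normalizedDeriv.sub ((hasQSeries_E2.mul G.hasQSeries).smul ((k : ℂ) / 12))
  have h2 : serreDerivative k G = normalizedDerivOfComplex G - ((k : ℂ) / 12) • (E2 * G) := by
    ext z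
    simp [serreDerivative]
    ring
  rw [← h2] at h1
  obtain ⟨H, -, hH⟩ := exists_modularForm_of_hasQSeries (k := k + 2) h1
    (serreDerivative_mdifferentiable _ hG) (fun γ => serreDerivative_slash_invariant hG
      (G.slash_action_eq' _ ⟨γ, rfl⟩))
  exact ⟨H, hH⟩

theorem E2_slash_apply (γ : SL(2, ℤ)) (z : ℍ) :
    (E2 ∣[(2 : ℤ)] γ) z = E2 z + 12 * (2 * Real.pi * Complex.I)⁻¹ * (γ 1 0 / denom γ z) := by
  have h2 : (2 * Real.pi * Complex.I : ℂ) ≠ 0 := Complex.two_pi_I_ne_zero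
  have hpi : (Real.pi : ℂ) ≠ 0 := Complex.ofReal_ne_zero.2 Real.pi_ne_zero
  have hc : (1 / (2 * riemannZeta 2)) * (2 * Real.pi * Complex.I)
      = -(12 * (2 * Real.pi * Complex.I : ℂ)⁻¹) := by
    rw [riemannZeta_two]
    field_simp
    linear_combination 12 * Complex.I_sq
  have h := congrFun (E2_slash_action γ) z
  rw [h, Pi.sub_apply, Pi.smul_apply, D2, smul_eq_mul]
  linear_combination -(γ 1 0 / denom γ z : ℂ) * hc

/-- Differentiating the transformation law of E₂ produces both extra terms: one from the weight
factor, one from the derivative of the anomaly. -/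
theorem normalizedDeriv_E2_slash_apply (γ : SL(2, ℤ)) (z : ℍ) :
    (normalizedDerivOfComplex E2 ∣[(4 : ℤ)] γ) z = normalizedDerivOfComplex E2 z
      + 2 * (2 * Real.pi * Complex.I)⁻¹ * (γ 1 0 / denom γ z) * E2 z
      + 12 * ((2 * Real.pi * Complex.I)⁻¹ * (γ 1 0 / denom γ z)) ^ 2 := by
  have h := congrFun (normalizedDerivOfComplex_SL_slash (k := 2) E2_mdifferentiable (γ := γ)) z
  have hE : DifferentiableAt ℂ (E2 ∘ ofComplex) z := mdifferentiableAt_iff.mp (E2_mdifferentiable z)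
  have hden := hasDerivAt_denom_zpow (γ : GL (Fin 2) ℝ) (-1) z
  have hev : ((E2 ∣[(2 : ℤ)] γ) ∘ ofComplex) =ᶠ[nhds (z : ℂ)] fun w => (E2 ∘ ofComplex) w +
      12 * (2 * Real.pi * Complex.I)⁻¹ * γ 1 0 * denom (γ : GL (Fin 2) ℝ) w ^ (-1 : ℤ) := by
    filter_upwards [isOpen_upperHalfPlaneSet.mem_nhds z.im_pos] with w hw
    simp only [Function.comp_apply, ofComplex_apply_of_im_pos hw, E2_slash_apply, zpow_neg_one]
    simp only [div_eq_mul_inv]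
    ring
  have hz := denom_ne_zero (γ : GL (Fin 2) ℝ) z
  have hd : normalizedDerivOfComplex (E2 ∣[(2 : ℤ)] γ) z = normalizedDerivOfComplex E2 z -
      12 * ((2 * Real.pi * Complex.I)⁻¹ * (γ 1 0 / denom γ z)) ^ 2 := by
    rw [normalizedDerivOfComplex, normalizedDerivOfComplex, hev.deriv_eq,
      (hE.hasDerivAt.fun_add (hden.const_mul _)).deriv]
    rw [show (-1 - 1 : ℤ) = -2 by norm_num, zpow_neg]
    simp
    field_simp
    ring
  rw [hd, Pi.sub_apply, E2_slash_apply] at h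
  norm_num at h
  norm_num
  linear_combination -h

/-- If E₂ transforms with anomaly c, then both E₂² and 12 θE₂ acquire 2cE₂ + c², and the difference
is modular. -/
theorem exists_modularForm_E2 : ∃ H : ModularForm 𝒮ℒ 4, qExpansion 1 H =
    eisensteinTwoSeries ℂ * eisensteinTwoSeries ℂ - (12 : ℂ) • thetaOp (eisensteinTwoSeries ℂ) := by
  have h1 := (hasQSeries_E2.mul hasQSeries_E2).sub (hasQSeries_E2.normalizedDeriv.smul 12)
  obtain ⟨H, -, hH⟩ := exists_modularForm_of_hasQSeries (k := 4) h1
    ((E2_mdifferentiable.mul E2_mdifferentiable).sub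
      ((normalizedDerivOfComplex_mdifferentiable E2_mdifferentiable).const_smul (12 : ℂ))) (by
      intro γ
      ext z
      have h3 := congrFun (ModularForm.mul_slash_SL2 2 2 γ E2 E2) z
      rw [sub_eq_add_neg, SlashAction.add_slash, SlashAction.neg_slash, ModularForm.SL_smul_slash]
      norm_num at h3
      simp only [Pi.add_apply, Pi.neg_apply, Pi.smul_apply, h3, normalizedDeriv_E2_slash_apply,
        Pi.mul_apply, E2_slash_apply, smul_eq_mul]
      ring)
  exact ⟨H, hH⟩

end Analytic

/-! ### Formal properties of the theta operator -/

section Theta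
variable {R : Type*} [CommRing R]

@[simp] theorem coeff_thetaOp (f : R⟦X⟧) (n : ℕ) : coeff n (thetaOp f) = n * coeff n f := by
  simp [thetaOp]

theorem thetaOp_add (f g : R⟦X⟧) : thetaOp (f + g) = thetaOp f + thetaOp g := by
  ext n; simp [mul_add]

theorem thetaOp_sub (f g : R⟦X⟧) : thetaOp (f - g) = thetaOp f - thetaOp g := by
  ext n; simp [mul_sub]

theorem thetaOp_zero : thetaOp (0 : R⟦X⟧) = 0 := by
  ext n; simp

theorem thetaOp_sum {ι : Type*} (s : Finset ι) (f : ι → R⟦X⟧) :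
    thetaOp (∑ i ∈ s, f i) = ∑ i ∈ s, thetaOp (f i) := by
  ext n; simp [Finset.mul_sum]

theorem thetaOp_mul (f g : R⟦X⟧) : thetaOp (f * g) = thetaOp f * g + f * thetaOp g := by
  ext n
  rw [coeff_thetaOp, map_add, coeff_mul, coeff_mul, coeff_mul, Finset.mul_sum,
    ← Finset.sum_add_distrib]
  refine Finset.sum_congr rfl fun x hx => ?_
  rw [← Finset.HasAntidiagonal.mem_antidiagonal.1 hx, coeff_thetaOp, coeff_thetaOp]
  push_cast
  ring

theorem thetaOp_C (a : R) : thetaOp (C a) = 0 := by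
  ext n
  rcases n with _ | n <;> simp [coeff_C]

theorem thetaOp_C_mul (a : R) (f : R⟦X⟧) : thetaOp (C a * f) = C a * thetaOp f := by
  rw [thetaOp_mul, thetaOp_C, zero_mul, zero_add]

theorem thetaOp_natCast_mul (a : ℕ) (f : R⟦X⟧) :
    thetaOp ((a : R⟦X⟧) * f) = (a : R⟦X⟧) * thetaOp f := by
  simpa using thetaOp_C_mul (a : R) f

theorem thetaOp_pow (f : R⟦X⟧) (n : ℕ) : thetaOp (f ^ n) = n * f ^ (n - 1) * thetaOp f := by
  induction n with
  | zero => simpa using thetaOp_C (1 : R)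
  | succ n ih =>
    rw [pow_succ, thetaOp_mul, ih]
    rcases n with _ | n
    · simp
    · simp only [Nat.add_sub_cancel, Nat.cast_add, Nat.cast_one]
      ring

theorem map_thetaOp {S : Type*} [CommRing S] (φ : R →+* S) (f : R⟦X⟧) :
    PowerSeries.map φ (thetaOp f) = thetaOp (PowerSeries.map φ f) := by
  ext n; simp

theorem map_iterate_thetaOp {S : Type*} [CommRing S] (φ : R →+* S) (f : R⟦X⟧) (i : ℕ) :
    PowerSeries.map φ (thetaOp^[i] f) = thetaOp^[i] (PowerSeries.map φ f) := by
  induction i with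
  | zero => rfl
  | succ i ih => rw [Function.iterate_succ_apply', Function.iterate_succ_apply', map_thetaOp, ih]

theorem coeff_iterate_thetaOp (f : R⟦X⟧) (i n : ℕ) :
    coeff n (thetaOp^[i] f) = (n : R) ^ i * coeff n f := by
  induction i with
  | zero => simp
  | succ i ih => rw [Function.iterate_succ_apply', coeff_thetaOp, ih]; ring

theorem natCast_dvd_iff_forall_coeff (a : ℕ) (f : R⟦X⟧) :
    (a : R⟦X⟧) ∣ f ↔ ∀ n, (a : R) ∣ coeff n f := by
  rw [show (a : R⟦X⟧) = C (a : R) by simp]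
  constructor
  · rintro ⟨g, rfl⟩ n
    rw [coeff_C_mul]
    exact dvd_mul_right _ _
  · intro h
    choose g hg using h
    refine ⟨PowerSeries.mk g, ?_⟩
    ext n
    rw [coeff_C_mul, coeff_mk, hg]

end Theta

/-! ### Arithmetic of p-integral rationals and reduction modulo p -/

section PIntegral
variable {p : ℕ} [hp : Fact p.Prime]

theorem isUnit_natCast_pIntegral {n : ℕ} (hn : ¬ p ∣ n) : IsUnit (n : pIntegral p) := by
  have h0 : n ≠ 0 := by rintro rfl; simp at hn
  refine isUnit_iff_exists_inv.2 ⟨⟨(1 / n : ℚ), ?_⟩, ?_⟩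
  · change ¬ p ∣ (1 / n : ℚ).den
    rw [one_div, Rat.inv_natCast_den_of_pos (Nat.pos_of_ne_zero h0)]
    exact hn
  · ext
    push_cast
    field_simp

theorem pIntegralToComplex_injective : Function.Injective (pIntegralToComplex p) :=
  (Rat.castHom ℂ).injective.comp Subtype.val_injective

variable (p) in
/-- Reduction modulo `p` on `ℤ_(p)`. -/
noncomputable def pIntegralReduction : pIntegral p →+* ZMod p where
  toFun x := ((x : ℚ) : ZMod p)
  map_zero' := by simp
  map_one' := by simp
  map_add' x y := by
    refine Rat.cast_add_of_ne_zero ?_ ?_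
    · exact fun h => x.2 ((ZMod.natCast_eq_zero_iff _ _).1 h)
    · exact fun h => y.2 ((ZMod.natCast_eq_zero_iff _ _).1 h)
  map_mul' x y := by
    refine Rat.cast_mul_of_ne_zero ?_ ?_
    · exact fun h => x.2 ((ZMod.natCast_eq_zero_iff _ _).1 h)
    · exact fun h => y.2 ((ZMod.natCast_eq_zero_iff _ _).1 h)

theorem pIntegralReduction_eq_zero_iff (x : pIntegral p) :
    pIntegralReduction p x = 0 ↔ (p : pIntegral p) ∣ x := by
  constructor
  · intro h
    change (((x : ℚ)) : ZMod p) = 0 at h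
    have hd : ((x : ℚ).den : ZMod p) ≠ 0 := fun h => x.2 ((ZMod.natCast_eq_zero_iff _ _).1 h)
    rw [Rat.cast_def, div_eq_zero_iff, or_iff_left hd, ZMod.intCast_zmod_eq_zero_iff_dvd] at h
    obtain ⟨m, hm⟩ := h
    obtain ⟨u, hu⟩ := isUnit_iff_exists_inv.1 (isUnit_natCast_pIntegral x.2)
    refine ⟨m * u, ?_⟩
    have h1 : x * ((x : ℚ).den : pIntegral p) = p * m := by
      ext
      push_cast
      rw [Rat.mul_den_eq_num, hm]
      push_cast
      ring
    calc x = x * (((x : ℚ).den : pIntegral p) * u) := by rw [hu, mul_one]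
      _ = _ := by rw [← mul_assoc, h1]; ring
  · rintro ⟨y, rfl⟩
    rw [map_mul, map_natCast, ZMod.natCast_self, zero_mul]

theorem natCast_dvd_iff_map_reduction_eq_zero (f : (pIntegral p)⟦X⟧) :
    (p : (pIntegral p)⟦X⟧) ∣ f ↔ PowerSeries.map (pIntegralReduction p) f = 0 := by
  rw [natCast_dvd_iff_forall_coeff, PowerSeries.ext_iff]
  simp [← pIntegralReduction_eq_zero_iff]

theorem congModPow_iff (m : ℕ) (f g : (pIntegral p)⟦X⟧) :
    CongModPow p m f g ↔ (p : (pIntegral p)⟦X⟧) ^ m ∣ f - g := by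
  rw [← Nat.cast_pow, natCast_dvd_iff_forall_coeff]
  simp [CongModPow]

end PIntegral

/-! ### Modular forms with p-integral coefficients -/

section ModularExpansions
open UpperHalfPlane ModularForm EisensteinSeries
variable {p : ℕ} [hp : Fact p.Prime]

theorem map_pIntegralToComplex_injective :
    Function.Injective (PowerSeries.map (pIntegralToComplex p)) := fun f g h => by
  ext n
  have := congrArg (coeff n) h
  simp only [coeff_map] at this
  exact congrArg _ (pIntegralToComplex_injective this)

variable (p) in
/-- `f` is the expansion of a modular form of weight `w` with `p`-integral coefficients. -/
def IsIntegralForm (w : ℕ) (f : (pIntegral p)⟦X⟧) : Prop := f ∈ modularExpansions p w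

theorem IsIntegralForm.of_weight_eq {a b : ℕ} {f : (pIntegral p)⟦X⟧}
    (hf : IsIntegralForm p a f) (h : a = b) : IsIntegralForm p b f := h ▸ hf

theorem IsIntegralForm.of_int_weight {a : ℤ} {b : ℕ} {f : (pIntegral p)⟦X⟧}
    (F : ModularForm 𝒮ℒ a) (hF : qExpansion 1 F = PowerSeries.map (pIntegralToComplex p) f)
    (h : a = b) : IsIntegralForm p b f := by
  subst h
  exact ⟨F, hF⟩

theorem IsIntegralForm.add {w : ℕ} {f g : (pIntegral p)⟦X⟧} (hf : IsIntegralForm p w f)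
    (hg : IsIntegralForm p w g) : IsIntegralForm p w (f + g) := by
  obtain ⟨F, hF⟩ := hf
  obtain ⟨G, hG⟩ := hg
  refine ⟨F + G, ?_⟩
  rw [map_add, ← hF, ← hG]
  exact ModularForm.qExpansion_add one_pos one_mem_strictPeriods_SL F G

theorem IsIntegralForm.zero (w : ℕ) : IsIntegralForm p w (0 : (pIntegral p)⟦X⟧) :=
  ⟨0, by rw [map_zero]; exact qExpansion_zero 1⟩

theorem IsIntegralForm.C_mul {w : ℕ} {f : (pIntegral p)⟦X⟧} (a : pIntegral p)
    (hf : IsIntegralForm p w f) : IsIntegralForm p w (C a * f) := by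
  obtain ⟨F, hF⟩ := hf
  refine ⟨pIntegralToComplex p a • F, ?_⟩
  rw [map_mul, ← hF, map_C, ← smul_eq_C_mul]
  exact ModularForm.qExpansion_smul one_pos one_mem_strictPeriods_SL _ F

theorem IsIntegralForm.natCast_mul {w : ℕ} {f : (pIntegral p)⟦X⟧} (a : ℕ)
    (hf : IsIntegralForm p w f) : IsIntegralForm p w ((a : (pIntegral p)⟦X⟧) * f) := by
  simpa using hf.C_mul (a : pIntegral p)

theorem IsIntegralForm.neg {w : ℕ} {f : (pIntegral p)⟦X⟧}
    (hf : IsIntegralForm p w f) : IsIntegralForm p w (-f) := by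
  simpa using hf.C_mul (-1)

theorem IsIntegralForm.sub {w : ℕ} {f g : (pIntegral p)⟦X⟧} (hf : IsIntegralForm p w f)
    (hg : IsIntegralForm p w g) : IsIntegralForm p w (f - g) := by
  rw [sub_eq_add_neg]
  exact hf.add hg.neg

theorem IsIntegralForm.mul {a b : ℕ} {f g : (pIntegral p)⟦X⟧}
    (hf : IsIntegralForm p a f) (hg : IsIntegralForm p b g) :
    IsIntegralForm p (a + b) (f * g) := by
  obtain ⟨F, hF⟩ := hf
  obtain ⟨G, hG⟩ := hg
  refine .of_int_weight (F.mul G) ?_ (Nat.cast_add a b).symm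
  rw [map_mul, ← hF, ← hG]
  exact ModularForm.qExpansion_mul one_pos one_mem_strictPeriods_SL F G

theorem IsIntegralForm.one : IsIntegralForm p 0 (1 : (pIntegral p)⟦X⟧) := by
  refine .of_int_weight (1 : ModularForm 𝒮ℒ 0) ?_ rfl
  rw [map_one]
  exact ModularForm.qExpansion_one

theorem IsIntegralForm.C (a : pIntegral p) :
    IsIntegralForm p 0 (PowerSeries.C a : (pIntegral p)⟦X⟧) := by
  simpa using IsIntegralForm.one.C_mul a

theorem IsIntegralForm.pow {a : ℕ} {f : (pIntegral p)⟦X⟧}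
    (hf : IsIntegralForm p a f) (n : ℕ) : IsIntegralForm p (n * a) (f ^ n) := by
  induction n with
  | zero => simpa using IsIntegralForm.one
  | succ n ih =>
    rw [pow_succ]
    exact (ih.mul hf).of_weight_eq (by ring)

/-- `M_k` is saturated: divisibility of the expansion by `p` can be cancelled. -/
theorem IsIntegralForm.of_natCast_mul {w : ℕ} {f : (pIntegral p)⟦X⟧} {a : ℕ} (ha : a ≠ 0)
    (hf : IsIntegralForm p w ((a : (pIntegral p)⟦X⟧) * f)) : IsIntegralForm p w f := by
  obtain ⟨F, hF⟩ := hf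
  refine ⟨(a : ℂ)⁻¹ • F, ?_⟩
  have h := ModularForm.qExpansion_smul one_pos one_mem_strictPeriods_SL (a : ℂ)⁻¹ F
  refine h.trans ?_
  rw [hF, map_mul, map_natCast, smul_eq_C_mul, ← mul_assoc,
    show (a : ℂ⟦X⟧) = PowerSeries.C (a : ℂ) by simp, ← map_mul,
    inv_mul_cancel₀ (Nat.cast_ne_zero.2 ha), map_one, one_mul]

theorem IsIntegralForm.eq_zero_of_forall {w : ℕ} {f : (pIntegral p)⟦X⟧}
    (hf : IsIntegralForm p w f) (h : ∀ F : ModularForm 𝒮ℒ (w : ℤ), F = 0) : f = 0 := by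
  obtain ⟨F, hF⟩ := hf
  apply map_pIntegralToComplex_injective
  rw [← hF, h F, map_zero]
  exact qExpansion_zero 1

theorem IsIntegralForm.weight_two {f : (pIntegral p)⟦X⟧} (hf : IsIntegralForm p 2 f) :
    f = 0 :=
  hf.eq_zero_of_forall (rank_zero_iff_forall_zero.1 levelOne_weight_two_rank_zero)

theorem IsIntegralForm.odd {w : ℕ} (hw : Odd w) {f : (pIntegral p)⟦X⟧}
    (hf : IsIntegralForm p w f) : f = 0 :=
  hf.eq_zero_of_forall (ModularForm.levelOne_odd_weight_eq_zero (by exact_mod_cast hw))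

/-- The power series of the weight four Eisenstein series. -/
noncomputable def eisensteinFourSeries (R : Type*) [CommRing R] : R⟦X⟧ :=
  PowerSeries.mk fun m => if m = 0 then 1 else 240 * (ArithmeticFunction.sigma 3 m : R)

/-- The power series of the weight six Eisenstein series. -/
noncomputable def eisensteinSixSeries (R : Type*) [CommRing R] : R⟦X⟧ :=
  PowerSeries.mk fun m => if m = 0 then 1 else -504 * (ArithmeticFunction.sigma 5 m : R)

@[simp] theorem map_eisensteinTwoSeries {R S : Type*} [CommRing R] [CommRing S] (φ : R →+* S) :
    PowerSeries.map φ (eisensteinTwoSeries R) = eisensteinTwoSeries S := by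
  ext n
  have h : φ 24 = 24 := map_ofNat φ 24
  simp [eisensteinTwoSeries, apply_ite φ, h]

@[simp] theorem map_eisensteinFourSeries {R S : Type*} [CommRing R] [CommRing S] (φ : R →+* S) :
    PowerSeries.map φ (eisensteinFourSeries R) = eisensteinFourSeries S := by
  ext n
  have h : φ 240 = 240 := map_ofNat φ 240
  simp [eisensteinFourSeries, apply_ite φ, h]

@[simp] theorem map_eisensteinSixSeries {R S : Type*} [CommRing R] [CommRing S] (φ : R →+* S) :
    PowerSeries.map φ (eisensteinSixSeries R) = eisensteinSixSeries S := by
  ext n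
  have h : φ 504 = 504 := map_ofNat φ 504
  simp [eisensteinSixSeries, apply_ite φ, h]

@[simp] theorem constantCoeff_eisensteinTwoSeries (R : Type*) [CommRing R] :
    constantCoeff (eisensteinTwoSeries R) = 1 := by
  rw [← coeff_zero_eq_constantCoeff_apply]; simp [eisensteinTwoSeries]

@[simp] theorem constantCoeff_eisensteinFourSeries (R : Type*) [CommRing R] :
    constantCoeff (eisensteinFourSeries R) = 1 := by
  rw [← coeff_zero_eq_constantCoeff_apply]; simp [eisensteinFourSeries]

@[simp] theorem constantCoeff_eisensteinSixSeries (R : Type*) [CommRing R] :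
    constantCoeff (eisensteinSixSeries R) = 1 := by
  rw [← coeff_zero_eq_constantCoeff_apply]; simp [eisensteinSixSeries]

theorem qExpansion_E₄ : qExpansion 1 E₄ = eisensteinFourSeries ℂ := by
  ext n
  rw [E_qExpansion_coeff _ ⟨2, rfl⟩, show bernoulli 4 = -1 / 30 by decide +kernel,
    eisensteinFourSeries, coeff_mk]
  norm_num

theorem qExpansion_E₆ : qExpansion 1 E₆ = eisensteinSixSeries ℂ := by
  ext n
  rw [E_qExpansion_coeff _ ⟨3, rfl⟩, show bernoulli 6 = 1 / 42 by decide +kernel,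
    eisensteinSixSeries, coeff_mk]
  norm_num

theorem eisensteinFourSeries_mem : IsIntegralForm p 4 (eisensteinFourSeries (pIntegral p)) :=
  .of_int_weight E₄ (by rw [qExpansion_E₄, map_eisensteinFourSeries]) rfl

theorem eisensteinSixSeries_mem : IsIntegralForm p 6 (eisensteinSixSeries (pIntegral p)) :=
  .of_int_weight E₆ (by rw [qExpansion_E₆, map_eisensteinSixSeries]) rfl

/-- The power series of the discriminant. -/
noncomputable def discriminantSeries (R : Type*) [CommRing R] : R⟦X⟧ :=
  PowerSeries.C (Ring.inverse 1728) * (eisensteinFourSeries R ^ 3 - eisensteinSixSeries R ^ 2)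

theorem qExpansion_discriminant : qExpansion 1 discriminant = discriminantSeries ℂ := by
  have h4 := ModularForm.hasQSeries E₄
  have h6 := ModularForm.hasQSeries E₆
  rw [qExpansion_E₄] at h4
  rw [qExpansion_E₆] at h6
  have h := ((h4.mul (h4.mul h4)).sub (h6.mul h6)).smul (Ring.inverse 1728)
  have h1 : (Ring.inverse 1728 : ℂ) •
      ((E₄ : ℍ → ℂ) * ((E₄ : ℍ → ℂ) * (E₄ : ℍ → ℂ)) - (E₆ : ℍ → ℂ) * (E₆ : ℍ → ℂ)) =
      CuspForm.discriminant := by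
    ext z
    have hz := discriminant_eq_E₄_cube_sub_E₆_sq z
    simp only [Pi.smul_apply, Pi.sub_apply, Pi.mul_apply, Ring.inverse_eq_inv', smul_eq_mul]
    refine Eq.trans ?_ hz.symm
    ring
  rw [h1] at h
  have h2 : discriminantSeries ℂ = (Ring.inverse 1728 : ℂ) •
      (eisensteinFourSeries ℂ * (eisensteinFourSeries ℂ * eisensteinFourSeries ℂ) -
        eisensteinSixSeries ℂ * eisensteinSixSeries ℂ) := by
    rw [discriminantSeries, smul_eq_C_mul]
    ring
  rw [h2]
  ext m
  exact (ModularFormClass.qExpansion_coeff_unique (f := CuspForm.discriminant) one_pos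
    one_mem_strictPeriods_SL h m).symm

theorem isUnit_ofNat_pIntegral_of_five_le (hp5 : 5 ≤ p) (a b : ℕ) :
    IsUnit (2 ^ a * 3 ^ b : pIntegral p) := by
  have h2 := isUnit_natCast_pIntegral (p := p) (n := 2)
    (fun h => by have := Nat.le_of_dvd two_pos h; omega)
  have h3 := isUnit_natCast_pIntegral (p := p) (n := 3)
    (fun h => by have := Nat.le_of_dvd three_pos h; omega)
  push_cast at h2 h3
  exact (h2.pow a).mul (h3.pow b)

theorem map_ringInverse {R S : Type*} [CommRing R] [CommRing S] (φ : R →+* S) {a : R}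
    (ha : IsUnit a) : φ (Ring.inverse a) = Ring.inverse (φ a) := by
  have h1 := congrArg φ (Ring.mul_inverse_cancel a ha)
  rw [map_mul, map_one] at h1
  have h2 := Ring.inverse_mul_cancel (φ a) (ha.map φ)
  calc φ (Ring.inverse a) = (Ring.inverse (φ a) * φ a) * φ (Ring.inverse a) := by rw [h2, one_mul]
    _ = _ := by rw [mul_assoc, h1, mul_one]

theorem map_discriminantSeries (hp5 : 5 ≤ p) {S : Type*} [CommRing S] (φ : pIntegral p →+* S) :
    PowerSeries.map φ (discriminantSeries (pIntegral p)) = discriminantSeries S := by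
  have h : IsUnit (1728 : pIntegral p) := by
    have := isUnit_ofNat_pIntegral_of_five_le hp5 6 3
    norm_num at this
    exact this
  have h2 : φ 1728 = 1728 := map_ofNat φ 1728
  simp [discriminantSeries, map_ringInverse φ h, h2]

theorem exists_discriminantSeries_eq (hp5 : 5 ≤ p) : ∃ u : (pIntegral p)⟦X⟧, IsUnit u ∧
    discriminantSeries (pIntegral p) = X * u := by
  have h0 : constantCoeff (discriminantSeries (pIntegral p)) = 0 := by
    simp [discriminantSeries]
  obtain ⟨u, hu⟩ := X_dvd_iff.2 h0
  refine ⟨u, ?_, hu⟩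
  have h1 : coeff 1 (discriminantSeries (pIntegral p)) = 1 := by
    apply pIntegralToComplex_injective
    rw [← coeff_map, map_discriminantSeries hp5, ← qExpansion_discriminant,
      discriminant_qExpansion_coeff_one, map_one]
  rw [hu, ← zero_add 1, coeff_succ_X_mul] at h1
  rw [isUnit_iff_constantCoeff, ← coeff_zero_eq_constantCoeff_apply, h1]
  exact isUnit_one

/-- Division by Δ preserves integrality because Δ is q times a unit of the power series ring. This
drives the inductions on the weight, and in weight below 12 it forces cusp forms to vanish. -/
theorem IsIntegralForm.exists_eq_discriminant_mul (hp5 : 5 ≤ p) {w : ℕ} {f : (pIntegral p)⟦X⟧}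
    (hf : IsIntegralForm p w f) (h0 : constantCoeff f = 0) :
    f = 0 ∨ ∃ v, w = v + 12 ∧ ∃ g, IsIntegralForm p v g ∧
      f = discriminantSeries (pIntegral p) * g := by
  obtain ⟨F, hF⟩ := hf
  have hc : (qExpansion 1 F).coeff 0 = 0 := by
    rw [hF, coeff_map, coeff_zero_eq_constantCoeff_apply, h0, map_zero]
  have hq := qExpansion_eq_qExpansion_discriminant_mul F hc
  set G := CuspForm.discriminantEquiv (toCuspForm F hc)
  rcases lt_or_ge w 12 with hw | hw
  · left
    have hG : G = 0 := rank_zero_iff_forall_zero.1 (levelOne_neg_weight_rank_zero (by lia)) G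
    apply map_pIntegralToComplex_injective
    rw [← hF, hq, hG, map_zero]
    have : qExpansion 1 ((0 : ModularForm 𝒮ℒ ((w : ℤ) - 12)) : ℍ → ℂ) = 0 := qExpansion_zero 1
    rw [this, mul_zero]
  · right
    obtain ⟨v, rfl⟩ := Nat.exists_eq_add_of_le' hw
    refine ⟨v, rfl, ?_⟩
    obtain ⟨u, hu, hΔ⟩ := exists_discriminantSeries_eq (p := p) hp5
    obtain ⟨u', hu'⟩ := isUnit_iff_exists_inv.1 hu
    obtain ⟨f', rfl⟩ := X_dvd_iff.2 h0
    have hfac : X * f' = discriminantSeries (pIntegral p) * (u' * f') := by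
      rw [hΔ, mul_assoc, ← mul_assoc u, hu', one_mul]
    refine ⟨u' * f', .of_int_weight G ?_ (by push_cast; ring), hfac⟩
    rw [hfac, map_mul, map_discriminantSeries hp5, ← qExpansion_discriminant] at hF
    have hne : qExpansion 1 discriminant ≠ 0 := fun h => by
      have := discriminant_qExpansion_coeff_one
      rw [h, map_zero] at this
      exact zero_ne_one this
    exact mul_left_cancel₀ hne (hq.symm.trans hF)

end ModularExpansions

/-! ### Serre derivative on expansions and Ramanujan's identities -/

section SerreDerivative
open UpperHalfPlane ModularForm EisensteinSeries
variable {p : ℕ} [hp : Fact p.Prime]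

/-- The quasimodular form `E₂ / 12`. -/
noncomputable def twelfthE2 (R : Type*) [CommRing R] : R⟦X⟧ :=
  PowerSeries.C (Ring.inverse 12) * eisensteinTwoSeries R

theorem isUnit_twelve (hp5 : 5 ≤ p) : IsUnit (12 : pIntegral p) := by
  have := isUnit_ofNat_pIntegral_of_five_le hp5 2 1
  norm_num at this
  exact this

theorem map_twelfthE2 (hp5 : 5 ≤ p) {S : Type*} [CommRing S] (φ : pIntegral p →+* S) :
    PowerSeries.map φ (twelfthE2 (pIntegral p)) = twelfthE2 S := by
  have h2 : φ 12 = 12 := map_ofNat φ 12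
  simp [twelfthE2, map_ringInverse φ (isUnit_twelve hp5), h2]

theorem twelve_mul_twelfthE2 {R : Type*} [CommRing R] (h : IsUnit (12 : R)) :
    12 * twelfthE2 R = eisensteinTwoSeries R := by
  rw [twelfthE2, ← mul_assoc, show (12 : R⟦X⟧) = PowerSeries.C 12 from (map_ofNat _ 12).symm,
    ← map_mul, Ring.mul_inverse_cancel 12 h, map_one, one_mul]

/-- The Serre derivative on `q`-expansions of weight `w`. -/
noncomputable def serreTheta {R : Type*} [CommRing R] (w : ℕ) (f : R⟦X⟧) : R⟦X⟧ :=
  thetaOp f - (w : R⟦X⟧) * twelfthE2 R * f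

theorem IsIntegralForm.serreTheta (hp5 : 5 ≤ p) {w : ℕ} {f : (pIntegral p)⟦X⟧}
    (hf : IsIntegralForm p w f) : IsIntegralForm p (w + 2) (serreTheta w f) := by
  obtain ⟨F, hF⟩ := hf
  obtain ⟨H, hH⟩ := exists_modularForm_serreDerivative F
  refine .of_int_weight H ?_ (by push_cast; ring)
  rw [hH, hF, _root_.serreTheta, map_sub, map_mul, map_mul, map_thetaOp, map_natCast,
    map_twelfthE2 hp5, twelfthE2, smul_eq_C_mul, Ring.inverse_eq_inv', div_eq_mul_inv, map_mul]
  simp [mul_assoc]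

/-- The weight four form `E₄ / 144`, written in terms of `E₂`. -/
noncomputable def quasiDefect (R : Type*) [CommRing R] : R⟦X⟧ :=
  twelfthE2 R * twelfthE2 R - thetaOp (twelfthE2 R)

theorem isIntegralForm_quasiDefect (hp5 : 5 ≤ p) :
    IsIntegralForm p 4 (quasiDefect (pIntegral p)) := by
  obtain ⟨H, hH⟩ := exists_modularForm_E2
  refine IsIntegralForm.of_natCast_mul (a := 144) (by norm_num) ?_
  refine .of_int_weight H ?_ rfl
  have h := congrArg (PowerSeries.map (pIntegralToComplex p))
    (twelve_mul_twelfthE2 (isUnit_twelve hp5))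
  rw [map_mul, map_eisensteinTwoSeries, map_twelfthE2 hp5, map_ofNat] at h
  rw [hH, map_mul, map_natCast, quasiDefect, map_sub, map_mul, map_thetaOp, map_twelfthE2 hp5,
    smul_eq_C_mul, ← h]
  have h12 : thetaOp ((12 : ℂ⟦X⟧) * twelfthE2 ℂ) = 12 * thetaOp (twelfthE2 ℂ) := by
    simpa using thetaOp_natCast_mul 12 (twelfthE2 ℂ)
  rw [h12, show PowerSeries.C (12 : ℂ) = (12 : ℂ⟦X⟧) from map_ofNat _ 12]
  push_cast
  ring

/-- Three times the Serre derivative of E₄, plus E₆, has weight 6 and constant term zero, hence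
vanishes. -/
theorem thetaOp_eisensteinFourSeries (hp5 : 5 ≤ p) :
    3 * thetaOp (eisensteinFourSeries (pIntegral p)) =
      12 * twelfthE2 (pIntegral p) * eisensteinFourSeries (pIntegral p)
        - eisensteinSixSeries (pIntegral p) := by
  have h1 := ((eisensteinFourSeries_mem (p := p)).serreTheta hp5).natCast_mul 3
  have h2 := h1.add eisensteinSixSeries_mem
  have h3 := constantCoeff_eisensteinTwoSeries (pIntegral p)
  rw [← twelve_mul_twelfthE2 (isUnit_twelve hp5), map_mul, map_ofNat] at h3
  have h4 : constantCoeff (thetaOp (eisensteinFourSeries (pIntegral p))) = 0 := by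
    rw [← coeff_zero_eq_constantCoeff_apply]; simp
  rcases h2.exists_eq_discriminant_mul hp5 (by
    simp only [serreTheta, map_add, map_mul, map_sub, map_natCast, h4,
      constantCoeff_eisensteinFourSeries, constantCoeff_eisensteinSixSeries]
    push_cast
    linear_combination -h3) with h | ⟨v, hv, -⟩
  · rw [serreTheta] at h
    push_cast at h
    linear_combination h
  · omega

/-- The same argument in weight 8. -/
theorem thetaOp_eisensteinSixSeries (hp5 : 5 ≤ p) :
    2 * thetaOp (eisensteinSixSeries (pIntegral p)) =
      12 * twelfthE2 (pIntegral p) * eisensteinSixSeries (pIntegral p)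
        - eisensteinFourSeries (pIntegral p) ^ 2 := by
  have h1 := ((eisensteinSixSeries_mem (p := p)).serreTheta hp5).natCast_mul 2
  have h2 := h1.add ((eisensteinFourSeries_mem (p := p)).mul eisensteinFourSeries_mem)
  have h3 := constantCoeff_eisensteinTwoSeries (pIntegral p)
  rw [← twelve_mul_twelfthE2 (isUnit_twelve hp5), map_mul, map_ofNat] at h3
  have h4 : constantCoeff (thetaOp (eisensteinSixSeries (pIntegral p))) = 0 := by
    rw [← coeff_zero_eq_constantCoeff_apply]; simp
  rcases h2.exists_eq_discriminant_mul hp5 (by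
    simp only [serreTheta, map_add, map_mul, map_sub, map_natCast, h4,
      constantCoeff_eisensteinFourSeries, constantCoeff_eisensteinSixSeries]
    push_cast
    linear_combination -h3) with h | ⟨v, hv, -⟩
  · rw [serreTheta] at h
    push_cast at h
    linear_combination h
  · omega

end SerreDerivative

/-! ### The Eisenstein series of weight p - 1 -/

section Hasse
open UpperHalfPlane ModularForm EisensteinSeries
variable {p : ℕ} [hp : Fact p.Prime]

theorem isUnit_of_reduction_ne_zero {x : pIntegral p} (hx : pIntegralReduction p x ≠ 0) :
    IsUnit x := by
  have h1 : x * ((x : ℚ).den : pIntegral p) = ((x : ℚ).num : pIntegral p) := by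
    ext
    push_cast
    rw [Rat.mul_den_eq_num]
  have h2 : IsUnit ((x : ℚ).num : pIntegral p) := by
    have h3 : IsUnit (((x : ℚ).num.natAbs : ℕ) : pIntegral p) := by
      refine isUnit_natCast_pIntegral fun h => hx ?_
      rw [pIntegralReduction_eq_zero_iff]
      obtain ⟨m, hm⟩ := Int.natCast_dvd.2 h
      have hd := isUnit_natCast_pIntegral x.2
      rw [← hd.dvd_mul_right, h1, hm]
      push_cast
      exact dvd_mul_right _ _
    rcases Int.natAbs_eq (x : ℚ).num with h | h
    · rw [h, Int.cast_natCast]; exact h3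
    · rw [h, Int.cast_neg, Int.cast_natCast]; exact h3.neg
  rw [← h1] at h2
  exact isUnit_of_mul_isUnit_left h2

/-- By von Staudt–Clausen the prime p contributes -1/p to the Bernoulli number of index p - 1, and
every other contribution is p-integral. -/
theorem exists_bernoulli_pred_eq (hp5 : 5 ≤ p) : ∃ r : pIntegral p,
    (p : ℚ) * bernoulli (p - 1) = -1 + p * r := by
  obtain ⟨k, hk⟩ : Even (p - 1) := hp.out.even_sub_one (by omega)
  have hk2 : p - 1 = 2 * k := by omega
  obtain ⟨z, hz⟩ := Bernoulli.vonStaudt_clausen k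
  have hmem : p ∈ (Finset.range (2 * k + 2)).filter fun q => q.Prime ∧ (q - 1) ∣ 2 * k := by
    simp only [Finset.mem_filter, Finset.mem_range]
    exact ⟨by omega, hp.out, by rw [hk2]⟩
  rw [← Finset.add_sum_erase _ _ hmem, ← hk2] at hz
  set s := ((Finset.range (p - 1 + 2)).filter fun q => q.Prime ∧ (q - 1) ∣ p - 1).erase p
  have hs : ∑ q ∈ s, (1 : ℚ) / q ∈ pIntegral p := by
    refine Subring.sum_mem _ fun q hq => ?_
    have hq1 : q.Prime ∧ q ≠ p := by
      simp only [s, Finset.mem_erase, Finset.mem_filter] at hq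
      tauto
    change ¬ p ∣ (1 / q : ℚ).den
    rw [one_div, Rat.inv_natCast_den_of_pos hq1.1.pos]
    exact fun h => hq1.2 ((Nat.prime_dvd_prime_iff_eq hp.out hq1.1).1 h).symm
  refine ⟨(z : pIntegral p) - ⟨_, hs⟩, ?_⟩
  have hp0 : (p : ℚ) ≠ 0 := Nat.cast_ne_zero.2 hp.out.ne_zero
  push_cast
  rw [hz]
  field_simp
  ring

/-- The Eisenstein series `E_{p-1}` is `1 + pκ` with `κ ≡ -2 ∑ σ_{p-2}(n) qⁿ`. -/
theorem exists_hasse_form (hp5 : 5 ≤ p) : ∃ κ : (pIntegral p)⟦X⟧,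
    IsIntegralForm p (p - 1) (1 + (p : (pIntegral p)⟦X⟧) * κ) ∧
    ∀ n, pIntegralReduction p (coeff n κ) =
      if n = 0 then 0 else -2 * (ArithmeticFunction.sigma (p - 2) n : ZMod p) := by
  obtain ⟨r, hr⟩ := exists_bernoulli_pred_eq (p := p) hp5
  have hu : IsUnit (-1 + p * r : pIntegral p) := isUnit_of_reduction_ne_zero (by simp)
  obtain ⟨v, hv⟩ := isUnit_iff_exists_inv.1 hu
  have hvr : pIntegralReduction p v = -1 := by
    have := congrArg (pIntegralReduction p) hv
    simp at this
    rw [← neg_eq_iff_eq_neg, this]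
  have hcast : ((p - 1 : ℕ) : ZMod p) = -1 := by
    rw [Nat.cast_sub hp.out.one_lt.le]; simp
  -- Here v is the inverse of p B_{p-1}, so these are the coefficients of E_{p-1} divided by p.
  -- Modulo p both v and p - 1 are -1, leaving the factor -2.
  refine ⟨PowerSeries.mk fun n => if n = 0 then 0 else
    -2 * ((p - 1 : ℕ) : pIntegral p) * v * (ArithmeticFunction.sigma (p - 2) n : pIntegral p),
    ?_, fun n => ?_⟩
  · have h3 : 3 ≤ p - 1 := by omega
    refine .of_int_weight (E h3) ?_ rfl
    ext n
    have hB : (p : ℂ) * (bernoulli (p - 1) : ℂ) = pIntegralToComplex p (-1 + p * r) := by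
      have h1 : (((-1 + p * r : pIntegral p) : ℚ) : ℂ) = (p : ℂ) * (bernoulli (p - 1) : ℂ) := by
        push_cast
        exact_mod_cast hr.symm
      exact h1.symm
    have hv' : pIntegralToComplex p (-1 + p * r) * pIntegralToComplex p v = 1 := by
      rw [← map_mul, hv, map_one]
    rw [← hB] at hv'
    have hB0 : (bernoulli (p - 1) : ℂ) ≠ 0 := by
      intro h; rw [h] at hv'; simp at hv'
    rw [E_qExpansion_coeff h3 (hp.out.even_sub_one (by omega)), coeff_map,
      show (p : (pIntegral p)⟦X⟧) = PowerSeries.C (p : pIntegral p) by simp, map_add, coeff_C_mul,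
      coeff_mk, coeff_one]
    rcases eq_or_ne n 0 with rfl | hn
    · simp
    · have h2 : pIntegralToComplex p 2 = 2 := map_ofNat _ 2
      simp only [hn, if_false, zero_add, map_mul, map_neg, map_natCast, h2,
        show p - 1 - 1 = p - 2 by omega]
      field_simp
      linear_combination (((p - 1 : ℕ) : ℂ) * (ArithmeticFunction.sigma (p - 2) n : ℂ)) * hv'
  · rw [coeff_mk]
    have h2 : pIntegralReduction p 2 = 2 := map_ofNat _ 2
    split_ifs
    · simp
    · simp only [map_mul, map_neg, map_natCast, h2, hvr, hcast]
      ring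

end Hasse

/-! ### Congruences between κ and E₂ modulo p -/

section FrobeniusPower
variable {p : ℕ} [hp : Fact p.Prime]

theorem coeff_pow_char (f : (ZMod p)⟦X⟧) (n : ℕ) :
    coeff n (f ^ p) = if p ∣ n then coeff (n / p) f else 0 := by
  have h := MvPowerSeries.map_frobenius_expand (p := p) (hp := hp.out.ne_zero) (f := f)
  have h2 : frobenius (ZMod p) p = RingHom.id _ :=
    RingHom.ext fun x => by simp
  rw [h2, MvPowerSeries.map_id] at h
  have h3 : f.expand p hp.out.ne_zero = f ^ p := h
  rw [← h3, coeff_expand]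

/-- A divisor of pm that does not divide m is divisible by p. -/
theorem sigma_prime_mul (k : ℕ) (hk : k ≠ 0) {m : ℕ} (hm : m ≠ 0) :
    (ArithmeticFunction.sigma k (p * m) : ZMod p) = ArithmeticFunction.sigma k m := by
  rw [ArithmeticFunction.sigma_apply, ArithmeticFunction.sigma_apply]
  push_cast
  symm
  refine Finset.sum_subset (Nat.divisors_subset_of_dvd (mul_ne_zero hp.out.ne_zero hm)
    (dvd_mul_left _ _)) fun d hd hdm => ?_
  have h1 := Nat.dvd_of_mem_divisors hd
  have h2 : p ∣ d := by
    by_contra h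
    exact hdm (Nat.mem_divisors.2
      ⟨(((Nat.Prime.coprime_iff_not_dvd hp.out).2 h).symm.dvd_of_dvd_mul_left h1), hm⟩)
  rw [(ZMod.natCast_eq_zero_iff _ _).2 h2, zero_pow hk]

theorem natCast_pow_pred_eq_one {d : ℕ} (h : ¬ p ∣ d) : (d : ZMod p) ^ (p - 1) = 1 :=
  ZMod.pow_card_sub_one_eq_one fun h2 => h ((ZMod.natCast_eq_zero_iff _ _).1 h2)

/-- By Fermat, n d^(p-2) is n/d modulo p for each divisor d of n. -/
theorem natCast_mul_sigma {n : ℕ} (hn : ¬ p ∣ n) (hp2 : 2 ≤ p) :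
    (n : ZMod p) * ArithmeticFunction.sigma (p - 2) n = ArithmeticFunction.sigma 1 n := by
  rw [ArithmeticFunction.sigma_apply, ArithmeticFunction.sigma_one_apply,
    ← Nat.sum_div_divisors n (fun d => d)]
  push_cast
  rw [Finset.mul_sum]
  refine Finset.sum_congr rfl fun d hd => ?_
  have h1 := Nat.dvd_of_mem_divisors hd
  have h2 : ¬ p ∣ d := fun h => hn (h.trans h1)
  obtain ⟨e, rfl⟩ := h1
  have hd0 : 0 < d := Nat.pos_of_ne_zero (by rintro rfl; simp at h2)
  rw [Nat.mul_div_cancel_left _ hd0]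
  have h3 := natCast_pow_pred_eq_one h2
  rw [show p - 1 = p - 2 + 1 by omega, pow_succ] at h3
  push_cast
  linear_combination (e : ZMod p) * h3

theorem isUnit_twelve_zmod (hp5 : 5 ≤ p) : IsUnit (12 : ZMod p) := by
  have := (isUnit_twelve (p := p) hp5).map (pIntegralReduction p)
  rwa [map_ofNat] at this

theorem coeff_twelfthE2 (hp5 : 5 ≤ p) {n : ℕ} (hn : n ≠ 0) :
    coeff n (twelfthE2 (ZMod p)) = -2 * (ArithmeticFunction.sigma 1 n : ZMod p) := by
  have h := congrArg (coeff n) (twelve_mul_twelfthE2 (isUnit_twelve_zmod (p := p) hp5))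
  rw [show (12 : (ZMod p)⟦X⟧) = C 12 from (map_ofNat _ 12).symm, coeff_C_mul, eisensteinTwoSeries,
    coeff_mk, if_neg hn] at h
  have h12 := isUnit_twelve_zmod (p := p) hp5
  refine h12.mul_left_cancel ?_
  rw [h]
  ring

/-- For n > 0 the coefficients of κ and y modulo p are -2σ_{p-2}(n) and -2σ₁(n). Away from p they
differ by the factor n; at indices pm each agrees with its value at m, which is what subtracting the
p-th power removes. The first identity controls y modulo p². The second is an Artin–Schreier
equation for κ, used to show that κ is not a quotient of forms of the wrong weights. -/
theorem exists_hasseQuotient (hp5 : 5 ≤ p) : ∃ κ : (pIntegral p)⟦X⟧,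
    IsIntegralForm p (p - 1) (1 + (p : (pIntegral p)⟦X⟧) * κ) ∧
    thetaOp (PowerSeries.map (pIntegralReduction p) κ) =
      twelfthE2 (ZMod p) - twelfthE2 (ZMod p) ^ p ∧
    PowerSeries.map (pIntegralReduction p) κ - PowerSeries.map (pIntegralReduction p) κ ^ p =
      thetaOp^[p - 2] (twelfthE2 (ZMod p)) := by
  obtain ⟨κ, hκ, hc⟩ := exists_hasse_form (p := p) hp5
  refine ⟨κ, hκ, ?_, ?_⟩
  · ext n
    rw [coeff_thetaOp, coeff_map, hc, map_sub, coeff_pow_char]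
    by_cases hn : p ∣ n
    · obtain ⟨m, rfl⟩ := hn
      rw [if_pos (dvd_mul_right _ _), Nat.mul_div_cancel_left _ hp.out.pos]
      rcases eq_or_ne m 0 with rfl | hm
      · simp
      · rw [coeff_twelfthE2 hp5 hm, coeff_twelfthE2 hp5 (mul_ne_zero hp.out.ne_zero hm),
          sigma_prime_mul 1 one_ne_zero hm]
        simp
    · have hn0 : n ≠ 0 := by rintro rfl; simp at hn
      rw [if_neg hn, if_neg hn0, coeff_twelfthE2 hp5 hn0, ← natCast_mul_sigma hn (by omega)]
      ring
  · ext n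
    rw [map_sub, coeff_pow_char, coeff_map, hc, coeff_iterate_thetaOp, coeff_map, hc]
    by_cases hn : p ∣ n
    · obtain ⟨m, rfl⟩ := hn
      rw [if_pos (dvd_mul_right _ _), Nat.mul_div_cancel_left _ hp.out.pos]
      have h0 : ((p * m : ℕ) : ZMod p) ^ (p - 2) = 0 := by
        rw [Nat.cast_mul, ZMod.natCast_self, zero_mul, zero_pow (by omega)]
      rw [h0, zero_mul]
      rcases eq_or_ne m 0 with rfl | hm
      · simp
      · rw [if_neg hm, if_neg (mul_ne_zero hp.out.ne_zero hm), sigma_prime_mul _ (by omega) hm,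
          sub_self]
    · have hn0 : n ≠ 0 := by rintro rfl; simp at hn
      rw [if_neg hn, if_neg hn0, coeff_twelfthE2 hp5 hn0, ← natCast_mul_sigma hn (by omega)]
      have h3 := natCast_pow_pred_eq_one hn
      rw [show p - 1 = p - 2 + 1 by omega, pow_succ] at h3
      linear_combination (2 * (ArithmeticFunction.sigma (p - 2) n : ZMod p)) * h3

/-- The power series `η` for which `1 + pη` is the Eisenstein series of weight `p - 1`. -/
noncomputable def hasseQuotient (hp5 : 5 ≤ p) : (pIntegral p)⟦X⟧ :=
  (exists_hasseQuotient hp5).choose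

/-- The expansion of the Eisenstein series of weight `p - 1`. -/
noncomputable def hasseForm (hp5 : 5 ≤ p) : (pIntegral p)⟦X⟧ :=
  1 + (p : (pIntegral p)⟦X⟧) * hasseQuotient hp5

theorem isIntegralForm_hasseForm (hp5 : 5 ≤ p) : IsIntegralForm p (p - 1) (hasseForm hp5) :=
  (exists_hasseQuotient hp5).choose_spec.1

theorem thetaOp_map_hasseQuotient (hp5 : 5 ≤ p) :
    thetaOp (PowerSeries.map (pIntegralReduction p) (hasseQuotient hp5)) =
      twelfthE2 (ZMod p) - twelfthE2 (ZMod p) ^ p :=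
  (exists_hasseQuotient hp5).choose_spec.2.1

theorem map_hasseQuotient_sub_pow (hp5 : 5 ≤ p) :
    PowerSeries.map (pIntegralReduction p) (hasseQuotient hp5) -
      PowerSeries.map (pIntegralReduction p) (hasseQuotient hp5) ^ p =
      thetaOp^[p - 2] (twelfthE2 (ZMod p)) :=
  (exists_hasseQuotient hp5).choose_spec.2.2

/-- Modulo `p`, the operator `θ ^ p` is `θ`. -/
theorem iterate_thetaOp_add_pred (f : (ZMod p)⟦X⟧) {a : ℕ} (ha : a ≠ 0) (j : ℕ) :
    thetaOp^[a + j * (p - 1)] f = thetaOp^[a] f := by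
  ext n
  rw [coeff_iterate_thetaOp, coeff_iterate_thetaOp]
  by_cases hn : p ∣ n
  · rw [(ZMod.natCast_eq_zero_iff _ _).2 hn, zero_pow ha, zero_pow (by omega)]
  · rw [pow_add, mul_comm j, pow_mul, natCast_pow_pred_eq_one hn, one_pow, mul_one]

end FrobeniusPower

/-! ### Reductions modulo p as polynomials in E₄ and E₆ -/

section GradedPolynomials
variable {p : ℕ} [hp : Fact p.Prime]

/-- `P` is a polynomial in two variables of weights `4` and `6`, homogeneous of weight `w`. -/
abbrev IsGraded {K : Type*} [CommRing K] (P : MvPolynomial (Fin 2) K) (w : ℕ) : Prop :=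
  P.IsWeightedHomogeneous ![4, 6] w

variable (p) in
/-- The evaluation at the Eisenstein series of weights `4` and `6` modulo `p`. -/
noncomputable def evalEisenstein : MvPolynomial (Fin 2) (ZMod p) →ₐ[ZMod p] (ZMod p)⟦X⟧ :=
  MvPolynomial.aeval ![eisensteinFourSeries (ZMod p), eisensteinSixSeries (ZMod p)]

@[simp] theorem evalEisenstein_X_zero :
    evalEisenstein p (MvPolynomial.X 0) = eisensteinFourSeries (ZMod p) := by simp [evalEisenstein]

@[simp] theorem evalEisenstein_X_one :
    evalEisenstein p (MvPolynomial.X 1) = eisensteinSixSeries (ZMod p) := by simp [evalEisenstein]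

@[simp] theorem evalEisenstein_C (a : ZMod p) :
    evalEisenstein p (MvPolynomial.C a) = PowerSeries.C a := by
  rw [← MvPolynomial.algebraMap_eq, AlgHom.commutes]
  rfl

theorem isGraded_X_zero {K : Type*} [CommRing K] : IsGraded (MvPolynomial.X 0 : MvPolynomial (Fin 2) K) 4 :=
  MvPolynomial.isWeightedHomogeneous_X K _ 0

theorem isGraded_X_one {K : Type*} [CommRing K] : IsGraded (MvPolynomial.X 1 : MvPolynomial (Fin 2) K) 6 :=
  MvPolynomial.isWeightedHomogeneous_X K _ 1

theorem IsGraded.pow {K : Type*} [CommRing K] {P : MvPolynomial (Fin 2) K} {w : ℕ}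
    (h : IsGraded P w) (n : ℕ) : IsGraded (P ^ n) (n * w) := by
  simpa using MvPolynomial.IsWeightedHomogeneous.pow h n

/-- The polynomial representing the discriminant. -/
noncomputable def discriminantPoly (K : Type*) [CommRing K] : MvPolynomial (Fin 2) K :=
  MvPolynomial.C (Ring.inverse 1728) * (MvPolynomial.X 0 ^ 3 - MvPolynomial.X 1 ^ 2)

theorem isGraded_discriminantPoly {K : Type*} [CommRing K] :
    IsGraded (discriminantPoly K) 12 :=
  MvPolynomial.IsWeightedHomogeneous.C_mul ((isGraded_X_zero.pow 3).sub (isGraded_X_one.pow 2)) _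

theorem evalEisenstein_discriminantPoly :
    evalEisenstein p (discriminantPoly (ZMod p)) = discriminantSeries (ZMod p) := by
  simp [discriminantPoly, discriminantSeries]

/-- Every even weight other than `2` is the weight of a monomial `X₀^a X₁^b`. -/
theorem exists_weight_eq {w : ℕ} (hw : Even w) (h2 : w ≠ 2) : ∃ a b : ℕ, a * 4 + b * 6 = w := by
  obtain ⟨m, rfl⟩ := hw
  rcases Nat.even_or_odd' m with ⟨c, rfl | rfl⟩
  · exact ⟨c, 0, by ring⟩
  · exact ⟨c - 1, 1, by omega⟩

/-- Induction on the weight: remove the constant term with a monomial in E₄ and E₆, then divide by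
Δ. -/
theorem IsIntegralForm.exists_poly (hp5 : 5 ≤ p) {w : ℕ} {f : (pIntegral p)⟦X⟧}
    (hf : IsIntegralForm p w f) : ∃ P : MvPolynomial (Fin 2) (ZMod p), IsGraded P w ∧
      evalEisenstein p P = PowerSeries.map (pIntegralReduction p) f := by
  induction w using Nat.strong_induction_on generalizing f with
  | _ w ih =>
  have hzero : f = 0 → ∃ P : MvPolynomial (Fin 2) (ZMod p), IsGraded P w ∧
      evalEisenstein p P = PowerSeries.map (pIntegralReduction p) f := by
    rintro rfl
    exact ⟨0, MvPolynomial.isWeightedHomogeneous_zero _ _ _, by simp⟩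
  rcases Nat.even_or_odd w with hw | hw
  swap
  · exact hzero (hf.odd hw)
  by_cases h2 : w = 2
  · subst h2
    exact hzero hf.weight_two
  obtain ⟨a, b, rfl⟩ := exists_weight_eq hw h2
  set c := constantCoeff f
  have hm : IsIntegralForm p (a * 4 + b * 6) (PowerSeries.C c *
      (eisensteinFourSeries (pIntegral p) ^ a * eisensteinSixSeries (pIntegral p) ^ b)) :=
    ((eisensteinFourSeries_mem.pow a).mul (eisensteinSixSeries_mem.pow b)).C_mul c
  have hP : IsGraded (MvPolynomial.C (pIntegralReduction p c) * (MvPolynomial.X 0 ^ a * MvPolynomial.X 1 ^ b) :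
      MvPolynomial (Fin 2) (ZMod p)) (a * 4 + b * 6) :=
    MvPolynomial.IsWeightedHomogeneous.C_mul ((isGraded_X_zero.pow a).mul (isGraded_X_one.pow b)) _
  rcases (hf.sub hm).exists_eq_discriminant_mul hp5 (by simp [c]) with h | ⟨v, hv, g, hg, h⟩
  · refine ⟨_, hP, ?_⟩
    rw [sub_eq_zero.1 h]
    simp
  · obtain ⟨Q, hQ, hQg⟩ := ih v (by omega) hg
    refine ⟨_, hP.add (show IsGraded _ _ by
      rw [hv, add_comm v]; exact isGraded_discriminantPoly.mul hQ), ?_⟩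
    rw [eq_add_of_sub_eq h]
    simp [hQg, evalEisenstein_discriminantPoly, map_discriminantSeries hp5, add_comm]

end GradedPolynomials

/-! ### Weighted homogeneous polynomials in two variables -/

section GradedPolynomialsOverField
variable {K : Type*} [Field K]

theorem weight_four_six (d : Fin 2 →₀ ℕ) :
    Finsupp.weight (![4, 6] : Fin 2 → ℕ) d = d 0 * 4 + d 1 * 6 := by
  rw [Finsupp.weight_apply, Finsupp.sum_fintype _ _ (by simp), Fin.sum_univ_two]
  simp

theorem monomial_fin_two_eq {R : Type*} [CommRing R] (d : Fin 2 →₀ ℕ) (c : R) :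
    MvPolynomial.monomial d c =
      MvPolynomial.C c * (MvPolynomial.X 0 ^ d 0 * MvPolynomial.X 1 ^ d 1) := by
  rw [MvPolynomial.monomial_eq, Finsupp.prod_fintype _ _ (by simp), Fin.prod_univ_two]

theorem IsGraded.induction {R : Type*} [CommRing R] {P : MvPolynomial (Fin 2) R} {w : ℕ}
    (hP : IsGraded P w)
    {motive : MvPolynomial (Fin 2) R → Prop} (zero : motive 0)
    (add : ∀ P Q, motive P → motive Q → motive (P + Q))
    (monomial : ∀ c a b, a * 4 + b * 6 = w →
      motive (MvPolynomial.C c * (MvPolynomial.X 0 ^ a * MvPolynomial.X 1 ^ b))) :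
    motive P := by
  rw [P.as_sum]
  refine Finset.sum_induction _ motive add zero fun d hd => ?_
  rw [monomial_fin_two_eq]
  refine monomial _ _ _ ?_
  rw [← weight_four_six]
  exact hP (MvPolynomial.mem_support_iff.1 hd)

theorem isGraded_monomial {R : Type*} [CommRing R] (c : R) (a b : ℕ) :
    IsGraded (MvPolynomial.C c * (MvPolynomial.X 0 ^ a * MvPolynomial.X 1 ^ b) :
      MvPolynomial (Fin 2) R) (a * 4 + b * 6) :=
  MvPolynomial.IsWeightedHomogeneous.C_mul ((isGraded_X_zero.pow a).mul (isGraded_X_one.pow b)) _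

theorem IsGraded.of_eq {R : Type*} [CommRing R] {P : MvPolynomial (Fin 2) R} {a b : ℕ}
    (hP : IsGraded P a) (h : a = b) : IsGraded P b := h ▸ hP

theorem isGraded_zero {R : Type*} [CommRing R] (w : ℕ) :
    IsGraded (0 : MvPolynomial (Fin 2) R) w := MvPolynomial.isWeightedHomogeneous_zero _ _ _

/-- A graded polynomial is a multiple of a given monomial with small exponent of `X₁`, up to
a multiple of `X₀³ - X₁²`. -/
theorem IsGraded.exists_eq_add_mul {R : Type*} [CommRing R] {P : MvPolynomial (Fin 2) R}
    {a b : ℕ} (hb : b ≤ 1) (hP : IsGraded P (a * 4 + b * 6)) : ∃ (c : R)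
      (Q : MvPolynomial (Fin 2) R),
      P = MvPolynomial.C c * (MvPolynomial.X 0 ^ a * MvPolynomial.X 1 ^ b) +
        (MvPolynomial.X 0 ^ 3 - MvPolynomial.X 1 ^ 2) * Q ∧
      IsGraded Q (a * 4 + b * 6 - 12) ∧ (a * 4 + b * 6 < 12 → Q = 0) := by
  refine hP.induction (motive := fun P => ∃ (c : R) (Q : MvPolynomial (Fin 2) R),
      P = MvPolynomial.C c * (MvPolynomial.X 0 ^ a * MvPolynomial.X 1 ^ b) +
        (MvPolynomial.X 0 ^ 3 - MvPolynomial.X 1 ^ 2) * Q ∧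
      IsGraded Q (a * 4 + b * 6 - 12) ∧ (a * 4 + b * 6 < 12 → Q = 0))
    ⟨0, 0, by simp, isGraded_zero _, fun _ => rfl⟩ ?_ ?_
  · rintro P Q ⟨c, S, rfl, hS, hS0⟩ ⟨d, T, rfl, hT, hT0⟩
    exact ⟨c + d, S + T, by rw [map_add]; ring, hS.add hT, fun h => by rw [hS0 h, hT0 h, add_zero]⟩
  · intro c u v huv
    -- The weight fixes the parity of the exponent of X₁, and b is 0 or 1; squares of X₁ are then
    -- traded for cubes of X₀.
    obtain ⟨t, rfl⟩ : ∃ t, v = b + 2 * t := ⟨(v - b) / 2, by omega⟩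
    obtain rfl : a = u + 3 * t := by omega
    clear huv hP
    induction t generalizing u with
    | zero => exact ⟨c, 0, by simp, isGraded_zero _, fun _ => rfl⟩
    | succ t ih =>
      obtain ⟨d, Q, hQ, hQg, hQ0⟩ := ih (u + 3)
      refine ⟨d, Q - MvPolynomial.C c *
        (MvPolynomial.X 0 ^ u * MvPolynomial.X 1 ^ (b + 2 * t)), ?_, ?_, ?_⟩
      · rw [show u + 3 * (t + 1) = u + 3 + 3 * t by ring, mul_sub, add_sub_assoc',
          eq_sub_iff_add_eq, ← hQ]
        ring
      · refine (hQg.of_eq (by omega)).sub ((isGraded_monomial c u _).of_eq (by omega))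
      · intro h
        omega

/-- The homomorphism recording the weight in an additional variable. -/
noncomputable def weightHom (K : Type*) [CommRing K] :
    MvPolynomial (Fin 2) K →ₐ[K] Polynomial (MvPolynomial (Fin 2) K) :=
  MvPolynomial.aeval ![Polynomial.monomial 4 (MvPolynomial.X 0),
    Polynomial.monomial 6 (MvPolynomial.X 1)]

theorem weightHom_monomial {R : Type*} [CommRing R] (c : R) (a b : ℕ) :
    weightHom R (MvPolynomial.C c * (MvPolynomial.X 0 ^ a * MvPolynomial.X 1 ^ b)) =
      Polynomial.monomial (a * 4 + b * 6)
        (MvPolynomial.C c * (MvPolynomial.X 0 ^ a * MvPolynomial.X 1 ^ b)) := by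
  rw [map_mul, map_mul, map_pow, map_pow, weightHom, MvPolynomial.aeval_X, MvPolynomial.aeval_X,
    ← MvPolynomial.algebraMap_eq, AlgHom.commutes]
  simp only [Matrix.cons_val_zero, Matrix.cons_val_one, Polynomial.monomial_pow,
    Polynomial.monomial_mul_monomial]
  rw [IsScalarTower.algebraMap_apply R (MvPolynomial (Fin 2) R), Polynomial.algebraMap_eq,
    Polynomial.C_mul_monomial, mul_comm a, mul_comm b]

theorem IsGraded.weightHom_eq {R : Type*} [CommRing R] {P : MvPolynomial (Fin 2) R} {w : ℕ}
    (hP : IsGraded P w) : weightHom R P = Polynomial.monomial w P := by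
  refine hP.induction (motive := fun P => weightHom R P = Polynomial.monomial w P) (by simp)
    (fun P Q h1 h2 => by rw [map_add, h1, h2, map_add]) ?_
  rintro c a b rfl
  exact weightHom_monomial c a b

theorem isGraded_coeff_weightHom {R : Type*} [CommRing R] (P : MvPolynomial (Fin 2) R) (m : ℕ) :
    IsGraded ((weightHom R P).coeff m) m := by
  induction P using MvPolynomial.induction_on' with
  | monomial u a =>
    rw [monomial_fin_two_eq, weightHom_monomial, Polynomial.coeff_monomial]
    split_ifs with h
    · exact (isGraded_monomial _ _ _).of_eq h
    · exact isGraded_zero _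
  | add P Q hP hQ =>
    rw [map_add, Polynomial.coeff_add]
    exact hP.add hQ

theorem eval_one_weightHom {R : Type*} [CommRing R] (P : MvPolynomial (Fin 2) R) :
    (weightHom R P).eval 1 = P := by
  induction P using MvPolynomial.induction_on' with
  | monomial u a =>
    rw [monomial_fin_two_eq, weightHom_monomial, Polynomial.eval_monomial, one_pow, mul_one]
  | add P Q hP hQ =>
    rw [map_add, Polynomial.eval_add, hP, hQ]

/-- A factor of a nonzero graded polynomial is graded. -/
theorem IsGraded.exists_of_mul {P Q : MvPolynomial (Fin 2) K} {w : ℕ} (h : IsGraded (P * Q) w)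
    (h0 : P * Q ≠ 0) : ∃ a b, a + b = w ∧ IsGraded P a ∧ IsGraded Q b := by
  have key := h.weightHom_eq
  rw [map_mul] at key
  have hinj : ∀ S : MvPolynomial (Fin 2) K, S ≠ 0 → weightHom K S ≠ 0 := fun S hS h => hS (by
    rw [← eval_one_weightHom S, h, Polynomial.eval_zero])
  have hP := hinj P (left_ne_zero_of_mul h0)
  have hQ := hinj Q (right_ne_zero_of_mul h0)
  -- Top and bottom degrees in the weight variable are both additive. The product is a monomial, so
  -- in each factor the two coincide.
  have hd := congrArg Polynomial.natDegree key
  have ht := congrArg Polynomial.natTrailingDegree key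
  rw [Polynomial.natDegree_mul hP hQ, Polynomial.natDegree_monomial_eq _ h0] at hd
  rw [Polynomial.natTrailingDegree_mul hP hQ, Polynomial.natTrailingDegree_monomial h0] at ht
  have hPl := (weightHom K P).natTrailingDegree_le_natDegree
  have hQl := (weightHom K Q).natTrailingDegree_le_natDegree
  have aux : ∀ S : MvPolynomial (Fin 2) K,
      (weightHom K S).natTrailingDegree = (weightHom K S).natDegree →
      IsGraded S (weightHom K S).natDegree := by
    intro S hS
    have hm : weightHom K S = Polynomial.monomial (weightHom K S).natDegree
        ((weightHom K S).coeff (weightHom K S).natDegree) := by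
      ext1 m
      rw [Polynomial.coeff_monomial]
      split_ifs with hm
      · rw [hm]
      · rcases lt_or_gt_of_ne hm with h1 | h1
        · exact Polynomial.coeff_eq_zero_of_natDegree_lt h1
        · exact Polynomial.coeff_eq_zero_of_lt_natTrailingDegree (hS ▸ h1)
    have h1 := congrArg (Polynomial.eval 1) hm
    rw [eval_one_weightHom, Polynomial.eval_monomial, one_pow, mul_one] at h1
    have := isGraded_coeff_weightHom S (weightHom K S).natDegree
    rwa [← h1] at this
  exact ⟨_, _, hd, aux P (by omega), aux Q (by omega)⟩

theorem isGraded_C {R : Type*} [CommRing R] (c : R) :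
    IsGraded (MvPolynomial.C c : MvPolynomial (Fin 2) R) 0 :=
  MvPolynomial.isWeightedHomogeneous_C _ _

theorem isGraded_one {R : Type*} [CommRing R] :
    IsGraded (1 : MvPolynomial (Fin 2) R) 0 := isGraded_C 1

theorem IsGraded.weight_unique {R : Type*} [CommRing R] {P : MvPolynomial (Fin 2) R} {a b : ℕ}
    (ha : IsGraded P a) (hb : IsGraded P b) (h : P ≠ 0) : a = b :=
  MvPolynomial.IsWeightedHomogeneous.inj_right h ha hb

theorem IsGraded.eq_C_of_weight_zero {R : Type*} [CommRing R] {P : MvPolynomial (Fin 2) R}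
    (hP : IsGraded P 0) : ∃ c, P = MvPolynomial.C c := by
  refine hP.induction (motive := fun P => ∃ c, P = MvPolynomial.C c) ⟨0, by simp⟩ ?_ ?_
  · rintro _ _ ⟨c, rfl⟩ ⟨d, rfl⟩
    exact ⟨c + d, by simp⟩
  · intro c a b h
    obtain rfl : a = 0 := by omega
    obtain rfl : b = 0 := by omega
    exact ⟨c, by simp⟩

theorem IsGraded.eq_zero_of_weight_two {R : Type*} [CommRing R] {P : MvPolynomial (Fin 2) R}
    (hP : IsGraded P 2) : P = 0 := by
  refine hP.induction (motive := fun P => P = 0) rfl ?_ fun c a b h => by omega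
  rintro _ _ rfl rfl
  simp

theorem IsGraded.eq_zero_of_odd {R : Type*} [CommRing R] {P : MvPolynomial (Fin 2) R} {w : ℕ}
    (hw : Odd w) (hP : IsGraded P w) : P = 0 := by
  obtain ⟨m, rfl⟩ := hw
  refine hP.induction (motive := fun P => P = 0) rfl ?_ fun c a b h => by omega
  rintro _ _ rfl rfl
  simp

end GradedPolynomialsOverField

/-! ### Injectivity of evaluation in a fixed weight -/

section EvaluationInjective
variable {p : ℕ} [hp : Fact p.Prime]

theorem eisenstein_cube_sub_sq_ne_zero (hp5 : 5 ≤ p) :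
    eisensteinFourSeries (ZMod p) ^ 3 - eisensteinSixSeries (ZMod p) ^ 2 ≠ 0 := by
  intro h
  obtain ⟨u, hu, hu2⟩ := exists_discriminantSeries_eq (p := p) hp5
  have h2 := map_discriminantSeries hp5 (pIntegralReduction p)
  rw [discriminantSeries.eq_1 (ZMod p), h, mul_zero, hu2, map_mul, map_X] at h2
  have h3 := hu.map (PowerSeries.map (pIntegralReduction p))
  exact mul_ne_zero X_ne_zero h3.ne_zero h2

/-- The constant term kills the monomial outside the ideal of X₀³ - X₁², whose value is not zero;
divide by it and descend. Homogeneity is essential, since A - 1 evaluates to zero. -/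
theorem IsGraded.eq_zero_of_eval_eq_zero (hp5 : 5 ≤ p) {P : MvPolynomial (Fin 2) (ZMod p)}
    {w : ℕ} (hP : IsGraded P w) (h : evalEisenstein p P = 0) : P = 0 := by
  induction w using Nat.strong_induction_on generalizing P with
  | _ w ih =>
  rcases Nat.even_or_odd w with hw | hw
  swap
  · exact hP.eq_zero_of_odd hw
  by_cases h2 : w = 2
  · subst h2
    exact hP.eq_zero_of_weight_two
  obtain ⟨a, b, hb, rfl⟩ : ∃ a b : ℕ, b ≤ 1 ∧ a * 4 + b * 6 = w := by
    obtain ⟨m, rfl⟩ := hw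
    rcases Nat.even_or_odd' m with ⟨c, rfl | rfl⟩
    · exact ⟨c, 0, by omega⟩
    · exact ⟨c - 1, 1, by omega⟩
  obtain ⟨c, Q, rfl, hQ, hQ0⟩ := hP.exists_eq_add_mul hb
  have hc := congrArg constantCoeff h
  simp only [map_add, map_mul, map_sub, map_pow, evalEisenstein_C, evalEisenstein_X_zero,
    evalEisenstein_X_one, constantCoeff_eisensteinFourSeries, constantCoeff_eisensteinSixSeries,
    constantCoeff_C, one_pow, sub_self, zero_mul, add_zero, mul_one, map_zero] at hc
  subst hc
  rw [map_zero, zero_mul, zero_add] at h ⊢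
  simp only [map_mul, map_sub, map_pow, evalEisenstein_X_zero, evalEisenstein_X_one] at h
  have hQe := (mul_eq_zero.1 h).resolve_left (eisenstein_cube_sub_sq_ne_zero hp5)
  by_cases h12 : a * 4 + b * 6 < 12
  · rw [hQ0 h12, mul_zero]
  · rw [ih _ (by omega) hQ hQe, mul_zero]

theorem IsGraded.eq_of_eval_eq (hp5 : 5 ≤ p) {P Q : MvPolynomial (Fin 2) (ZMod p)}
    {w : ℕ} (hP : IsGraded P w) (hQ : IsGraded Q w)
    (h : evalEisenstein p P = evalEisenstein p Q) : P = Q :=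
  sub_eq_zero.1 (IsGraded.eq_zero_of_eval_eq_zero hp5 (hP.sub hQ) (by rw [map_sub, h, sub_self]))

end EvaluationInjective

/-! ### The Serre derivative as a derivation on polynomials -/

section RamanujanDerivation
variable {p : ℕ} [hp : Fact p.Prime]

theorem IsGraded.mul {R : Type*} [CommRing R] {P Q : MvPolynomial (Fin 2) R} {a b : ℕ}
    (hP : IsGraded P a) (hQ : IsGraded Q b) : IsGraded (P * Q) (a + b) :=
  MvPolynomial.IsWeightedHomogeneous.mul hP hQ

theorem IsGraded.neg {R : Type*} [CommRing R] {P : MvPolynomial (Fin 2) R} {a : ℕ}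
    (hP : IsGraded P a) : IsGraded (-P) a :=
  MvPolynomial.IsWeightedHomogeneous.neg hP

variable (p) in
/-- The derivation of the ring of polynomials in the Eisenstein series of weights `4` and `6`
that is induced by the Serre derivative. -/
noncomputable def ramanujanDerivation :
    Derivation (ZMod p) (MvPolynomial (Fin 2) (ZMod p)) (MvPolynomial (Fin 2) (ZMod p)) :=
  MvPolynomial.mkDerivation (ZMod p) ![-(MvPolynomial.C 3⁻¹ * MvPolynomial.X 1),
    -(MvPolynomial.C 2⁻¹ * MvPolynomial.X 0 ^ 2)]

theorem natCast_zmod_ne_zero_of_lt {m : ℕ} (h0 : 0 < m) (h : m < p) : (m : ZMod p) ≠ 0 :=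
  fun h2 => absurd (Nat.le_of_dvd h0 ((ZMod.natCast_eq_zero_iff _ _).1 h2)) (by omega)

/-- The derivation corresponds to the Serre derivative in weight `w` on `P`. -/
def IsSerreDerivativeAt (P : MvPolynomial (Fin 2) (ZMod p)) (w : ℕ) : Prop :=
  IsGraded P w ∧ IsGraded (ramanujanDerivation p P) (w + 2) ∧
    evalEisenstein p (ramanujanDerivation p P) = serreTheta w (evalEisenstein p P)

theorem isSerreDerivativeAt_C (c : ZMod p) : IsSerreDerivativeAt (MvPolynomial.C c) 0 := by
  have h : ramanujanDerivation p (MvPolynomial.C c) = 0 := by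
    rw [← MvPolynomial.algebraMap_eq, Derivation.map_algebraMap]
  refine ⟨isGraded_C c, by rw [h]; exact isGraded_zero _, ?_⟩
  rw [h]
  simp [serreTheta, thetaOp_C]

theorem IsSerreDerivativeAt.mul {P Q : MvPolynomial (Fin 2) (ZMod p)} {v w : ℕ}
    (hP : IsSerreDerivativeAt P v) (hQ : IsSerreDerivativeAt Q w) :
    IsSerreDerivativeAt (P * Q) (v + w) := by
  refine ⟨hP.1.mul hQ.1, ?_, ?_⟩
  · rw [Derivation.leibniz, smul_eq_mul, smul_eq_mul]
    exact ((hP.1.mul hQ.2.1).of_eq (by ring)).add ((hQ.1.mul hP.2.1).of_eq (by ring))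
  · rw [Derivation.leibniz, smul_eq_mul, smul_eq_mul, map_add, map_mul, map_mul, hP.2.2, hQ.2.2,
      map_mul, serreTheta, serreTheta, serreTheta, thetaOp_mul]
    push_cast
    ring

theorem IsSerreDerivativeAt.pow {P : MvPolynomial (Fin 2) (ZMod p)} {w : ℕ}
    (hP : IsSerreDerivativeAt P w) (n : ℕ) : IsSerreDerivativeAt (P ^ n) (n * w) := by
  induction n with
  | zero => simpa using isSerreDerivativeAt_C (1 : ZMod p)
  | succ n ih => rw [pow_succ, add_mul, one_mul]; exact ih.mul hP

theorem isSerreDerivativeAt_X_zero (hp5 : 5 ≤ p) :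
    IsSerreDerivativeAt (p := p) (MvPolynomial.X 0) 4 := by
  have hD : ramanujanDerivation p (MvPolynomial.X 0) =
      -(MvPolynomial.C 3⁻¹ * MvPolynomial.X 1) := by
    simp [ramanujanDerivation, MvPolynomial.mkDerivation_X]
  refine ⟨isGraded_X_zero, ?_, ?_⟩
  · rw [hD]
    exact (MvPolynomial.IsWeightedHomogeneous.C_mul isGraded_X_one _).neg
  · have h3 : (3 : ZMod p) ≠ 0 := by
      exact_mod_cast natCast_zmod_ne_zero_of_lt (p := p) (m := 3) (by norm_num) (by omega)
    have h := congrArg (PowerSeries.map (pIntegralReduction p))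
      (thetaOp_eisensteinFourSeries (p := p) hp5)
    simp only [map_mul, map_sub, map_thetaOp, map_eisensteinFourSeries, map_eisensteinSixSeries,
      map_twelfthE2 hp5, map_ofNat] at h
    have h3C : (3 : (ZMod p)⟦X⟧) = PowerSeries.C (3 : ZMod p) := (map_ofNat _ 3).symm
    have h3n : (3 : (ZMod p)⟦X⟧) ≠ 0 := by
      rw [h3C, Ne, map_eq_zero_iff _ PowerSeries.C_injective]
      exact h3
    refine mul_left_cancel₀ h3n ?_
    have hinv : (3 : (ZMod p)⟦X⟧) * PowerSeries.C 3⁻¹ = 1 := by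
      rw [h3C, ← map_mul, mul_inv_cancel₀ h3, map_one]
    simp only [hD, map_neg, map_mul, evalEisenstein_C, evalEisenstein_X_one,
      evalEisenstein_X_zero, serreTheta, mul_sub, h]
    push_cast
    linear_combination -eisensteinSixSeries (ZMod p) * hinv

theorem isSerreDerivativeAt_X_one (hp5 : 5 ≤ p) :
    IsSerreDerivativeAt (p := p) (MvPolynomial.X 1) 6 := by
  have hD : ramanujanDerivation p (MvPolynomial.X 1) =
      -(MvPolynomial.C 2⁻¹ * MvPolynomial.X 0 ^ 2) := by
    simp [ramanujanDerivation, MvPolynomial.mkDerivation_X]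
  refine ⟨isGraded_X_one, ?_, ?_⟩
  · rw [hD]
    exact (MvPolynomial.IsWeightedHomogeneous.C_mul (isGraded_X_zero.pow 2) _).neg
  · have h2 : (2 : ZMod p) ≠ 0 := by
      exact_mod_cast natCast_zmod_ne_zero_of_lt (p := p) (m := 2) (by norm_num) (by omega)
    have h := congrArg (PowerSeries.map (pIntegralReduction p))
      (thetaOp_eisensteinSixSeries (p := p) hp5)
    simp only [map_mul, map_sub, map_pow, map_thetaOp, map_eisensteinFourSeries,
      map_eisensteinSixSeries, map_twelfthE2 hp5, map_ofNat] at h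
    have h2C : (2 : (ZMod p)⟦X⟧) = PowerSeries.C (2 : ZMod p) := (map_ofNat _ 2).symm
    have h2n : (2 : (ZMod p)⟦X⟧) ≠ 0 := by
      rw [h2C, Ne, map_eq_zero_iff _ PowerSeries.C_injective]
      exact h2
    refine mul_left_cancel₀ h2n ?_
    have hinv : (2 : (ZMod p)⟦X⟧) * PowerSeries.C 2⁻¹ = 1 := by
      rw [h2C, ← map_mul, mul_inv_cancel₀ h2, map_one]
    simp only [hD, map_neg, map_mul, map_pow, evalEisenstein_C, evalEisenstein_X_one,
      evalEisenstein_X_zero, serreTheta, mul_sub, h]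
    push_cast
    linear_combination -eisensteinFourSeries (ZMod p) ^ 2 * hinv

/-- Both sides obey the Leibniz rule with additive weights, so the generators suffice, and there the
claim is Ramanujan's identities. -/
theorem IsGraded.isSerreDerivativeAt (hp5 : 5 ≤ p) {P : MvPolynomial (Fin 2) (ZMod p)} {w : ℕ}
    (hP : IsGraded P w) : IsSerreDerivativeAt P w := by
  refine hP.induction (motive := fun P => IsSerreDerivativeAt P w) ?_ ?_ ?_
  · refine ⟨isGraded_zero _, by rw [map_zero]; exact isGraded_zero _, ?_⟩
    simp [serreTheta, thetaOp_zero]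
  · intro P Q hP hQ
    refine ⟨hP.1.add hQ.1, by rw [map_add]; exact hP.2.1.add hQ.2.1, ?_⟩
    rw [map_add, map_add, hP.2.2, hQ.2.2, map_add, serreTheta, serreTheta, serreTheta, thetaOp_add]
    ring
  · rintro c a b rfl
    have := (isSerreDerivativeAt_C c).mul
      (((isSerreDerivativeAt_X_zero hp5).pow a).mul ((isSerreDerivativeAt_X_one hp5).pow b))
    rwa [zero_add] at this

end RamanujanDerivation

/-! ### The Hasse invariant A: simple zeros and theta without weight drop -/

section HassePolynomial
variable {p : ℕ} [hp : Fact p.Prime]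

theorem natCast_prime_powerSeries_zmod : (p : (ZMod p)⟦X⟧) = 0 := by
  rw [← map_natCast (PowerSeries.C (R := ZMod p)), CharP.cast_eq_zero, map_zero]

theorem map_hasseForm (hp5 : 5 ≤ p) :
    PowerSeries.map (pIntegralReduction p) (hasseForm hp5) = 1 := by
  rw [hasseForm, map_add, map_mul, map_one, map_natCast, natCast_prime_powerSeries_zmod, zero_mul,
    add_zero]

/-- The polynomial representing the Hasse invariant. -/
noncomputable def hassePoly (hp5 : 5 ≤ p) : MvPolynomial (Fin 2) (ZMod p) :=
  ((isIntegralForm_hasseForm hp5).exists_poly hp5).choose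

theorem isGraded_hassePoly (hp5 : 5 ≤ p) : IsGraded (hassePoly hp5) (p - 1) :=
  ((isIntegralForm_hasseForm hp5).exists_poly hp5).choose_spec.1

@[simp] theorem evalEisenstein_hassePoly (hp5 : 5 ≤ p) :
    evalEisenstein p (hassePoly hp5) = 1 :=
  ((isIntegralForm_hasseForm hp5).exists_poly hp5).choose_spec.2.trans (map_hasseForm hp5)

theorem hassePoly_ne_zero (hp5 : 5 ≤ p) : hassePoly hp5 ≠ 0 := fun h => by
  have := evalEisenstein_hassePoly hp5
  rw [h, map_zero] at this
  exact zero_ne_one this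

theorem IsGraded.weight_eq_zero_of_isUnit {P : MvPolynomial (Fin 2) (ZMod p)} {w : ℕ}
    (hP : IsGraded P w) (h : IsUnit P) : w = 0 := by
  obtain ⟨Q, hQ⟩ := isUnit_iff_exists_inv.1 h
  obtain ⟨a, b, hab, ha, -⟩ := IsGraded.exists_of_mul (P := P) (Q := Q) (w := 0)
    (hQ ▸ isGraded_one) (hQ ▸ one_ne_zero)
  rw [hP.weight_unique ha h.ne_zero]
  omega

theorem isGraded_derivation_hassePoly (hp5 : 5 ≤ p) :
    IsGraded (ramanujanDerivation p (hassePoly hp5)) (p + 1) :=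
  ((isGraded_hassePoly hp5).isSerreDerivativeAt hp5).2.1.of_eq (by omega)

/-- A evaluates to 1, which θ kills, and its weight p - 1 is -1 modulo p; only y remains. -/
theorem evalEisenstein_derivation_hassePoly (hp5 : 5 ≤ p) :
    evalEisenstein p (ramanujanDerivation p (hassePoly hp5)) = twelfthE2 (ZMod p) := by
  rw [((isGraded_hassePoly hp5).isSerreDerivativeAt hp5).2.2, evalEisenstein_hassePoly, serreTheta,
    Nat.cast_sub (by omega), natCast_prime_powerSeries_zmod, ← map_one (PowerSeries.C), thetaOp_C]
  simp

/-- The Hasse invariant satisfies a second order differential equation. -/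
theorem exists_derivation_derivation_hassePoly (hp5 : 5 ≤ p) :
    ∃ e, ramanujanDerivation p (ramanujanDerivation p (hassePoly hp5)) = hassePoly hp5 * e := by
  obtain ⟨e, he, hee⟩ := (isIntegralForm_quasiDefect (p := p) hp5).exists_poly hp5
  -- The weight p + 1 of ∂A is 1 modulo p, so ∂²A evaluates to θy - y² = -`quasiDefect`.
  refine ⟨-e, ?_⟩
  have h2 := (isGraded_derivation_hassePoly hp5).isSerreDerivativeAt hp5
  refine IsGraded.eq_of_eval_eq hp5 h2.2.1
    (((isGraded_hassePoly hp5).mul he.neg).of_eq (by omega)) ?_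
  rw [h2.2.2, evalEisenstein_derivation_hassePoly, map_mul, evalEisenstein_hassePoly, map_neg, hee,
    serreTheta, quasiDefect, map_sub, map_mul, map_thetaOp, map_twelfthE2 hp5]
  push_cast
  rw [natCast_prime_powerSeries_zmod]
  ring

variable {π : MvPolynomial (Fin 2) (ZMod p)}

theorem exists_isGraded_of_prime_dvd_hassePoly (hp5 : 5 ≤ p) (hπ : Prime π)
    (hd : π ∣ hassePoly hp5) : ∃ w, 0 < w ∧ w ≤ p - 1 ∧ IsGraded π w := by
  obtain ⟨Q, hQ⟩ := hd
  have h0 := hassePoly_ne_zero hp5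
  have hg := isGraded_hassePoly hp5
  rw [hQ] at h0 hg
  obtain ⟨a, b, hab, ha, -⟩ := IsGraded.exists_of_mul hg h0
  refine ⟨a, Nat.pos_of_ne_zero ?_, by omega, ha⟩
  rintro rfl
  obtain ⟨c, rfl⟩ := ha.eq_C_of_weight_zero
  refine hπ.not_isUnit ((IsUnit.mk0 c ?_).map MvPolynomial.C)
  rintro rfl
  exact hπ.ne_zero (map_zero _)

theorem constantCoeff_twelfthE2_ne_zero (hp5 : 5 ≤ p) :
    constantCoeff (twelfthE2 (ZMod p)) ≠ 0 := fun h => by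
  have := congrArg constantCoeff (twelve_mul_twelfthE2 (isUnit_twelve_zmod (p := p) hp5))
  rw [map_mul, h, mul_zero, constantCoeff_eisensteinTwoSeries] at this
  exact zero_ne_one this

/-- If π divided ∂π, the cofactor would have weight 2 and so vanish. Then θ of the value of π is w y
times that value, with 0 < w < p. Comparing constant terms, the value has constant term zero,
although it divides the value 1 of A. -/
theorem not_dvd_derivation_of_prime_dvd_hassePoly (hp5 : 5 ≤ p) (hπ : Prime π)
    (hd : π ∣ hassePoly hp5) : ¬ π ∣ ramanujanDerivation p π := by
  obtain ⟨w, hw0, hw, hg⟩ := exists_isGraded_of_prime_dvd_hassePoly hp5 hπ hd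
  obtain ⟨-, h1, h2⟩ := hg.isSerreDerivativeAt hp5
  rintro ⟨σ, hσ⟩
  have hσ0 : σ = 0 := by
    by_contra hne
    rw [hσ] at h1
    obtain ⟨a, b, hab, ha, hb⟩ := IsGraded.exists_of_mul h1 (mul_ne_zero hπ.ne_zero hne)
    have := hg.weight_unique ha hπ.ne_zero
    obtain rfl : b = 2 := by omega
    exact hne hb.eq_zero_of_weight_two
  rw [hσ, hσ0, mul_zero, map_zero, serreTheta] at h2
  obtain ⟨Q, hQ⟩ := hd
  have h3 := evalEisenstein_hassePoly hp5
  rw [hQ, map_mul] at h3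
  have h4 := congrArg constantCoeff h3
  rw [map_mul, map_one] at h4
  have h5 := congrArg constantCoeff h2
  have h6 : constantCoeff (thetaOp (evalEisenstein p π)) = 0 := by
    rw [← coeff_zero_eq_constantCoeff_apply, coeff_thetaOp]; simp
  rw [map_zero, map_sub, h6, zero_sub, map_mul, map_mul, map_natCast, zero_eq_neg] at h5
  rcases mul_eq_zero.1 h5 with h7 | h7
  · exact mul_ne_zero (natCast_zmod_ne_zero_of_lt hw0 (by omega))
      (constantCoeff_twelfthE2_ne_zero hp5) h7
  · rw [h7, zero_mul] at h4
    exact zero_ne_one h4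

/-- Igusa's argument. If A = π^(r+2) B with π not dividing B, the equation ∂²A = A e forces π to
divide (r+2)(r+1)(∂π)² B. The weight of A bounds r + 2 by p - 1, so the integer factors are units,
and π divides neither ∂π nor B. -/
theorem not_sq_dvd_hassePoly (hp5 : 5 ≤ p) (hπ : Prime π)
    (hd : π ∣ hassePoly hp5) : ¬ π ^ 2 ∣ hassePoly hp5 := by
  intro h2
  obtain ⟨w, hw0, hw, hg⟩ := exists_isGraded_of_prime_dvd_hassePoly hp5 hπ hd
  have hfin : FiniteMultiplicity π (hassePoly hp5) :=
    FiniteMultiplicity.of_prime_left hπ (hassePoly_ne_zero hp5)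
  obtain ⟨B, hB, hnB⟩ := hfin.exists_eq_pow_mul_and_not_dvd
  have hm := hfin.le_multiplicity_of_pow_dvd h2
  obtain ⟨r, hr⟩ := Nat.exists_eq_add_of_le' hm
  rw [hr] at hB
  have hr : r + 2 ≤ p - 1 := by
    have h0 := hassePoly_ne_zero hp5
    have hg2 := isGraded_hassePoly hp5
    rw [hB] at h0 hg2
    obtain ⟨a, b, hab, ha, -⟩ := IsGraded.exists_of_mul hg2 h0
    have := (hg.pow (r + 2)).weight_unique ha (pow_ne_zero _ hπ.ne_zero)
    nlinarith
  obtain ⟨e, he⟩ := exists_derivation_derivation_hassePoly hp5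
  set D := ramanujanDerivation p
  have hDD : D (D (π ^ (r + 2) * B)) = π ^ r * (((r + 2 : ℕ) : MvPolynomial (Fin 2) (ZMod p)) *
      ((r + 1 : ℕ) : MvPolynomial (Fin 2) (ZMod p)) * (D π * (D π * B)) + π * (((r + 2 : ℕ) :
      MvPolynomial (Fin 2) (ZMod p)) * (D (D π) * B + 2 * D π * D B) + π * D (D B))) := by
    simp only [Derivation.leibniz, Derivation.leibniz_pow, smul_eq_mul, map_add, nsmul_eq_mul,
      Derivation.map_natCast, Nat.add_sub_cancel, show r + 2 - 1 = r + 1 from rfl]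
    push_cast
    ring
  rw [hB, hDD, pow_add, mul_assoc (π ^ r), mul_assoc (π ^ r)] at he
  have he2 := mul_left_cancel₀ (pow_ne_zero r hπ.ne_zero) he
  have h3 : π ∣ ((r + 2 : ℕ) : MvPolynomial (Fin 2) (ZMod p)) *
      ((r + 1 : ℕ) : MvPolynomial (Fin 2) (ZMod p)) * (D π * (D π * B)) := by
    rw [← dvd_add_left (dvd_mul_right π _), he2]
    exact ⟨π * (B * e), by ring⟩
  have hcast : ∀ m : ℕ, 0 < m → m < p → ¬ π ∣ (m : MvPolynomial (Fin 2) (ZMod p)) := by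
    intro m h0 h1 h
    have hu : IsUnit (m : MvPolynomial (Fin 2) (ZMod p)) := by
      rw [← map_natCast MvPolynomial.C]
      exact (IsUnit.mk0 _ (natCast_zmod_ne_zero_of_lt h0 h1)).map MvPolynomial.C
    exact hπ.not_isUnit (isUnit_of_dvd_unit h hu)
  have hDπ := not_dvd_derivation_of_prime_dvd_hassePoly hp5 hπ hd
  rcases hπ.dvd_or_dvd h3 with h | h
  · rcases hπ.dvd_or_dvd h with h | h
    · exact hcast _ (by omega) (by omega) h
    · exact hcast _ (by omega) (by omega) h
  · rcases hπ.dvd_or_dvd h with h | h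
    · exact hDπ h
    · rcases hπ.dvd_or_dvd h with h | h
      · exact hDπ h
      · exact hnB h

theorem not_dvd_derivation_hassePoly (hp5 : 5 ≤ p) (hπ : Prime π)
    (hd : π ∣ hassePoly hp5) : ¬ π ∣ ramanujanDerivation p (hassePoly hp5) := by
  intro h
  have h2 := not_sq_dvd_hassePoly hp5 hπ hd
  obtain ⟨B, hB⟩ := hd
  rw [hB, Derivation.leibniz, smul_eq_mul, smul_eq_mul, dvd_add_right (dvd_mul_right π _)] at h
  rcases hπ.dvd_or_dvd h with ⟨B', rfl⟩ | h
  · exact h2 ⟨B', by rw [hB]; ring⟩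
  · exact not_dvd_derivation_of_prime_dvd_hassePoly hp5 hπ ⟨B, hB⟩ h

theorem exists_prime_dvd_hassePoly (hp5 : 5 ≤ p) :
    ∃ π : MvPolynomial (Fin 2) (ZMod p), Prime π ∧ π ∣ hassePoly hp5 := by
  have hu : ¬ IsUnit (hassePoly hp5) := fun h => by
    have := (isGraded_hassePoly hp5).weight_eq_zero_of_isUnit h
    omega
  obtain ⟨π, h1, h2⟩ := WfDvdMonoid.exists_irreducible_factor hu (hassePoly_ne_zero hp5)
  exact ⟨π, h1.prime, h2⟩

/-- A is squarefree, so it divides anything divisible by all its prime factors. -/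
theorem exists_prime_dvd_hassePoly_not_dvd (hp5 : 5 ≤ p) {F : MvPolynomial (Fin 2) (ZMod p)}
    (hF : ¬ hassePoly hp5 ∣ F) : ∃ π, Prime π ∧ π ∣ hassePoly hp5 ∧ ¬ π ∣ F := by
  by_contra! hall
  refine hF ?_
  have key : ∀ B : MvPolynomial (Fin 2) (ZMod p), B ∣ hassePoly hp5 → B ∣ F := by
    intro B
    induction B using UniqueFactorizationMonoid.induction_on_prime with
    | h₁ => exact fun h => absurd (zero_dvd_iff.1 h) (hassePoly_ne_zero hp5)
    | h₂ u hu => exact fun _ => hu.dvd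
    | h₃ B π hB hπ ih =>
      intro h
      obtain ⟨G, rfl⟩ := ih ((dvd_mul_left B π).trans h)
      have hπA := (dvd_mul_right π B).trans h
      rcases hπ.dvd_or_dvd (hall π hπ hπA) with ⟨B', rfl⟩ | h1
      · exact absurd ((Dvd.intro B' (by ring)).trans h) (not_sq_dvd_hassePoly hp5 hπ hπA)
      · rw [mul_comm π]
        exact mul_dvd_mul_left B h1
  exact key _ dvd_rfl

/-- The powers of the theta operator raise weights by `p + 1`, keeping indivisibility by a factor
of the Hasse invariant as long as the weights are prime to `p`. -/
theorem exists_poly_iterate_thetaOp (hp5 : 5 ≤ p) (hπ : Prime π) (hd : π ∣ hassePoly hp5)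
    {G : MvPolynomial (Fin 2) (ZMod p)} {w : ℕ} (hG : IsGraded G w) (hGπ : ¬ π ∣ G) (a : ℕ)
    (ha : ∀ j < a, ((w + j : ℕ) : ZMod p) ≠ 0) : ∃ Q, IsGraded Q (w + a * (p + 1)) ∧
      evalEisenstein p Q = thetaOp^[a] (evalEisenstein p G) ∧ ¬ π ∣ Q := by
  induction a with
  | zero => exact ⟨G, hG.of_eq (by ring), rfl, hGπ⟩
  | succ a ih =>
    obtain ⟨Q, hQ, hQe, hQπ⟩ := ih fun j hj => ha j (by omega)
    obtain ⟨-, h1, h2⟩ := hQ.isSerreDerivativeAt hp5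
    -- This is θQ = ∂Q + w y Q made homogeneous by means of A ↦ 1 and ∂A ↦ y. Modulo π only the
    -- second term survives, and it is not zero because the weight is prime to p.
    refine ⟨hassePoly hp5 * ramanujanDerivation p Q + MvPolynomial.C ((w + a : ℕ) : ZMod p) *
      (ramanujanDerivation p (hassePoly hp5) * Q), ?_, ?_, ?_⟩
    · have e : p - 1 + 2 = p + 1 := by omega
      refine (((isGraded_hassePoly hp5).mul h1).of_eq ?_).add
        ((((isGraded_C _).mul ((isGraded_derivation_hassePoly hp5).mul hQ))).of_eq ?_)
      · rw [add_mul, one_mul]; omega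
      · rw [add_mul, one_mul]; omega
    · have hw : ((w + a * (p + 1) : ℕ) : (ZMod p)⟦X⟧) = ((w + a : ℕ) : (ZMod p)⟦X⟧) := by
        push_cast
        rw [natCast_prime_powerSeries_zmod]
        ring
      rw [map_add, map_mul, map_mul, map_mul, evalEisenstein_hassePoly, h2,
        evalEisenstein_derivation_hassePoly, evalEisenstein_C, serreTheta, hw, map_natCast,
        Function.iterate_succ_apply', ← hQe]
      ring
    · rw [dvd_add_right (hd.mul_right _)]
      intro h
      rcases hπ.dvd_or_dvd h with h | h
      · exact hπ.not_isUnit (isUnit_of_dvd_unit h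
          ((IsUnit.mk0 _ (ha a (by omega))).map MvPolynomial.C))
      · rcases hπ.dvd_or_dvd h with h | h
        · exact not_dvd_derivation_hassePoly hp5 hπ hd h
        · exact hQπ h

end HassePolynomial

/-! ### Congruences between weights modulo p and modulo p² -/

section WeightCongruences
variable {p : ℕ} [hp : Fact p.Prime]

theorem emultiplicity_hassePoly (hp5 : 5 ≤ p) {π : MvPolynomial (Fin 2) (ZMod p)} (hπ : Prime π)
    (hd : π ∣ hassePoly hp5) : emultiplicity π (hassePoly hp5) = 1 := by
  have := emultiplicity_eq_coe (a := π) (b := hassePoly hp5) (n := 1)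
  exact_mod_cast this.2 ⟨by rwa [pow_one], not_sq_dvd_hassePoly hp5 hπ hd⟩

theorem exists_emultiplicity_eq {π : MvPolynomial (Fin 2) (ZMod p)} (hπ : Prime π)
    {F : MvPolynomial (Fin 2) (ZMod p)} (hF : F ≠ 0) : ∃ a : ℕ, emultiplicity π F = a :=
  ⟨_, (FiniteMultiplicity.of_prime_left hπ hF).emultiplicity_eq_multiplicity⟩

/-- Graded polynomials with the same nonzero expansion have weights congruent modulo `p - 1`. -/
theorem IsGraded.weight_modEq (hp5 : 5 ≤ p) {F G : MvPolynomial (Fin 2) (ZMod p)} {v w : ℕ}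
    (hF : IsGraded F v) (hG : IsGraded G w) (h : evalEisenstein p F = evalEisenstein p G)
    (h0 : F ≠ 0) : v ≡ w [MOD p - 1] := by
  obtain ⟨π, hπ, hd⟩ := exists_prime_dvd_hassePoly (p := p) hp5
  have hG0 : G ≠ 0 := by
    rintro rfl
    rw [map_zero] at h
    exact h0 (hF.eq_zero_of_eval_eq_zero hp5 h)
  have hA := isGraded_hassePoly (p := p) hp5
  -- Taking (p-1)-th powers lets powers of A equalise the weights; multiplicities of π are then
  -- compared.
  have key : F ^ (p - 1) * hassePoly hp5 ^ w = G ^ (p - 1) * hassePoly hp5 ^ v := by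
    refine IsGraded.eq_of_eval_eq hp5 ((hF.pow _).mul (hA.pow _))
      (((hG.pow _).mul (hA.pow _)).of_eq (by ring)) ?_
    simp [h]
  obtain ⟨a, ha⟩ := exists_emultiplicity_eq hπ h0
  obtain ⟨b, hb⟩ := exists_emultiplicity_eq hπ hG0
  have hm := congrArg (emultiplicity π) key
  simp only [emultiplicity_mul hπ, emultiplicity_pow hπ, emultiplicity_hassePoly hp5 hπ hd, ha,
    hb, mul_one] at hm
  have hm2 : (p - 1) * a + w = (p - 1) * b + v := by exact_mod_cast hm
  have h1 : (p - 1) * a + w ≡ w [MOD p - 1] := by simp [Nat.ModEq]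
  have h2 : (p - 1) * b + v ≡ v [MOD p - 1] := by simp [Nat.ModEq]
  exact h2.symm.trans (hm2 ▸ h1)

/-- Starting from ∂A, of weight 1 modulo p, the p - 2 derivatives meet only the weights 1, …, p - 2
modulo p, hence no drop. -/
theorem thetaOp_pow_twelfthE2_poly (hp5 : 5 ≤ p) {π : MvPolynomial (Fin 2) (ZMod p)}
    (hπ : Prime π) (hd : π ∣ hassePoly hp5) : ∃ Y, IsGraded Y ((p - 1) * (p + 1)) ∧
      evalEisenstein p Y = thetaOp^[p - 2] (twelfthE2 (ZMod p)) ∧ ¬ π ∣ Y := by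
  obtain ⟨Y, h1, h2, h3⟩ := exists_poly_iterate_thetaOp hp5 hπ hd
    (isGraded_derivation_hassePoly hp5) (not_dvd_derivation_hassePoly hp5 hπ hd) (p - 2) (by
      intro j hj
      have : ((p + 1 + j : ℕ) : ZMod p) = ((1 + j : ℕ) : ZMod p) := by push_cast; simp
      rw [this]
      exact natCast_zmod_ne_zero_of_lt (by omega) (by omega))
  refine ⟨Y, h1.of_eq ?_, by rw [h2, evalEisenstein_derivation_hassePoly], h3⟩
  obtain ⟨q, rfl⟩ := Nat.exists_eq_add_of_le' (show 2 ≤ p by omega)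
  simp only [Nat.add_sub_cancel, show q + 2 - 1 = q + 1 from rfl]
  ring

/-- The weights of two forms congruent modulo `p ^ 2`, and not zero modulo `p`, which differ by
`u (p - 1)` differ by a multiple of `p (p - 1)`. -/
theorem dvd_of_congruent_mod_sq (hp5 : 5 ≤ p) {h g : (pIntegral p)⟦X⟧} {w u : ℕ}
    (hh : IsIntegralForm p w h) (hg : IsIntegralForm p (w + u * (p - 1)) g)
    (hcong : (p : (pIntegral p)⟦X⟧) ^ 2 ∣ h - g)
    (h0 : ¬ (p : (pIntegral p)⟦X⟧) ∣ h) : p ∣ u := by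
  by_contra hpu
  obtain ⟨π, hπ, hd⟩ := exists_prime_dvd_hassePoly (p := p) hp5
  obtain ⟨Y, hY, hYe, hYπ⟩ := thetaOp_pow_twelfthE2_poly hp5 hπ hd
  set κ := hasseQuotient (p := p) hp5
  set red := PowerSeries.map (pIntegralReduction p)
  have hpow : ∃ r, hasseForm (p := p) hp5 ^ u =
      1 + (u : (pIntegral p)⟦X⟧) * p * κ + (p : (pIntegral p)⟦X⟧) ^ 2 * r := by
    obtain ⟨r, hr⟩ := Polynomial.powAddExpansion 1 ((p : (pIntegral p)⟦X⟧) * κ) u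
    exact ⟨r * κ ^ 2, by rw [hasseForm, hr]; ring⟩
  obtain ⟨r, hr⟩ := hpow
  obtain ⟨s, hs⟩ := hcong
  have hform : IsIntegralForm p (w + u * (p - 1)) (hasseForm hp5 ^ u * h - g) :=
    ((((isIntegralForm_hasseForm hp5).pow u).mul hh).of_weight_eq (by ring)).sub hg
  -- Dividing by p shows that uκh is modulo p a form of weight w + u(p-1). As u is invertible, κ
  -- becomes the quotient T / (H A^u).
  have heq : hasseForm hp5 ^ u * h - g =
      (p : (pIntegral p)⟦X⟧) * (u * κ * h + p * (r * h + s)) := by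
    rw [hr]
    linear_combination hs
  rw [heq] at hform
  obtain ⟨S, hS, hSe⟩ := (hform.of_natCast_mul hp.out.ne_zero).exists_poly hp5
  obtain ⟨H, hH, hHe⟩ := hh.exists_poly hp5
  rw [map_add, map_mul, map_mul, map_mul, map_natCast, map_natCast,
    natCast_prime_powerSeries_zmod, zero_mul, add_zero] at hSe
  have hu0 : (u : ZMod p) ≠ 0 := fun h => hpu ((ZMod.natCast_eq_zero_iff _ _).1 h)
  set T := MvPolynomial.C ((u : ZMod p)⁻¹) * S with hT
  have hTg : IsGraded T (w + u * (p - 1)) := ((isGraded_C _).mul hS).of_eq (by ring)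
  have hTe : evalEisenstein p T = red κ * evalEisenstein p H := by
    have : PowerSeries.C ((u : ZMod p)⁻¹) * (u : (ZMod p)⟦X⟧) = 1 := by
      rw [← map_natCast (PowerSeries.C (R := ZMod p)), ← map_mul, inv_mul_cancel₀ hu0, map_one]
    rw [hT, map_mul, evalEisenstein_C, hSe, hHe]
    linear_combination red κ * red h * this
  have hκ := map_hasseQuotient_sub_pow (p := p) hp5
  have hA := isGraded_hassePoly (p := p) hp5
  -- The Artin–Schreier equation for κ, with denominators cleared by H^p and powers of A.
  have key : T * H ^ (p - 1) * hassePoly hp5 ^ ((p - 1) * u + p + 1) +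
      -(T ^ p * hassePoly hp5 ^ (p + 1)) = Y * H ^ p * hassePoly hp5 ^ (p * u) := by
    obtain ⟨q, hq⟩ := Nat.exists_eq_add_of_le' (show 1 ≤ p by omega)
    have hq1 : p - 1 = q := by omega
    have e1 : IsGraded (T * H ^ (p - 1) * hassePoly hp5 ^ ((p - 1) * u + p + 1))
        (p * w + (p - 1) * (p * u + p + 1)) := by
      refine ((hTg.mul (hH.pow _)).mul (hA.pow _)).of_eq ?_
      rw [hq1, hq]; ring
    have e2 : IsGraded (T ^ p * hassePoly hp5 ^ (p + 1))
        (p * w + (p - 1) * (p * u + p + 1)) := by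
      refine ((hTg.pow _).mul (hA.pow _)).of_eq ?_
      rw [hq1, hq]; ring
    have e3 : IsGraded (Y * H ^ p * hassePoly hp5 ^ (p * u))
        (p * w + (p - 1) * (p * u + p + 1)) := by
      refine ((hY.mul (hH.pow _)).mul (hA.pow _)).of_eq ?_
      rw [hq1, hq]; ring
    refine IsGraded.eq_of_eval_eq hp5 (MvPolynomial.IsWeightedHomogeneous.add e1 e2.neg) e3 ?_
    simp only [map_add, map_neg, map_mul, map_pow, evalEisenstein_hassePoly, one_pow, mul_one, hTe,
      hYe, ← hκ, mul_pow]
    rw [mul_assoc, ← pow_succ', Nat.sub_add_cancel (by omega)]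
    ring
  have hH0 : H ≠ 0 := fun h1 => h0 (by
    rw [natCast_dvd_iff_map_reduction_eq_zero, ← hHe, h1, map_zero])
  have hT0 : T ≠ 0 := fun h1 => by
    have hY0 : Y ≠ 0 := fun h2 => hYπ (h2 ▸ dvd_zero _)
    rw [h1, zero_mul, zero_mul, zero_pow (by omega), zero_mul, neg_zero, add_zero] at key
    exact mul_ne_zero (mul_ne_zero hY0 (pow_ne_zero _ hH0))
      (pow_ne_zero _ (hassePoly_ne_zero hp5)) key.symm
  obtain ⟨a, ha⟩ := exists_emultiplicity_eq hπ hT0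
  obtain ⟨b, hb⟩ := exists_emultiplicity_eq hπ hH0
  have hYm := emultiplicity_eq_zero.2 hYπ
  have m1 : emultiplicity π (T * H ^ (p - 1) * hassePoly hp5 ^ ((p - 1) * u + p + 1)) =
      ((a + (p - 1) * b + ((p - 1) * u + p + 1) : ℕ) : ℕ∞) := by
    simp only [emultiplicity_mul hπ, emultiplicity_pow hπ, emultiplicity_hassePoly hp5 hπ hd, ha,
      hb, mul_one]
    norm_cast
  have m2 : emultiplicity π (-(T ^ p * hassePoly hp5 ^ (p + 1))) =
      ((p * a + (p + 1) : ℕ) : ℕ∞) := by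
    simp only [emultiplicity_neg, emultiplicity_mul hπ, emultiplicity_pow hπ,
      emultiplicity_hassePoly hp5 hπ hd, ha, mul_one]
    norm_cast
  have m3 : emultiplicity π (Y * H ^ p * hassePoly hp5 ^ (p * u)) =
      ((p * b + p * u : ℕ) : ℕ∞) := by
    simp only [emultiplicity_mul hπ, emultiplicity_pow hπ, emultiplicity_hassePoly hp5 hπ hd,
      hb, mul_one, hYm, zero_add]
    norm_cast
  obtain ⟨q, hq⟩ := Nat.exists_eq_add_of_le' (show 5 ≤ p by omega)
  have hq1 : p - 1 = q + 4 := by omega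
  rw [hq1] at m1
  -- The three cases say that T / (H A^u) vanishes, is a unit, or has a pole at π. The right side Y
  -- / A^(p+1) has a pole of order p + 1: the first two cases give no pole, and the third gives one
  -- of order divisible by p.
  rcases lt_trichotomy (a + (q + 4) * b + ((q + 4) * u + p + 1)) (p * a + (p + 1)) with
    hlt | hlt | hlt
  · have := emultiplicity_add_of_gt (p := π) (a := -(T ^ p * hassePoly hp5 ^ (p + 1)))
      (b := T * H ^ (p - 1) * hassePoly hp5 ^ ((p - 1) * u + p + 1))
      (by rw [hq1, m2, m1]; exact_mod_cast hlt)
    rw [add_comm, key, m3, hq1, m1] at this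
    have h3 : p * b + p * u = a + (q + 4) * b + ((q + 4) * u + p + 1) := by exact_mod_cast this
    rw [hq] at h3 hlt
    have : b + u = a + (q + 5) + 1 := by linarith
    have h4 : b = a + (q + 5) + 1 - u := by omega
    nlinarith
  · have hmin := min_le_emultiplicity_add (p := π)
      (a := T * H ^ (p - 1) * hassePoly hp5 ^ ((p - 1) * u + p + 1))
      (b := -(T ^ p * hassePoly hp5 ^ (p + 1)))
    rw [key, m3, hq1, m1, m2, hlt, min_self] at hmin
    have h3 : p * a + (p + 1) ≤ p * b + p * u := by exact_mod_cast hmin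
    rw [hq] at h3 hlt
    have h4 : (q + 4) * (b + u) = (q + 4) * a := by linarith
    have h5 := Nat.eq_of_mul_eq_mul_left (by omega) h4
    rw [← h5] at h3
    linarith
  · have := emultiplicity_add_of_gt (p := π)
      (a := T * H ^ (p - 1) * hassePoly hp5 ^ ((p - 1) * u + p + 1))
      (b := -(T ^ p * hassePoly hp5 ^ (p + 1)))
      (by rw [hq1, m2, m1]; exact_mod_cast hlt)
    rw [key, m3, m2] at this
    have h3 : p * b + p * u = p * a + (p + 1) := by exact_mod_cast this
    have h4 : p ∣ p * a + (p + 1) := h3 ▸ ⟨b + u, by ring⟩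
    have h5 : p ∣ 1 := by
      have : p * a + (p + 1) = p * (a + 1) + 1 := by ring
      rw [this] at h4
      exact (Nat.dvd_add_right (dvd_mul_right _ _)).1 h4
    have := Nat.le_of_dvd one_pos h5
    omega

/-- A graded polynomial that is not divisible by a factor of the Hasse invariant does not have the
expansion of a form of smaller weight. -/
theorem weight_eq_of_not_dvd (hp5 : 5 ≤ p) {π U V : MvPolynomial (Fin 2) (ZMod p)}
    (hd : π ∣ hassePoly hp5) {w t : ℕ} (hU : IsGraded U (w + t * (p - 1))) (hUπ : ¬ π ∣ U)
    (hV : IsGraded V w) (h : evalEisenstein p U = evalEisenstein p V) : t = 0 := by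
  by_contra ht
  refine hUπ ?_
  have : U = V * hassePoly hp5 ^ t :=
    IsGraded.eq_of_eval_eq hp5 hU (hV.mul ((isGraded_hassePoly hp5).pow t)) (by simp [h])
  rw [this]
  exact (hd.trans (dvd_pow_self _ ht)).mul_left _

end WeightCongruences

/-! ### Forms modulo p and p², and the modular part of powers of E₂ -/

section FormsModuloPrimePowers
variable {p : ℕ} [hp : Fact p.Prime]

variable (p) in
/-- `g` is congruent modulo `p ^ m` to a modular form of weight `w`. -/
def IsFormModPow (m w : ℕ) (g : (pIntegral p)⟦X⟧) : Prop :=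
  ∃ h, IsIntegralForm p w h ∧ (p : (pIntegral p)⟦X⟧) ^ m ∣ g - h

variable {m v w : ℕ} {f g : (pIntegral p)⟦X⟧}

theorem IsIntegralForm.isFormModPow (hg : IsIntegralForm p w g) (m : ℕ) : IsFormModPow p m w g :=
  ⟨g, hg, by simp⟩

theorem isFormModPow_of_dvd (h : (p : (pIntegral p)⟦X⟧) ^ m ∣ g) (w : ℕ) : IsFormModPow p m w g :=
  ⟨0, .zero w, by simpa⟩

theorem IsFormModPow.of_weight_eq (hg : IsFormModPow p m v g) (h : v = w) :
    IsFormModPow p m w g := h ▸ hg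

theorem IsFormModPow.congr (hg : IsFormModPow p m w g)
    (h : (p : (pIntegral p)⟦X⟧) ^ m ∣ f - g) : IsFormModPow p m w f := by
  obtain ⟨g', h1, h2⟩ := hg
  exact ⟨g', h1, by simpa using dvd_add h h2⟩

theorem IsFormModPow.add (hf : IsFormModPow p m w f) (hg : IsFormModPow p m w g) :
    IsFormModPow p m w (f + g) := by
  obtain ⟨f', h1, h2⟩ := hf
  obtain ⟨g', h3, h4⟩ := hg
  exact ⟨f' + g', h1.add h3, by simpa [add_sub_add_comm] using dvd_add h2 h4⟩

theorem IsFormModPow.neg (hf : IsFormModPow p m w f) : IsFormModPow p m w (-f) := by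
  obtain ⟨f', h1, h2⟩ := hf
  refine ⟨-f', h1.neg, ?_⟩
  rw [← neg_sub']
  exact (dvd_neg).2 h2

theorem IsFormModPow.sub (hf : IsFormModPow p m w f) (hg : IsFormModPow p m w g) :
    IsFormModPow p m w (f - g) := by
  rw [sub_eq_add_neg]
  exact hf.add hg.neg

theorem IsFormModPow.mul (hf : IsFormModPow p m v f) (hg : IsFormModPow p m w g) :
    IsFormModPow p m (v + w) (f * g) := by
  obtain ⟨f', h1, h2⟩ := hf
  obtain ⟨g', h3, h4⟩ := hg
  refine ⟨f' * g', h1.mul h3, ?_⟩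
  rw [show f * g - f' * g' = (f - f') * g + f' * (g - g') by ring]
  exact dvd_add (h2.mul_right _) (h4.mul_left _)

theorem IsFormModPow.one (m : ℕ) : IsFormModPow p m 0 (1 : (pIntegral p)⟦X⟧) :=
  IsIntegralForm.one.isFormModPow m

theorem IsFormModPow.pow (hf : IsFormModPow p m w f) (s : ℕ) :
    IsFormModPow p m (s * w) (f ^ s) := by
  induction s with
  | zero => simpa using IsFormModPow.one m
  | succ s ih => rw [pow_succ, add_mul, one_mul]; exact ih.mul hf

theorem IsFormModPow.C_mul (a : pIntegral p) (hf : IsFormModPow p m w f) :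
    IsFormModPow p m w (C a * f) := by
  obtain ⟨f', h1, h2⟩ := hf
  exact ⟨C a * f', h1.C_mul a, by rw [← mul_sub]; exact h2.mul_left _⟩

theorem IsFormModPow.natCast_mul (a : ℕ) (hf : IsFormModPow p m w f) :
    IsFormModPow p m w ((a : (pIntegral p)⟦X⟧) * f) := by
  simpa using hf.C_mul (a : pIntegral p)

theorem IsFormModPow.intCast_mul (a : ℤ) (hf : IsFormModPow p m w f) :
    IsFormModPow p m w ((a : (pIntegral p)⟦X⟧) * f) := by
  simpa using hf.C_mul (a : pIntegral p)

theorem IsFormModPow.sum {ι : Type*} (s : Finset ι) (f : ι → (pIntegral p)⟦X⟧)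
    (h : ∀ i ∈ s, IsFormModPow p m w (f i)) : IsFormModPow p m w (∑ i ∈ s, f i) :=
  Finset.sum_induction f (IsFormModPow p m w) (fun _ _ => .add)
    ((IsIntegralForm.zero w).isFormModPow m) h

theorem IsFormModPow.prime_mul (hf : IsFormModPow p 1 w f) :
    IsFormModPow p 2 w ((p : (pIntegral p)⟦X⟧) * f) := by
  obtain ⟨f', h1, h2⟩ := hf
  refine ⟨p * f', h1.natCast_mul p, ?_⟩
  rw [← mul_sub, pow_two]
  exact mul_dvd_mul_left _ (by simpa using h2)

/-- A form modulo `p ^ 2` that is divisible by `p` is `p` times a form modulo `p`. -/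
theorem IsFormModPow.of_prime_mul (hf : IsFormModPow p 2 w ((p : (pIntegral p)⟦X⟧) * f)) :
    IsFormModPow p 1 w f := by
  obtain ⟨g, h1, c, h2⟩ := hf
  have hg : g = (p : (pIntegral p)⟦X⟧) * (f - p * c) := by linear_combination -h2
  rw [hg] at h1
  exact ⟨_, h1.of_natCast_mul hp.out.ne_zero, c, by ring⟩

theorem dvd_hasseForm_sub_one (hp5 : 5 ≤ p) : (p : (pIntegral p)⟦X⟧) ∣ hasseForm hp5 - 1 :=
  ⟨hasseQuotient hp5, by rw [hasseForm]; ring⟩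

theorem dvd_hasseForm_pow_sub_one (hp5 : 5 ≤ p) (t : ℕ) :
    (p : (pIntegral p)⟦X⟧) ∣ hasseForm hp5 ^ t - 1 :=
  (dvd_hasseForm_sub_one hp5).trans (by simpa using sub_dvd_pow_sub_pow (hasseForm hp5) 1 t)

theorem sq_dvd_hasseForm_pow_prime_sub_one (hp5 : 5 ≤ p) :
    (p : (pIntegral p)⟦X⟧) ^ 2 ∣ hasseForm hp5 ^ p - 1 := by
  obtain ⟨r, hr⟩ := Polynomial.powAddExpansion 1 ((p : (pIntegral p)⟦X⟧) * hasseQuotient hp5) p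
  exact ⟨hasseQuotient hp5 + r * hasseQuotient hp5 ^ 2, by rw [hasseForm, hr]; ring⟩

theorem sq_dvd_hasseForm_pow_prime_mul_sub_one (hp5 : 5 ≤ p) (t : ℕ) :
    (p : (pIntegral p)⟦X⟧) ^ 2 ∣ hasseForm hp5 ^ (p * t) - 1 := by
  refine (sq_dvd_hasseForm_pow_prime_sub_one hp5).trans ?_
  rw [pow_mul]
  simpa using sub_dvd_pow_sub_pow (hasseForm hp5 ^ p) 1 t

theorem IsFormModPow.raise (hp5 : 5 ≤ p) (hg : IsFormModPow p 1 v g) (t : ℕ)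
    (h : v + t * (p - 1) = w) : IsFormModPow p 1 w g := by
  refine (hg.mul (((isIntegralForm_hasseForm hp5).pow t).isFormModPow 1)).of_weight_eq h |>.congr ?_
  obtain ⟨c, hc⟩ := dvd_hasseForm_pow_sub_one (p := p) hp5 t
  exact ⟨-(g * c), by linear_combination -g * hc⟩

theorem IsFormModPow.raise_sq (hp5 : 5 ≤ p) (hg : IsFormModPow p 2 v g) (t : ℕ)
    (h : v + t * (p * (p - 1)) = w) : IsFormModPow p 2 w g := by
  refine (hg.mul (((isIntegralForm_hasseForm hp5).pow (p * t)).isFormModPow 2)).of_weight_eq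
    (by rw [← h]; ring) |>.congr ?_
  obtain ⟨c, hc⟩ := sq_dvd_hasseForm_pow_prime_mul_sub_one (p := p) hp5 t
  exact ⟨-(g * c), by linear_combination -g * hc⟩

theorem IsFormModPow.weaken (hg : IsFormModPow p 2 w g) : IsFormModPow p 1 w g := by
  obtain ⟨h, h1, h2⟩ := hg
  exact ⟨h, h1, (pow_dvd_pow _ one_le_two).trans h2⟩

/-- The Serre derivative of the form of weight `p - 1`. -/
noncomputable def hasseSerreTheta (hp5 : 5 ≤ p) : (pIntegral p)⟦X⟧ :=
  serreTheta (p - 1) (hasseForm hp5)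

theorem isIntegralForm_hasseSerreTheta (hp5 : 5 ≤ p) :
    IsIntegralForm p (p + 1) (hasseSerreTheta hp5) :=
  ((isIntegralForm_hasseForm hp5).serreTheta hp5).of_weight_eq (by omega)

/-- The Serre derivative of E is pθκ - (p-1)yE. Multiplied by E^(p-1), and with E^p ≡ 1 (mod p²) and
θκ ≡ y - y^p (mod p), it becomes y - p y^p. -/
theorem sq_dvd_twelfthE2_sub (hp5 : 5 ≤ p) : (p : (pIntegral p)⟦X⟧) ^ 2 ∣
    twelfthE2 (pIntegral p) - hasseSerreTheta hp5 * hasseForm hp5 ^ (p - 1) -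
      p * twelfthE2 (pIntegral p) ^ p := by
  have h1 : (p : (pIntegral p)⟦X⟧) ∣ thetaOp (hasseQuotient hp5) -
      (twelfthE2 (pIntegral p) - twelfthE2 (pIntegral p) ^ p) := by
    rw [natCast_dvd_iff_map_reduction_eq_zero]
    simp only [map_sub, map_pow, map_thetaOp, map_twelfthE2 hp5, thetaOp_map_hasseQuotient hp5]
    ring
  obtain ⟨z, hz⟩ := h1
  obtain ⟨c, hc⟩ := sq_dvd_hasseForm_pow_prime_sub_one (p := p) hp5
  obtain ⟨d, hd⟩ := dvd_hasseForm_pow_sub_one (p := p) hp5 (p - 1)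
  have hth : thetaOp (hasseForm hp5) = p * thetaOp (hasseQuotient hp5) := by
    rw [hasseForm, thetaOp_add, thetaOp_natCast_mul, ← map_one (C (R := pIntegral p)), thetaOp_C,
      zero_add]
  have hpp : hasseForm hp5 ^ p = hasseForm hp5 * hasseForm hp5 ^ (p - 1) := by
    rw [← pow_succ', Nat.sub_add_cancel (by omega)]
  rw [hpp] at hc
  rw [hasseSerreTheta, serreTheta, hth, Nat.cast_sub (by omega), Nat.cast_one]
  set y := twelfthE2 (pIntegral p)
  set E := hasseForm (p := p) hp5
  set F := E ^ (p - 1)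
  set T := thetaOp (hasseQuotient (p := p) hp5)
  refine ⟨-(y - y ^ p) * d - z * F + (p - 1) * y * c, ?_⟩
  linear_combination -(p : (pIntegral p)⟦X⟧) * F * hz - (p : (pIntegral p)⟦X⟧) * (y - y ^ p) * hd +
    ((p : (pIntegral p)⟦X⟧) - 1) * y * hc

theorem isFormModPow_twelfthE2 (hp5 : 5 ≤ p) :
    IsFormModPow p 1 (p + 1) (twelfthE2 (pIntegral p)) := by
  refine ⟨_, isIntegralForm_hasseSerreTheta hp5, ?_⟩
  obtain ⟨c, hc⟩ := sq_dvd_twelfthE2_sub (p := p) hp5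
  obtain ⟨d, hd⟩ := dvd_hasseForm_pow_sub_one (p := p) hp5 (p - 1)
  refine ⟨p * c + hasseSerreTheta hp5 * d + twelfthE2 (pIntegral p) ^ p, ?_⟩
  linear_combination hc + hasseSerreTheta hp5 * hd

/-- The modular part of the power `y ^ s` of the quasimodular form `y`, modulo `p ^ 2`. -/
noncomputable def modularPowPart (hp5 : 5 ≤ p) (s : ℕ) : (pIntegral p)⟦X⟧ :=
  hasseSerreTheta hp5 ^ s * hasseForm hp5 ^ (p - s)

theorem isIntegralForm_modularPowPart (hp5 : 5 ≤ p) {s : ℕ} (hs : s ≤ p) :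
    IsIntegralForm p (2 * s + p * (p - 1)) (modularPowPart hp5 s) := by
  refine (((isIntegralForm_hasseSerreTheta hp5).pow s).mul
    ((isIntegralForm_hasseForm hp5).pow (p - s))).of_weight_eq ?_
  obtain ⟨t, rfl⟩ := Nat.exists_eq_add_of_le hs
  obtain ⟨q, hq⟩ := Nat.exists_eq_add_of_le' (show 1 ≤ s + t by omega)
  rw [Nat.add_sub_cancel_left, hq, Nat.add_sub_cancel]
  have : t * q = (q + 1 - s) * q := by rw [show q + 1 - s = t by omega]
  have h2 : s * q + t * q = (q + 1) * q := by rw [← add_mul, hq]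
  linarith

/-- The s-th power of the case s = 1. The exponent s(p-1) of E is p - s plus the multiple p(s-1) of
p, which can be dropped modulo p². -/
theorem sq_dvd_twelfthE2_pow_sub (hp5 : 5 ≤ p) {s : ℕ} (hs : s ≤ p) :
    (p : (pIntegral p)⟦X⟧) ^ 2 ∣ twelfthE2 (pIntegral p) ^ s - modularPowPart hp5 s -
      p * s * twelfthE2 (pIntegral p) ^ (s - 1 + p) := by
  rw [modularPowPart]
  obtain ⟨c, hc⟩ := sq_dvd_twelfthE2_sub (p := p) hp5
  rcases Nat.eq_zero_or_pos s with rfl | hs0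
  · obtain ⟨d, hd⟩ := sq_dvd_hasseForm_pow_prime_sub_one (p := p) hp5
    refine ⟨-d, ?_⟩
    simp only [pow_zero, one_mul, Nat.sub_zero, Nat.cast_zero, mul_zero, zero_mul, sub_zero]
    linear_combination -hd
  set y := twelfthE2 (pIntegral p)
  set E := hasseForm (p := p) hp5
  set b := hasseSerreTheta (p := p) hp5
  obtain ⟨r, hr⟩ := Polynomial.powAddExpansion y (-(p * (y ^ p + p * c))) s
  have h1 : b * E ^ (p - 1) = y + -(p * (y ^ p + p * c)) := by linear_combination -hc
  obtain ⟨t, rfl⟩ := Nat.exists_eq_add_of_le' hs0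
  obtain ⟨d, hd⟩ := sq_dvd_hasseForm_pow_prime_mul_sub_one (p := p) hp5 t
  have h2 : (b * E ^ (p - 1)) ^ (t + 1) =
      b ^ (t + 1) * (E ^ (p - (t + 1)) * E ^ (p * t)) := by
    rw [mul_pow, ← pow_mul, ← pow_add]
    congr 2
    obtain ⟨q, hq⟩ := Nat.exists_eq_add_of_le hs
    rw [show p - (t + 1) = q by omega, hq, show t + 1 + q - 1 = t + q by omega]
    ring
  rw [h1, hr] at h2
  rw [show t + 1 - 1 = t from rfl] at *
  refine ⟨b ^ (t + 1) * E ^ (p - (t + 1)) * d + ((t + 1 : ℕ) : (pIntegral p)⟦X⟧) * y ^ t * c -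
    r * (y ^ p + p * c) ^ 2, ?_⟩
  rw [pow_add y t p]
  linear_combination h2 + b ^ (t + 1) * E ^ (p - (t + 1)) * hd

theorem thetaOp_eq_serreTheta_add (w : ℕ) (f : (pIntegral p)⟦X⟧) :
    thetaOp f = serreTheta w f + (w : (pIntegral p)⟦X⟧) * (twelfthE2 (pIntegral p) * f) := by
  rw [serreTheta]; ring

theorem natCast_pow_dvd_thetaOp {f : (pIntegral p)⟦X⟧} (h : (p : (pIntegral p)⟦X⟧) ^ m ∣ f) :
    (p : (pIntegral p)⟦X⟧) ^ m ∣ thetaOp f := by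
  obtain ⟨c, rfl⟩ := h
  rw [← Nat.cast_pow, thetaOp_natCast_mul]
  exact dvd_mul_right _ _

theorem IsFormModPow.thetaOp (hp5 : 5 ≤ p) (hf : IsFormModPow p 1 w f) :
    IsFormModPow p 1 (w + (p + 1)) (thetaOp f) := by
  obtain ⟨g, hg, hd⟩ := hf
  refine IsFormModPow.congr (g := _root_.thetaOp g) ?_
    (by rw [← thetaOp_sub]; exact natCast_pow_dvd_thetaOp hd)
  rw [thetaOp_eq_serreTheta_add w]
  refine ((((hg.serreTheta hp5).isFormModPow 1)).raise hp5 1 (by omega)).add ?_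
  exact (((isFormModPow_twelfthE2 hp5).mul (hg.isFormModPow 1)).natCast_mul w).of_weight_eq
    (by ring)

theorem IsFormModPow.iterate_thetaOp (hp5 : 5 ≤ p) (hf : IsFormModPow p 1 w f) (a : ℕ) :
    IsFormModPow p 1 (w + a * (p + 1)) (_root_.thetaOp^[a] f) := by
  induction a with
  | zero => simpa using hf
  | succ a ih =>
    rw [Function.iterate_succ_apply']
    exact (ih.thetaOp hp5).of_weight_eq (by ring)

theorem weightFiltration_le_of_isFormModPow (h : IsFormModPow p m w f) :
    weightFiltration p m f ≤ (w : ℕ∞) := by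
  obtain ⟨g, h1, h2⟩ := h
  exact iInf₂_le w ⟨g, h1, (congModPow_iff _ _ _).2 h2⟩

theorem le_weightFiltration {w : ℕ} (h : ∀ v < w, ¬ IsFormModPow p m v f) :
    (w : ℕ∞) ≤ weightFiltration p m f := by
  refine le_iInf₂ fun v hv => ?_
  obtain ⟨g, h1, h2⟩ := hv
  by_contra hlt
  exact h v (by exact_mod_cast not_le.1 hlt) ⟨g, h1, (congModPow_iff _ _ _).1 h2⟩

end FormsModuloPrimePowers

/-! ### Expansion of theta derivatives in powers of E₂ -/

section ThetaExpansion

/-- The coefficients of the expansion of iterated theta derivatives of forms of weight `d + 1` in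
powers of the quasimodular Eisenstein series. -/
def thetaCoeff (d i s : ℕ) : ℕ := i.choose s * (d + i).descFactorial s

theorem thetaCoeff_succ_mul (d i s : ℕ) :
    thetaCoeff d i (s + 1) * (s + 1) = thetaCoeff d i s * ((i - s) * (d + i - s)) := by
  rw [thetaCoeff, thetaCoeff, Nat.descFactorial_succ, mul_right_comm, Nat.choose_succ_right_eq]
  ring

/-- The source of the factor i(d+i) in the exceptional congruence. -/
theorem succ_mul_thetaCoeff (d i s : ℕ) :
    (s + 1) * thetaCoeff d (i + 1) (s + 1) = (i + 1) * (d + i + 1) * thetaCoeff d i s := by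
  have h := Nat.add_one_mul_choose_eq i s
  rw [thetaCoeff, thetaCoeff, ← add_assoc, Nat.succ_descFactorial_succ]
  linear_combination (d + i + 1) * (d + i).descFactorial s * h.symm

/-- The recursion that θ imposes on the coefficient of y^(s+1): s comes from θ(y^s), and d + 1 +
2(i-s) is the weight of the form multiplying y^s. -/
theorem thetaCoeff_succ_succ (d : ℕ) {i s : ℕ} (hs : s ≤ i) :
    thetaCoeff d (i + 1) (s + 1) =
      thetaCoeff d i (s + 1) + thetaCoeff d i s * (s + (d + 1 + 2 * (i - s))) := by
  obtain ⟨t, rfl⟩ := Nat.exists_eq_add_of_le hs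
  have h := Nat.choose_succ_right_eq (s + t) s
  rw [Nat.add_sub_cancel_left] at h
  rw [thetaCoeff, thetaCoeff, thetaCoeff, ← add_assoc, Nat.succ_descFactorial_succ,
    Nat.descFactorial_succ, Nat.choose_succ_succ, Nat.add_sub_cancel_left,
    show d + (s + t) - s = d + t by omega]
  linear_combination (d + (s + t)).descFactorial s * h

@[simp] theorem thetaCoeff_zero (d i : ℕ) : thetaCoeff d i 0 = 1 := by simp [thetaCoeff]

theorem thetaCoeff_eq_zero_of_lt (d : ℕ) {i s : ℕ} (h : i < s) : thetaCoeff d i s = 0 := by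
  rw [thetaCoeff, Nat.choose_eq_zero_of_lt h, zero_mul]

variable {R : Type*} [CommRing R]

/-- The iterated modular derivatives of a form of weight `d + 1`. -/
noncomputable def modularDerivative (d : ℕ) (f : R⟦X⟧) : ℕ → R⟦X⟧
  | 0 => f
  | 1 => serreTheta (d + 1) f
  | r + 2 => serreTheta (d + 1 + 2 * (r + 1)) (modularDerivative d f (r + 1)) -
      (((r + 1) * (d + r + 1) : ℕ) : R⟦X⟧) * (quasiDefect R * modularDerivative d f r)

/-- At r = 0 the truncated index r - 1 is harmless, its coefficient r(d+r) being zero. -/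
theorem thetaOp_modularDerivative (d : ℕ) (f : R⟦X⟧) (r : ℕ) :
    thetaOp (modularDerivative d f r) = modularDerivative d f (r + 1) +
      ((d + 1 + 2 * r : ℕ) : R⟦X⟧) * (twelfthE2 R * modularDerivative d f r) +
      ((r * (d + r) : ℕ) : R⟦X⟧) * (quasiDefect R * modularDerivative d f (r - 1)) := by
  cases r with
  | zero =>
    rw [modularDerivative, modularDerivative, serreTheta]
    push_cast
    ring
  | succ r =>
    rw [modularDerivative, serreTheta, Nat.add_sub_cancel]
    push_cast
    ring

/-- The expansion of iterated theta derivatives in powers of the quasimodular Eisenstein series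
with coefficients the iterated modular derivatives. -/
theorem iterate_thetaOp_eq_sum (d : ℕ) (f : R⟦X⟧) (i : ℕ) :
    thetaOp^[i] f = ∑ s ∈ Finset.range (i + 1),
      (thetaCoeff d i s : R⟦X⟧) * (twelfthE2 R ^ s * modularDerivative d f (i - s)) := by
  induction i with
  | zero => simp [modularDerivative]
  | succ i ih =>
    set y := twelfthE2 R with hy
    set e := quasiDefect R with he
    set F := modularDerivative d f
    have hθy : thetaOp y = y * y - e := by rw [he, quasiDefect]; ring
    have hterm : ∀ s ∈ Finset.range (i + 1),
        thetaOp ((thetaCoeff d i s : R⟦X⟧) * (y ^ s * F (i - s))) =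
          ((thetaCoeff d i s : R⟦X⟧) * (y ^ s * F (i + 1 - s)) +
          ((thetaCoeff d i s * (s + (d + 1 + 2 * (i - s))) : ℕ) : R⟦X⟧) *
            (y ^ (s + 1) * F (i - s))) +
          (((thetaCoeff d i s * ((i - s) * (d + i - s)) : ℕ) : R⟦X⟧) *
            (e * (y ^ s * F (i - 1 - s))) -
          ((thetaCoeff d i s * s : ℕ) : R⟦X⟧) * (e * (y ^ (s - 1) * F (i - s)))) := by
      intro s hs
      obtain ⟨t, rfl⟩ := Nat.exists_eq_add_of_le (Nat.lt_succ_iff.1 (Finset.mem_range.1 hs))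
      have hys : thetaOp (y ^ s) = (s : R⟦X⟧) * (y ^ (s + 1) - e * y ^ (s - 1)) := by
        cases s with
        | zero =>
          have h := thetaOp_C (1 : R)
          rw [map_one] at h
          simp [h]
        | succ s =>
          rw [thetaOp_pow, hθy, Nat.add_sub_cancel]
          ring
      rw [thetaOp_natCast_mul, thetaOp_mul, hys, Nat.add_sub_cancel_left,
        thetaOp_modularDerivative, show s + t + 1 - s = t + 1 by omega,
        show d + (s + t) - s = d + t by omega, show s + t - 1 - s = t - 1 by omega]
      push_cast
      ring
    -- The terms with E₄ coming from θy cancel those coming from the recursion for the modular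
    -- derivatives, by `thetaCoeff_succ_mul`.
    have htel : ∑ s ∈ Finset.range (i + 1),
        (((thetaCoeff d i s * ((i - s) * (d + i - s)) : ℕ) : R⟦X⟧) *
            (e * (y ^ s * F (i - 1 - s))) -
          ((thetaCoeff d i s * s : ℕ) : R⟦X⟧) * (e * (y ^ (s - 1) * F (i - s)))) = 0 := by
      rw [Finset.sum_sub_distrib, Finset.sum_range_succ, Finset.sum_range_succ', Nat.sub_self,
        zero_mul, mul_zero, Nat.cast_zero, zero_mul, add_zero, mul_zero, Nat.cast_zero, zero_mul,
        add_zero, sub_eq_zero]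
      refine Finset.sum_congr rfl fun s hs => ?_
      rw [thetaCoeff_succ_mul, Nat.add_sub_cancel, show i - (s + 1) = i - 1 - s by omega]
    rw [Function.iterate_succ_apply', ih, thetaOp_sum, Finset.sum_congr rfl hterm,
      Finset.sum_add_distrib, htel, add_zero, Finset.sum_add_distrib, Finset.sum_range_succ',
      Finset.sum_range_succ' _ (i + 1)]
    rw [add_right_comm, thetaCoeff_zero, thetaCoeff_zero]
    congr 1
    rw [Finset.sum_range_succ _ i, Finset.sum_range_succ _ i, ← add_assoc,
      ← Finset.sum_add_distrib]
    congr 1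
    · refine Finset.sum_congr rfl fun s hs => ?_
      rw [thetaCoeff_succ_succ d (Finset.mem_range.1 hs).le,
        show i + 1 - (s + 1) = i - s by omega]
      push_cast
      ring
    · rw [thetaCoeff_succ_succ d le_rfl, thetaCoeff_eq_zero_of_lt d (Nat.lt_succ_self i),
        zero_add, show i + 1 - (i + 1) = i - i by omega]

end ThetaExpansion

section
variable {p : ℕ} [hp : Fact p.Prime]

theorem isIntegralForm_modularDerivative (hp5 : 5 ≤ p) {d : ℕ} {f : (pIntegral p)⟦X⟧}
    (hf : IsIntegralForm p (d + 1) f) (r : ℕ) :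
    IsIntegralForm p (d + 1 + 2 * r) (modularDerivative d f r) := by
  induction r using Nat.twoStepInduction with
  | zero => exact hf
  | one => exact hf.serreTheta hp5
  | more r h1 h2 =>
    refine ((h2.serreTheta hp5).of_weight_eq (by ring)).sub (IsIntegralForm.natCast_mul _ ?_)
    exact ((isIntegralForm_quasiDefect hp5).mul h1).of_weight_eq (by ring)

end

/-! ### The coefficients modulo p² -/

section ThetaCoefficients
variable {p : ℕ} [hp : Fact p.Prime]

theorem prime_dvd_choose_of_mod_lt {j s : ℕ} (h : j % p < s % p) : p ∣ j.choose s := by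
  have := Choose.choose_modEq_choose_mod_mul_choose_div_nat (n := j) (k := s) (p := p)
  rw [Nat.choose_eq_zero_of_lt h, zero_mul] at this
  exact (Nat.modEq_zero_iff_dvd).1 this

theorem cast_choose_mul_add (m r s : ℕ) (t : ℕ) (hr : r < p) (hs : s < p) :
    ((m * p + r).choose (t * p + s) : ZMod p) = (r.choose s : ZMod p) * (m.choose t : ZMod p) := by
  have := Choose.choose_modEq_choose_mod_mul_choose_div_nat (n := m * p + r) (k := t * p + s)
    (p := p)
  rw [mul_comm m, mul_comm t, Nat.mul_add_mod, Nat.mul_add_mod, Nat.mod_eq_of_lt hr,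
    Nat.mod_eq_of_lt hs, Nat.mul_add_div hp.out.pos, Nat.mul_add_div hp.out.pos,
    Nat.div_eq_of_lt hr, Nat.div_eq_of_lt hs, add_zero, add_zero] at this
  rw [mul_comm m, mul_comm t]
  exact_mod_cast (ZMod.natCast_eq_natCast_iff _ _ _).2 this

theorem prime_dvd_descFactorial {s : ℕ} (h : p ≤ s) (N : ℕ) : p ∣ N.descFactorial s :=
  ((Nat.dvd_factorial hp.out.pos h)).trans (Nat.factorial_dvd_descFactorial N s)

theorem sq_dvd_descFactorial {s : ℕ} (h : p + p ≤ s) (N : ℕ) : p ^ 2 ∣ N.descFactorial s := by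
  refine Dvd.dvd.trans ?_ (Nat.factorial_dvd_descFactorial N s)
  refine Dvd.dvd.trans ?_ (Nat.factorial_dvd_factorial h)
  refine Dvd.dvd.trans ?_ (Nat.factorial_mul_factorial_dvd_factorial_add p p)
  rw [pow_two]
  exact mul_dvd_mul (Nat.dvd_factorial hp.out.pos le_rfl) (Nat.dvd_factorial hp.out.pos le_rfl)

theorem dvd_descFactorial_of_lt (a : ℕ) {m t s : ℕ} (h : t < s) :
    a ∣ (m * a + t).descFactorial s := by
  rw [Nat.descFactorial_eq_prod_range]
  refine Dvd.dvd.trans ?_ (Finset.dvd_prod_of_mem _ (Finset.mem_range.2 h))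
  rw [Nat.add_sub_cancel]
  exact dvd_mul_left _ _

theorem cast_descFactorial_add_prime (N s : ℕ) :
    ((N + p).descFactorial s : ZMod p) = (N.descFactorial s : ZMod p) := by
  rw [← descPochhammer_eval_eq_descFactorial, ← descPochhammer_eval_eq_descFactorial]
  simp

/-- For s < p the binomial vanishes by Lucas; for s ≥ p the falling factorial is a multiple of s!.
-/
theorem prime_dvd_thetaCoeff (d m : ℕ) {r s : ℕ} (hr : r < p) (hs : r < s) :
    p ∣ thetaCoeff d (m * p + r) s := by
  rcases lt_or_ge s p with h | h
  · refine (prime_dvd_choose_of_mod_lt ?_).mul_right _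
    rwa [mul_comm m, Nat.mul_add_mod, Nat.mod_eq_of_lt hr, Nat.mod_eq_of_lt h]
  · exact (prime_dvd_descFactorial h _).mul_left _

/-- One factor p comes from the binomial, another from the falling factorial, which has gone past
the multiple mp. -/
theorem sq_dvd_thetaCoeff_of_lt_prime (d m : ℕ) {r s : ℕ} (hs : d + r < s) (hsp : s < p) :
    p ^ 2 ∣ thetaCoeff d (m * p + r) s := by
  rw [pow_two, thetaCoeff]
  refine mul_dvd_mul (prime_dvd_choose_of_mod_lt ?_) ?_
  · rw [mul_comm m, Nat.mul_add_mod, Nat.mod_eq_of_lt hsp, Nat.mod_eq_of_lt (by omega)]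
    omega
  · rw [add_left_comm]
    exact dvd_descFactorial_of_lt p hs

theorem sq_dvd_thetaCoeff_of_prime_lt (d m : ℕ) {r s : ℕ} (hr : r < p) (hs : p + r < s) :
    p ^ 2 ∣ thetaCoeff d (m * p + r) s := by
  rw [thetaCoeff]
  rcases lt_or_ge s (p + p) with h | h
  · rw [pow_two]
    refine mul_dvd_mul (prime_dvd_choose_of_mod_lt ?_) (prime_dvd_descFactorial (by omega) _)
    obtain ⟨t, rfl⟩ := Nat.exists_eq_add_of_le (show p ≤ s by omega)
    rw [mul_comm m, Nat.mul_add_mod, Nat.mod_eq_of_lt hr, Nat.add_mod_left,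
      Nat.mod_eq_of_lt (by omega)]
    omega
  · exact (sq_dvd_descFactorial h _).mul_left _

/-- The falling factorial splits off p! times a binomial over p. Lucas gives m + 1 once from this
binomial and once from C(i, p+s), while (p-1)! ≡ -1 by Wilson. This is the source of n² in the
exceptional congruence. -/
theorem sq_dvd_thetaCoeff_add_prime (d m : ℕ) {r s : ℕ} (hs : s ≤ r) (hr : d + r < p) :
    (p : ℤ) ^ 2 ∣ (thetaCoeff d ((m + 1) * p + r) (p + s) : ℤ) +
      p * (m + 1) ^ 2 * thetaCoeff d (m * p + r) s := by
  have hdesc := Nat.descFactorial_mul_descFactorial (k := s) (m := p + s)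
    (n := d + ((m + 1) * p + r)) (by omega)
  rw [Nat.add_sub_cancel, Nat.descFactorial_eq_factorial_mul_choose,
    ← Nat.mul_factorial_pred hp.out.ne_zero] at hdesc
  have hN : d + ((m + 1) * p + r) - s = (m + 1) * p + (d + r - s) := by omega
  rw [hN] at hdesc
  have key : (p : ℤ) ∣ (((m + 1) * p + r).choose (p + s) : ℤ) * (((p - 1).factorial : ℤ) *
      (((m + 1) * p + (d + r - s)).choose p : ℤ) * ((d + ((m + 1) * p + r)).descFactorial s : ℤ)) +
      (m + 1) ^ 2 * (((m * p + r).choose s : ℤ) * ((d + (m * p + r)).descFactorial s : ℤ)) := by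
    rw [← ZMod.intCast_zmod_eq_zero_iff_dvd]
    push_cast
    have h1 := cast_choose_mul_add (p := p) (m + 1) r s 1 (by omega) (by omega)
    have h2 := cast_choose_mul_add (p := p) (m + 1) (d + r - s) 0 1 (by omega) hp.out.pos
    have h3 := cast_choose_mul_add (p := p) m r s 0 (by omega) (by omega)
    have h4 := cast_descFactorial_add_prime (p := p) (d + (m * p + r)) s
    rw [show d + (m * p + r) + p = d + ((m + 1) * p + r) by ring] at h4
    rw [one_mul, Nat.choose_one_right] at h1
    rw [one_mul, add_zero, Nat.choose_one_right, Nat.choose_zero_right] at h2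
    rw [zero_mul, zero_add, Nat.choose_zero_right] at h3
    rw [h1, h2, h3, h4, ZMod.wilsons_lemma]
    push_cast
    ring
  obtain ⟨c, hc⟩ := key
  refine ⟨c, ?_⟩
  rw [thetaCoeff, thetaCoeff, ← hdesc]
  push_cast
  linear_combination (p : ℤ) * hc

variable {S : Type*} [CommRing S]

/-- The expression of the theta derivatives through the coefficients `F`, with `y` in the role of
the quasimodular Eisenstein series. -/
def thetaExpansion (d : ℕ) (y : S) (F : ℕ → S) (j : ℕ) : S :=
  ∑ s ∈ Finset.range (j + 1), (thetaCoeff d j s : S) * (y ^ s * F (j - s))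

theorem natCast_eq_zero_of_sq_dvd {p : ℕ} (hS : (p : S) ^ 2 = 0) {a : ℕ} (h : p ^ 2 ∣ a) :
    (a : S) = 0 := by
  obtain ⟨c, rfl⟩ := h
  rw [Nat.cast_mul, Nat.cast_pow, hS, zero_mul]

theorem prime_mul_natCast_eq_zero {p : ℕ} (hS : (p : S) ^ 2 = 0) {a : ℕ} (h : p ∣ a) :
    (p : S) * (a : S) = 0 := by
  obtain ⟨c, rfl⟩ := h
  rw [Nat.cast_mul, ← mul_assoc, ← pow_two, hS, zero_mul]

theorem prime_mul_thetaExpansion (hS : (p : S) ^ 2 = 0) (d m : ℕ) (y : S) (F : ℕ → S) {r : ℕ}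
    (hr : r < p) : (p : S) * thetaExpansion d y F (m * p + r) =
      p * ∑ s ∈ Finset.range (r + 1),
        (thetaCoeff d (m * p + r) s : S) * (y ^ s * F (m * p + r - s)) := by
  have hle : r + 1 ≤ m * p + r + 1 := by omega
  rw [thetaExpansion, ← Finset.sum_range_add_sum_Ico _ hle, mul_add, add_eq_left, Finset.mul_sum]
  refine Finset.sum_eq_zero fun s hs => ?_
  rw [← mul_assoc, prime_mul_natCast_eq_zero hS (prime_dvd_thetaCoeff d m hr
    (Finset.mem_Ico.1 hs).1), zero_mul]

/-- The expansion of theta derivatives of order `(m + 1) p + r + 1` modulo `p ^ 2`. -/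
theorem thetaExpansion_eq (hS : (p : S) ^ 2 = 0) (d m : ℕ) (y : S) (F B : ℕ → S)
    (hB : ∀ s ≤ p, y ^ s = B s + p * s * y ^ (s - 1 + p)) {r i : ℕ} (hr : d + (r + 1) < p)
    (hi : i = (m + 1) * p + (r + 1)) :
    thetaExpansion d y F i =
      ∑ s ∈ Finset.range (r + 2), (thetaCoeff d i s : S) * (B s * F (i - s)) +
      ∑ s ∈ Finset.Ico (r + 2) (d + (r + 1) + 1), (thetaCoeff d i s : S) * (y ^ s * F (i - s)) +
      p * (y ^ p * (((i * (d + i) : ℕ) : S) * thetaExpansion d y F ((m + 1) * p + r) -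
        (m + 1) ^ 2 * thetaExpansion d y F (m * p + (r + 1)))) := by
  have hipos : p + (r + 1) + 1 ≤ i + 1 := by rw [hi, add_mul]; omega
  -- The corrections p s y^(s-1+p) reassemble, by `succ_mul_thetaCoeff`, into i(d+i) times the
  -- expansion of order i - 1.
  have s1 : ∑ s ∈ Finset.range (r + 2), (thetaCoeff d i s : S) * (y ^ s * F (i - s)) =
      ∑ s ∈ Finset.range (r + 2), (thetaCoeff d i s : S) * (B s * F (i - s)) +
      y ^ p * (((i * (d + i) : ℕ) : S) * (p * thetaExpansion d y F ((m + 1) * p + r))) := by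
    rw [prime_mul_thetaExpansion hS d (m + 1) y F (show r < p by omega)]
    have : ∀ s ∈ Finset.range (r + 2), (thetaCoeff d i s : S) * (y ^ s * F (i - s)) =
        (thetaCoeff d i s : S) * (B s * F (i - s)) +
        p * (((s * thetaCoeff d i s : ℕ) : S) * (y ^ (s - 1 + p) * F (i - s))) := by
      intro s hs
      rw [hB s (by have := Finset.mem_range.1 hs; omega)]
      push_cast
      ring
    rw [Finset.sum_congr rfl this, Finset.sum_add_distrib, Finset.sum_range_succ' (fun s =>
      (p : S) * (((s * thetaCoeff d i s : ℕ) : S) * (y ^ (s - 1 + p) * F (i - s)))), zero_mul,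
      Nat.cast_zero, zero_mul, mul_zero, add_zero, Finset.mul_sum, Finset.mul_sum, Finset.mul_sum]
    congr 1
    refine Finset.sum_congr rfl fun s hs => ?_
    have hi' : i = (m + 1) * p + r + 1 := hi
    rw [hi', succ_mul_thetaCoeff, Nat.add_sub_cancel, Nat.add_sub_add_right, pow_add]
    push_cast
    ring
  have s3 : ∑ s ∈ Finset.Ico (d + (r + 1) + 1) p, (thetaCoeff d i s : S) * (y ^ s * F (i - s)) =
      0 := by
    refine Finset.sum_eq_zero fun s hs => ?_
    rw [Finset.mem_Ico] at hs
    rw [hi, natCast_eq_zero_of_sq_dvd hS (sq_dvd_thetaCoeff_of_lt_prime d _ (by omega) hs.2),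
      zero_mul]
  have s5 : ∑ s ∈ Finset.Ico (p + (r + 1) + 1) (i + 1),
      (thetaCoeff d i s : S) * (y ^ s * F (i - s)) = 0 := by
    refine Finset.sum_eq_zero fun s hs => ?_
    rw [Finset.mem_Ico] at hs
    rw [hi, natCast_eq_zero_of_sq_dvd hS
      (sq_dvd_thetaCoeff_of_prime_lt d _ (r := r + 1) (by omega) (by omega)), zero_mul]
  -- The block of exponents from p on reproduces the expansion of order i - p, with factor -(m+1)² p
  -- y^p.
  have s4 : ∑ s ∈ Finset.Ico p (p + (r + 1) + 1),
      (thetaCoeff d i s : S) * (y ^ s * F (i - s)) =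
      -(y ^ p * ((m + 1) ^ 2 * (p * thetaExpansion d y F (m * p + (r + 1))))) := by
    rw [prime_mul_thetaExpansion hS d m y F (show r + 1 < p by omega),
      Finset.sum_Ico_eq_sum_range, show p + (r + 1) + 1 - p = r + 1 + 1 by omega,
      Finset.mul_sum, Finset.mul_sum, Finset.mul_sum, ← Finset.sum_neg_distrib]
    refine Finset.sum_congr rfl fun s hs => ?_
    obtain ⟨c, hc⟩ := sq_dvd_thetaCoeff_add_prime (p := p) d m (r := r + 1) (s := s)
      (Nat.lt_succ_iff.1 (Finset.mem_range.1 hs)) hr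
    have hc2 := congrArg (Int.cast : ℤ → S) hc
    push_cast at hc2
    rw [hS, zero_mul] at hc2
    rw [hi, show (m + 1) * p + (r + 1) - (p + s) = m * p + (r + 1) - s by
      rw [add_mul, one_mul]; omega, pow_add]
    linear_combination y ^ p * y ^ s * F (m * p + (r + 1) - s) * hc2
  rw [thetaExpansion, ← Finset.sum_range_add_sum_Ico _ (show r + 2 ≤ i + 1 by omega),
    ← Finset.sum_Ico_consecutive _ (show r + 2 ≤ d + (r + 1) + 1 by omega)
      (show d + (r + 1) + 1 ≤ i + 1 by omega),
    ← Finset.sum_Ico_consecutive _ (show d + (r + 1) + 1 ≤ p by omega)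
      (show p ≤ i + 1 by omega),
    ← Finset.sum_Ico_consecutive _ (show p ≤ p + (r + 1) + 1 by omega) hipos, s1, s3, s4, s5]
  ring

end ThetaCoefficients

/-! ### Weights of the pieces of the expansion -/

section WeightsOfThetaDerivatives
variable {p : ℕ} [hp : Fact p.Prime] {d : ℕ} {f : (pIntegral p)⟦X⟧}

theorem dvd_iterate_thetaOp_sub (f : (pIntegral p)⟦X⟧) {a : ℕ} (ha : a ≠ 0) (j : ℕ) :
    (p : (pIntegral p)⟦X⟧) ∣ thetaOp^[a + j * (p - 1)] f - thetaOp^[a] f := by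
  rw [natCast_dvd_iff_map_reduction_eq_zero, map_sub, map_iterate_thetaOp, map_iterate_thetaOp,
    iterate_thetaOp_add_pred _ ha, sub_self]

/-- The theta derivatives of order `(m + 1) p + r + 1` modulo `p ^ 2`. -/
theorem sq_dvd_iterate_thetaOp_sub (hp5 : 5 ≤ p) (f : (pIntegral p)⟦X⟧) {m r i a : ℕ}
    (hr : d + (r + 1) < p) (hi : i = (m + 1) * p + (r + 1)) (ha : a = m + 1 + r) :
    (p : (pIntegral p)⟦X⟧) ^ 2 ∣ thetaOp^[i] f -
      (∑ s ∈ Finset.range (r + 2), (thetaCoeff d i s : (pIntegral p)⟦X⟧) *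
        (modularPowPart hp5 s * modularDerivative d f (i - s)) +
      ∑ s ∈ Finset.Ico (r + 2) (d + (r + 1) + 1), (thetaCoeff d i s : (pIntegral p)⟦X⟧) *
        (twelfthE2 (pIntegral p) ^ s * modularDerivative d f (i - s)) +
      p * ((((i * (d + i) : ℕ) : ℤ) - (m + 1) ^ 2 : ℤ) *
        (twelfthE2 (pIntegral p) ^ p * thetaOp^[a] f))) := by
  set y := twelfthE2 (pIntegral p) with hy
  set φ := Ideal.Quotient.mk (Ideal.span {(p : (pIntegral p)⟦X⟧) ^ 2})
  have hφ : ∀ x, φ x = 0 ↔ (p : (pIntegral p)⟦X⟧) ^ 2 ∣ x := fun x => by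
    rw [Ideal.Quotient.eq_zero_iff_mem, Ideal.mem_span_singleton]
  have hS : (p : (pIntegral p)⟦X⟧ ⧸ Ideal.span {(p : (pIntegral p)⟦X⟧) ^ 2}) ^ 2 = 0 := by
    rw [← map_natCast φ, ← map_pow, hφ]
  have hexp : ∀ j, φ (thetaOp^[j] f) =
      thetaExpansion d (φ y) (fun r => φ (modularDerivative d f r)) j := fun j => by
    rw [iterate_thetaOp_eq_sum d, thetaExpansion, map_sum]
    simp only [map_mul, map_natCast, map_pow, hy]
  have key := thetaExpansion_eq hS d m (φ y) (fun r => φ (modularDerivative d f r))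
    (fun s => φ (modularPowPart hp5 s)) (fun s hs => by
      have h := (hφ _).2 (sq_dvd_twelfthE2_pow_sub hp5 hs)
      rw [map_sub, map_sub, sub_sub, sub_eq_zero] at h
      simpa only [map_mul, map_pow, map_natCast] using h) hr hi
  -- The orders i - 1 and i - p both exceed a by multiples of p - 1, so modulo p both derivatives
  -- are θ^a f and the two corrections merge.
  obtain ⟨x1, h1⟩ := dvd_iterate_thetaOp_sub f (a := a) (by omega) (m + 1)
  obtain ⟨x2, h2⟩ := dvd_iterate_thetaOp_sub f (a := a) (by omega) m
  obtain ⟨q, hq⟩ := Nat.exists_eq_add_of_le' (show 1 ≤ p by omega)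
  have hq1 : p - 1 = q := by omega
  rw [show a + (m + 1) * (p - 1) = (m + 1) * p + r by rw [hq1, ha, hq]; ring] at h1
  rw [show a + m * (p - 1) = m * p + (r + 1) by rw [hq1, ha, hq]; ring] at h2
  rw [← hexp, ← hexp, ← hexp] at key
  have e1 := congrArg φ (eq_add_of_sub_eq h1)
  have e2 := congrArg φ (eq_add_of_sub_eq h2)
  rw [map_add, map_mul, map_natCast] at e1 e2
  rw [← hφ, map_sub, sub_eq_zero, key, e1, e2]
  simp only [map_add, map_mul, map_sum, map_natCast, map_pow, map_intCast]
  push_cast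
  linear_combination (φ y ^ p * (i * (d + i) * φ x1 - (m + 1) ^ 2 * φ x2)) * hS

/-- Modulo p each factor y has weight p + 1, that is p - 1 more than its quasimodular weight 2. -/
theorem isFormModPow_pow_mul_modularDerivative (hp5 : 5 ≤ p) (hf : IsIntegralForm p (d + 1) f)
    {i s t : ℕ} (hsi : s ≤ i) (hst : s ≤ t) : IsFormModPow p 1 (d + 1 + 2 * i + t * (p - 1))
      (twelfthE2 (pIntegral p) ^ s * modularDerivative d f (i - s)) := by
  refine (((isFormModPow_twelfthE2 hp5).pow s).mul
    ((isIntegralForm_modularDerivative hp5 hf (i - s)).isFormModPow 1)).raise hp5 (t - s) ?_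
  obtain ⟨u, rfl⟩ := Nat.exists_eq_add_of_le hsi
  obtain ⟨v, rfl⟩ := Nat.exists_eq_add_of_le hst
  obtain ⟨q, hq⟩ := Nat.exists_eq_add_of_le' (show 1 ≤ p by omega)
  rw [Nat.add_sub_cancel_left, Nat.add_sub_cancel_left, hq, Nat.add_sub_cancel]
  ring

theorem isFormModPow_modularPowPart_sum (hp5 : 5 ≤ p) (hf : IsIntegralForm p (d + 1) f) {i r : ℕ}
    (hri : r ≤ i + 1) (hrp : r ≤ p + 1) : IsFormModPow p 2 (d + 1 + 2 * i + p * (p - 1))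
      (∑ s ∈ Finset.range r, (thetaCoeff d i s : (pIntegral p)⟦X⟧) *
        (modularPowPart hp5 s * modularDerivative d f (i - s))) := by
  refine IsFormModPow.sum _ _ fun s hs => IsFormModPow.natCast_mul _ ?_
  rw [Finset.mem_range] at hs
  exact (((isIntegralForm_modularPowPart hp5 (by omega)).mul
    (isIntegralForm_modularDerivative hp5 hf (i - s))).of_weight_eq (by omega)).isFormModPow 2

/-- Beyond s = r the coefficients carry a factor p, so these terms matter only modulo p. -/
theorem exists_sum_Ico_eq_prime_mul (hp5 : 5 ≤ p) (hf : IsIntegralForm p (d + 1) f) {m r i t : ℕ}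
    (hr : r < p) (hi : i = (m + 1) * p + r) (ht : t < p) :
    ∃ S, ∑ s ∈ Finset.Ico (r + 1) (t + 1), (thetaCoeff d i s : (pIntegral p)⟦X⟧) *
        (twelfthE2 (pIntegral p) ^ s * modularDerivative d f (i - s)) =
      p * S ∧ IsFormModPow p 1 (d + 1 + 2 * i + t * (p - 1)) S := by
  refine ⟨∑ s ∈ Finset.Ico (r + 1) (t + 1), ((thetaCoeff d i s / p : ℕ) : (pIntegral p)⟦X⟧) *
        (twelfthE2 (pIntegral p) ^ s * modularDerivative d f (i - s)), ?_, ?_⟩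
  · rw [Finset.mul_sum]
    refine Finset.sum_congr rfl fun s hs => ?_
    rw [Finset.mem_Ico] at hs
    obtain ⟨c, hc⟩ := prime_dvd_thetaCoeff d (m + 1) hr (s := s) (by omega)
    rw [hi, hc, Nat.mul_div_cancel_left _ hp.out.pos]
    push_cast
    ring
  · refine IsFormModPow.sum _ _ fun s hs => IsFormModPow.natCast_mul _ ?_
    rw [Finset.mem_Ico] at hs
    have : p ≤ i := by rw [hi, add_mul]; omega
    exact isFormModPow_pow_mul_modularDerivative hp5 hf (by omega) (by omega)

/-- Serves the two ends i' = 0 and i' = p - k + 1. Only s = 0 counts fully modulo p²; the terms with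
0 < s ≤ p are p times forms modulo p of weight at most k + 2i + p(p-1). -/
theorem isFormModPow_iterate_thetaOp_of_dvd (hp5 : 5 ≤ p) (hf : IsIntegralForm p (d + 1) f)
    {i : ℕ} (h1 : ∀ s, 0 < s → s ≤ p → p ∣ thetaCoeff d i s)
    (h2 : ∀ s, p < s → p ^ 2 ∣ thetaCoeff d i s) :
    IsFormModPow p 2 (d + 1 + 2 * i + p * (p - 1)) (thetaOp^[i] f) := by
  rw [iterate_thetaOp_eq_sum d]
  refine IsFormModPow.sum _ _ fun s hs => ?_
  have hsi := Nat.lt_succ_iff.1 (Finset.mem_range.1 hs)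
  rcases Nat.eq_zero_or_pos s with rfl | h0
  · refine IsFormModPow.natCast_mul _ (IsFormModPow.raise_sq hp5 ?_ 1
      (show d + 1 + 2 * i + 1 * (p * (p - 1)) = _ by ring))
    rw [pow_zero, one_mul, Nat.sub_zero]
    exact (isIntegralForm_modularDerivative hp5 hf i).isFormModPow 2
  rcases le_or_gt s p with hsp | hsp
  · obtain ⟨c, hc⟩ := h1 s h0 hsp
    rw [hc, Nat.cast_mul, mul_assoc]
    exact ((isFormModPow_pow_mul_modularDerivative hp5 hf hsi hsp).natCast_mul c).prime_mul
  · obtain ⟨c, hc⟩ := h2 s hsp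
    refine isFormModPow_of_dvd ?_ _
    rw [hc]
    push_cast
    exact (dvd_mul_right _ _).mul_right _

/-- Modulo p, θ^((m+1)p+j) f equals θ^(m+1+j) f, and the coefficients with s > j vanish, so the
expansion can be solved recursively for its leading form. For j ≤ m the resulting weight is
(m+1-j)(p-1) below the natural one. -/
theorem isFormModPow_modularDerivative_of_le (hp5 : 5 ≤ p) (hf : IsIntegralForm p (d + 1) f)
    (m j : ℕ) (hj : j < p) : IsFormModPow p 1 (d + 1 + (m + 1 + j) * (p + 1))
      (modularDerivative d f ((m + 1) * p + j)) := by
  induction j using Nat.strong_induction_on with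
  | _ j ih =>
  have hθ : IsFormModPow p 1 (d + 1 + (m + 1 + j) * (p + 1)) (thetaOp^[(m + 1) * p + j] f) := by
    refine ((hf.isFormModPow 1).iterate_thetaOp hp5 (m + 1 + j)).congr ?_
    have h := dvd_iterate_thetaOp_sub f (a := m + 1 + j) (by omega) (m + 1)
    obtain ⟨q, hq⟩ := Nat.exists_eq_add_of_le' (show 1 ≤ p by omega)
    have hq1 : p - 1 = q := by omega
    rw [show m + 1 + j + (m + 1) * (p - 1) = (m + 1) * p + j by rw [hq1, hq]; ring] at h
    simpa using h
  rw [iterate_thetaOp_eq_sum d, Finset.sum_range_succ', thetaCoeff_zero, pow_zero, Nat.cast_one,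
    one_mul, one_mul, Nat.sub_zero] at hθ
  have hS : IsFormModPow p 1 (d + 1 + (m + 1 + j) * (p + 1))
      (∑ s ∈ Finset.range ((m + 1) * p + j),
        (thetaCoeff d ((m + 1) * p + j) (s + 1) : (pIntegral p)⟦X⟧) *
        (twelfthE2 (pIntegral p) ^ (s + 1) *
          modularDerivative d f ((m + 1) * p + j - (s + 1)))) := by
    refine IsFormModPow.sum _ _ fun s hs => ?_
    rcases lt_or_ge j (s + 1) with hjs | hjs
    · refine isFormModPow_of_dvd ?_ _
      obtain ⟨c, hc⟩ := prime_dvd_thetaCoeff d (m + 1) hj hjs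
      rw [hc, pow_one, Nat.cast_mul, mul_assoc]
      exact dvd_mul_right _ _
    · refine IsFormModPow.natCast_mul _ ?_
      obtain ⟨t, rfl⟩ := Nat.exists_eq_add_of_le hjs
      rw [show (m + 1) * p + (s + 1 + t) - (s + 1) = (m + 1) * p + t by omega]
      exact (((isFormModPow_twelfthE2 hp5).pow (s + 1)).mul
        (ih t (by omega) (by omega))).of_weight_eq (by ring)
  simpa using hθ.sub hS

theorem prime_dvd_thetaCoeff_of_dvd_add {p d i s : ℕ} (h : p ∣ d + i) (hs : 0 < s) :
    p ∣ thetaCoeff d i s := by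
  obtain ⟨c, hc⟩ := h
  have := dvd_descFactorial_of_lt p (m := c) hs
  rw [add_zero, mul_comm c, ← hc] at this
  exact this.mul_left _

theorem sq_dvd_thetaCoeff_of_dvd_add {i s : ℕ} (h : p ∣ d + i) (hs : p < s) :
    p ^ 2 ∣ thetaCoeff d i s := by
  refine Dvd.dvd.mul_left ?_ _
  obtain ⟨c, hc⟩ := h
  rw [← Nat.descFactorial_mul_descFactorial hs.le, pow_two]
  refine mul_dvd_mul ?_ (prime_dvd_descFactorial le_rfl _)
  have := dvd_descFactorial_of_lt p (m := c - 1) (show 0 < s - p by omega)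
  rwa [add_zero, Nat.sub_mul, one_mul, mul_comm c, ← hc] at this

/-- The drop of the weight of the theta derivatives modulo `p` beyond the order `p - d`. -/
theorem isFormModPow_iterate_thetaOp_of_ge (hp5 : 5 ≤ p) (hf : IsIntegralForm p (d + 1) f)
    (hd : d ≤ p) (a : ℕ) : IsFormModPow p 1 (d + 1 + 2 * (p - d) + a * (p + 1))
      (thetaOp^[a + (p - d)] f) := by
  rw [Function.iterate_add_apply]
  refine IsFormModPow.iterate_thetaOp hp5 ?_ a
  -- At order p - d the falling factorials start at d + i = p, so modulo p only the leading modular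
  -- derivative survives.
  refine ((isIntegralForm_modularDerivative hp5 hf (p - d)).isFormModPow 1).congr ?_
  rw [iterate_thetaOp_eq_sum d, Finset.sum_range_succ', thetaCoeff_zero, pow_zero, Nat.cast_one,
    one_mul, one_mul, Nat.sub_zero, add_sub_cancel_right, pow_one]
  refine Finset.dvd_sum fun s hs => ?_
  obtain ⟨c, hc⟩ := prime_dvd_thetaCoeff_of_dvd_add (p := p) (d := d) (i := p - d) (s := s + 1)
    (by rw [Nat.add_sub_cancel' hd]) (Nat.succ_pos s)
  rw [hc, Nat.cast_mul, mul_assoc]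
  exact dvd_mul_right _ _

/-- If the summands beyond the first have lower weights modulo `p`, the modular part of the
expansion has lower weight up to `p` times a form modulo `p`. -/
theorem exists_modularPowPart_sum_eq (hp5 : 5 ≤ p) (hf : IsIntegralForm p (d + 1) f)
    {m r i : ℕ} (hrm : r ≤ m) (hr : r < p) (hi : i = (m + 1) * p + r) :
    ∃ S T, IsFormModPow p 2 (d + 1 + 2 * i) S ∧
      IsFormModPow p 1 (d + 1 + 2 * i + r * (p - 1)) T ∧
      ∑ s ∈ Finset.range (r + 1), (thetaCoeff d i s : (pIntegral p)⟦X⟧) *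
        (modularPowPart hp5 s * modularDerivative d f (i - s)) = S + p * T := by
  refine Finset.sum_induction _ (fun x => ∃ S T, IsFormModPow p 2 (d + 1 + 2 * i) S ∧
      IsFormModPow p 1 (d + 1 + 2 * i + r * (p - 1)) T ∧ x = S + p * T) ?_ ?_ ?_
  · rintro _ _ ⟨S, T, h1, h2, rfl⟩ ⟨S', T', h3, h4, rfl⟩
    exact ⟨S + S', T + T', h1.add h3, h2.add h4, by ring⟩
  · exact ⟨0, 0, (IsIntegralForm.zero _).isFormModPow 2, (IsIntegralForm.zero _).isFormModPow 1,
      by simp⟩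
  intro s hs
  have hsr := Nat.lt_succ_iff.1 (Finset.mem_range.1 hs)
  suffices h : ∃ S T, IsFormModPow p 2 (d + 1 + 2 * i) S ∧
      IsFormModPow p 1 (d + 1 + 2 * i + r * (p - 1)) T ∧
      modularPowPart hp5 s * modularDerivative d f (i - s) = S + p * T by
    obtain ⟨S, T, h1, h2, h3⟩ := h
    exact ⟨_, _, h1.natCast_mul (thetaCoeff d i s), h2.natCast_mul (thetaCoeff d i s),
      by rw [h3]; ring⟩
  obtain ⟨j, rfl⟩ := Nat.exists_eq_add_of_le hsr
  have hij : i - s = (m + 1) * p + j := by omega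
  obtain ⟨u, rfl⟩ := Nat.exists_eq_add_of_le hrm
  obtain ⟨q, hq⟩ := Nat.exists_eq_add_of_le' (show 1 ≤ p by omega)
  have hq1 : p - 1 = q := by omega
  -- Here m = s + j + u, so the modular derivative is E^(s+u+1) g up to p times a form of its own
  -- weight.
  obtain ⟨g, hg, x, hx⟩ := isFormModPow_modularDerivative_of_le hp5 hf (s + j + u) j (by omega)
  rw [← hij, pow_one] at hx
  obtain ⟨z, hz⟩ := dvd_hasseForm_pow_sub_one (p := p) hp5 (s + u + 1)
  have hF := isIntegralForm_modularDerivative hp5 hf (i - s)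
  set F := modularDerivative d f (i - s)
  set E := hasseForm (p := p) hp5
  have hE := isIntegralForm_hasseForm (p := p) hp5
  have hg2 : IsIntegralForm p (d + 1 + 2 * (i - s)) (E ^ (s + u + 1) * g) := by
    refine ((hE.pow _).mul hg).of_weight_eq ?_
    rw [hij, hq1, hq]
    ring
  have hdiff : F - E ^ (s + u + 1) * g = p * (x - z * g) := by
    linear_combination hx - g * hz
  have hx2 : IsIntegralForm p (d + 1 + 2 * (i - s)) (x - z * g) := by
    have := hF.sub hg2
    rw [hdiff] at this
    exact this.of_natCast_mul hp.out.ne_zero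
  obtain ⟨w, hw⟩ := sq_dvd_hasseForm_pow_prime_sub_one (p := p) hp5
  have hb := isIntegralForm_hasseSerreTheta (p := p) hp5
  set b := hasseSerreTheta (p := p) hp5
  -- The powers of E contributed by the modular part and by the weight drop combine to contain E^p,
  -- which is 1 modulo p²; this removes p(p-1) from the weight.
  have hEE : E ^ (p - s) * E ^ (s + u + 1) = E ^ p * E ^ (u + 1) := by
    rw [← pow_add, ← pow_add]
    congr 1
    omega
  refine ⟨b ^ s * (E ^ p * (E ^ (u + 1) * g)), b ^ s * (E ^ (p - s) * (x - z * g)), ?_, ?_, ?_⟩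
  · have h1 : IsIntegralForm p (d + 1 + 2 * i) (b ^ s * (E ^ (u + 1) * g)) := by
      refine ((hb.pow s).mul ((hE.pow _).mul hg)).of_weight_eq ?_
      rw [hi, hq1, hq]
      ring
    refine (h1.isFormModPow 2).congr ⟨b ^ s * (E ^ (u + 1) * g) * w, ?_⟩
    linear_combination b ^ s * (E ^ (u + 1) * g) * hw
  · have h1 : IsFormModPow p 1 (d + 1 + 2 * i + s * (p - 1)) (b ^ s * (x - z * g)) := by
      refine ((hb.pow s).mul hx2).of_weight_eq ?_ |>.isFormModPow 1
      rw [hij, hi, hq1, hq]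
      ring
    obtain ⟨v, hv⟩ := dvd_hasseForm_pow_sub_one (p := p) hp5 (p - s)
    refine (h1.raise hp5 j (by ring)).congr ⟨b ^ s * (x - z * g) * v, ?_⟩
    linear_combination b ^ s * (x - z * g) * hv
  · rw [modularPowPart]
    linear_combination b ^ s * E ^ (p - s) * hdiff + b ^ s * g * hEE

end WeightsOfThetaDerivatives

/-! ### Tools for the lower bounds -/

section LowerBounds
variable {p : ℕ} [hp : Fact p.Prime] {f : (pIntegral p)⟦X⟧}

theorem IsFormModPow.exists_poly (hp5 : 5 ≤ p) {w : ℕ} (hf : IsFormModPow p 1 w f) :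
    ∃ P, IsGraded P w ∧ evalEisenstein p P = PowerSeries.map (pIntegralReduction p) f := by
  obtain ⟨h, h1, h2⟩ := hf
  rw [pow_one, natCast_dvd_iff_map_reduction_eq_zero, map_sub, sub_eq_zero] at h2
  rw [h2]
  exact h1.exists_poly hp5

/-- A form of weight `k < p` whose filtration is `k > 0` is not divisible by some prime factor of
the Hasse invariant. -/
theorem exists_prime_not_dvd_of_weightFiltration (hp5 : 5 ≤ p) {k : ℕ} (hk0 : 0 < k) (hkp : k < p)
    (hf : IsIntegralForm p k f) (hω : weightFiltration p 1 f = (k : ℕ∞)) :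
    ∃ F π, IsGraded F k ∧ evalEisenstein p F = PowerSeries.map (pIntegralReduction p) f ∧
      Prime π ∧ π ∣ hassePoly hp5 ∧ ¬ π ∣ F := by
  obtain ⟨F, hF, hFe⟩ := hf.exists_poly hp5
  have hconst : ∀ c, PowerSeries.map (pIntegralReduction p) f ≠ PowerSeries.C c := by
    intro c hc
    have h : IsFormModPow p 1 0 f := by
      refine ((IsIntegralForm.C (p := p) ((c.val : ℕ) : pIntegral p)).isFormModPow 1).congr ?_
      rw [pow_one, natCast_dvd_iff_map_reduction_eq_zero, map_sub, hc, map_C, map_natCast,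
        ZMod.natCast_zmod_val, sub_self]
    have h2 := weightFiltration_le_of_isFormModPow h
    rw [hω] at h2
    have : k ≤ 0 := by exact_mod_cast h2
    omega
  -- Since k ≤ p - 1, divisibility by A leaves only constant multiples of A, whose value is
  -- constant, of filtration 0.
  have hA : ¬ hassePoly hp5 ∣ F := by
    rintro ⟨G, rfl⟩
    have h0 : hassePoly hp5 * G ≠ 0 := fun h => hconst 0 (by rw [← hFe, h, map_zero, map_zero])
    obtain ⟨a, b, hab, ha, hb⟩ := IsGraded.exists_of_mul hF h0
    have h1 := (isGraded_hassePoly hp5).weight_unique ha (hassePoly_ne_zero hp5)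
    have hA0 : 0 < p - 1 := by omega
    obtain rfl : b = 0 := by omega
    obtain ⟨c, rfl⟩ := hb.eq_C_of_weight_zero
    exact hconst c (by rw [← hFe, map_mul, evalEisenstein_hassePoly, evalEisenstein_C, one_mul])
  obtain ⟨π, h1, h2, h3⟩ := exists_prime_dvd_hassePoly_not_dvd hp5 hA
  exact ⟨F, π, hF, hFe, h1, h2, h3⟩

variable {k : ℕ} {F π : MvPolynomial (Fin 2) (ZMod p)}

/-- Vanishing modulo p persists under θ, hence reaches order 1 + i(p-1), where the derivative is θf
modulo p. But π does not divide the polynomial of θf. -/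
theorem not_dvd_iterate_thetaOp (hp5 : 5 ≤ p) (hk : (k : ZMod p) ≠ 0) (hF : IsGraded F k)
    (hFe : evalEisenstein p F = PowerSeries.map (pIntegralReduction p) f) (hπ : Prime π)
    (hd : π ∣ hassePoly hp5) (hπF : ¬ π ∣ F) (i : ℕ) :
    ¬ (p : (pIntegral p)⟦X⟧) ∣ thetaOp^[i] f := by
  intro h
  have h2 : ∀ j, (p : (pIntegral p)⟦X⟧) ∣ thetaOp^[j + i] f := by
    intro j
    induction j with
    | zero => simpa using h
    | succ j ih =>
      rw [Nat.succ_add, Function.iterate_succ_apply']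
      rw [← pow_one (p : (pIntegral p)⟦X⟧)] at ih ⊢
      exact natCast_pow_dvd_thetaOp ih
  have h3 := h2 (1 + i * (p - 1) - i)
  have hle : i ≤ i * (p - 1) := Nat.le_mul_of_pos_right _ (by omega)
  rw [Nat.sub_add_cancel (by omega)] at h3
  have h4 := dvd_iterate_thetaOp_sub f one_ne_zero i
  rw [dvd_sub_right h3, natCast_dvd_iff_map_reduction_eq_zero, map_iterate_thetaOp, ← hFe] at h4
  obtain ⟨Q, hQ, h5, h6⟩ := exists_poly_iterate_thetaOp hp5 hπ hd hF hπF 1 (by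
    intro j hj
    obtain rfl : j = 0 := by omega
    simpa using hk)
  rw [h4] at h5
  exact h6 (by rw [hQ.eq_zero_of_eval_eq_zero hp5 h5]; exact dvd_zero _)

/-- The product is represented by (∂A)^p times the polynomial of θ^a f. Neither factor is divisible
by π, so no power of A can be removed. -/
theorem not_isFormModPow_twelfthE2_pow_mul (hp5 : 5 ≤ p) (hF : IsGraded F k)
    (hFe : evalEisenstein p F = PowerSeries.map (pIntegralReduction p) f) (hπ : Prime π)
    (hd : π ∣ hassePoly hp5) (hπF : ¬ π ∣ F) {a w t : ℕ}
    (ha : ∀ j < a, ((k + j : ℕ) : ZMod p) ≠ 0) (ht : t ≠ 0)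
    (hw : k + (p + a) * (p + 1) = w + t * (p - 1)) :
    ¬ IsFormModPow p 1 w (twelfthE2 (pIntegral p) ^ p * thetaOp^[a] f) := by
  intro h
  obtain ⟨V, hV, hVe⟩ := h.exists_poly hp5
  obtain ⟨Q, hQ, hQe, hQπ⟩ := exists_poly_iterate_thetaOp hp5 hπ hd hF hπF a ha
  have hU : IsGraded (ramanujanDerivation p (hassePoly hp5) ^ p * Q) (w + t * (p - 1)) :=
    (((isGraded_derivation_hassePoly hp5).pow p).mul hQ).of_eq (by rw [← hw]; ring)
  refine ht (weight_eq_of_not_dvd hp5 hd hU ?_ hV ?_)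
  · intro h
    rcases hπ.dvd_or_dvd h with h | h
    · exact not_dvd_derivation_hassePoly hp5 hπ hd (hπ.dvd_of_dvd_pow h)
    · exact hQπ h
  · rw [hVe, map_mul, map_pow, evalEisenstein_derivation_hassePoly, hQe, hFe, map_mul, map_pow,
      map_twelfthE2 hp5, map_iterate_thetaOp]

/-- The weights of forms congruent modulo `p ^ 2` to a series that is not zero modulo `p` differ by
multiples of `p (p - 1)`. -/
theorem exists_weight_eq_add_mul (hp5 : 5 ≤ p) {g : (pIntegral p)⟦X⟧} {v w : ℕ}
    (hv : IsFormModPow p 2 v g) (hw : IsFormModPow p 2 w g) (hlt : v < w)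
    (h0 : ¬ (p : (pIntegral p)⟦X⟧) ∣ g) : ∃ t, w = v + (t + 1) * (p * (p - 1)) := by
  obtain ⟨V, hV, hVe⟩ := hv.weaken.exists_poly hp5
  obtain ⟨W, hW, hWe⟩ := hw.weaken.exists_poly hp5
  have hV0 : V ≠ 0 := by
    rintro rfl
    rw [map_zero] at hVe
    exact h0 ((natCast_dvd_iff_map_reduction_eq_zero _).2 hVe.symm)
  have hmod := hV.weight_modEq hp5 hW (hVe.trans hWe.symm) hV0
  obtain ⟨u, hu⟩ := (Nat.modEq_iff_dvd' hlt.le).1 hmod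
  obtain ⟨h, hh1, hh2⟩ := hv
  obtain ⟨h', hh3, hh4⟩ := hw
  obtain rfl : w = v + u * (p - 1) := by rw [mul_comm, ← hu]; omega
  have hpdvd : (p : (pIntegral p)⟦X⟧) ∣ (p : (pIntegral p)⟦X⟧) ^ 2 := dvd_pow_self _ two_ne_zero
  have hpu := dvd_of_congruent_mod_sq hp5 hh1 hh3 (by simpa using dvd_sub hh4 hh2)
    (fun h5 => h0 (by simpa using dvd_add (hpdvd.trans hh2) h5))
  obtain ⟨t, rfl⟩ := hpu
  cases t with
  | zero => omega
  | succ t => exact ⟨t, by ring⟩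

theorem IsFormModPow.of_intCast_mul {w : ℕ} {g : (pIntegral p)⟦X⟧} {a : ℤ} (ha : ¬ (p : ℤ) ∣ a)
    (h : IsFormModPow p 1 w ((a : (pIntegral p)⟦X⟧) * g)) : IsFormModPow p 1 w g := by
  have hco : IsCoprime (p : ℤ) a := (Nat.prime_iff_prime_int.1 hp.out).coprime_iff_not_dvd.2 ha
  obtain ⟨u, v, huv⟩ := hco
  refine (h.intCast_mul v).congr ⟨(u : (pIntegral p)⟦X⟧) * g, ?_⟩
  have := congrArg (Int.cast : ℤ → (pIntegral p)⟦X⟧) huv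
  push_cast at this
  linear_combination -g * this

end LowerBounds

/-! ### Main form plus correction modulo p² -/

section ThetaDerivativesModuloSquare
variable {p : ℕ} [hp : Fact p.Prime] {d m r i : ℕ} {f : (pIntegral p)⟦X⟧}

theorem isFormModPow_twelfthE2_pow_mul (hp5 : 5 ≤ p) (hf : IsIntegralForm p (d + 1) f) {a w t : ℕ}
    (h : d + 1 + (p + a) * (p + 1) + t * (p - 1) = w) :
    IsFormModPow p 1 w (twelfthE2 (pIntegral p) ^ p * thetaOp^[a] f) :=
  ((((isFormModPow_twelfthE2 hp5).pow p).mul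
    ((hf.isFormModPow 1).iterate_thetaOp hp5 a)).of_weight_eq (by ring)).raise hp5 t h

/-- The theta derivatives of order `(m + 1) p + r + 1` are the sum of a form of the expected
weight modulo `p ^ 2` and an explicit multiple of `p`. -/
theorem exists_isFormModPow_add (hp5 : 5 ≤ p) (hf : IsIntegralForm p (d + 1) f)
    (hr : d + (r + 1) < p) (hi : i = (m + 1) * p + (r + 1)) :
    ∃ S, IsFormModPow p 2 (d + 1 + 2 * i + p * (p - 1)) S ∧ thetaOp^[i] f = S +
      p * ((((i * (d + i) : ℕ) : ℤ) - (m + 1) ^ 2 : ℤ) *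
        (twelfthE2 (pIntegral p) ^ p * thetaOp^[m + 1 + r] f)) := by
  obtain ⟨x, hx⟩ := sq_dvd_iterate_thetaOp_sub hp5 f hr hi rfl
  have h1 := isFormModPow_modularPowPart_sum hp5 hf (i := i) (r := r + 2) (by omega) (by omega)
  obtain ⟨S, hS, hS2⟩ := exists_sum_Ico_eq_prime_mul hp5 hf (t := d + (r + 1))
    (show r + 1 < p by omega) hi hr
  have h2 : IsFormModPow p 2 (d + 1 + 2 * i + p * (p - 1)) ((p : (pIntegral p)⟦X⟧) * S) := by
    refine (hS2.raise hp5 (p - (d + (r + 1))) ?_).prime_mul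
    rw [add_assoc, ← add_mul, Nat.add_sub_cancel' hr.le]
  have h3 : IsFormModPow p 2 (d + 1 + 2 * i + p * (p - 1)) ((p : (pIntegral p)⟦X⟧) ^ 2 * x) :=
    isFormModPow_of_dvd (dvd_mul_right _ _) _
  refine ⟨_, (h1.add h2).add h3, ?_⟩
  rw [hS] at hx
  linear_combination hx

/-- A refinement of `exists_isFormModPow_add` for i' < n: the drop of the modular derivatives brings
the main form down to weight k + 2i, at the price of p times a form modulo p whose weight is still
below that of the correction when n ≤ p - d. -/
theorem exists_isFormModPow_add_prime_mul_add (hp5 : 5 ≤ p) (hf : IsIntegralForm p (d + 1) f)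
    (hr : d + (r + 1) < p) (hi : i = (m + 1) * p + (r + 1)) (hrm : r + 1 ≤ m) :
    ∃ S T, IsFormModPow p 2 (d + 1 + 2 * i) S ∧
      IsFormModPow p 1 (d + 1 + 2 * i + (d + (r + 1)) * (p - 1)) T ∧ thetaOp^[i] f = S + p * T +
      p * ((((i * (d + i) : ℕ) : ℤ) - (m + 1) ^ 2 : ℤ) *
        (twelfthE2 (pIntegral p) ^ p * thetaOp^[m + 1 + r] f)) := by
  obtain ⟨x, hx⟩ := sq_dvd_iterate_thetaOp_sub hp5 f hr hi rfl
  obtain ⟨S, T, h1, h2, h3⟩ := exists_modularPowPart_sum_eq hp5 hf hrm (by omega) hi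
  obtain ⟨S', hS, hS2⟩ := exists_sum_Ico_eq_prime_mul hp5 hf (t := d + (r + 1))
    (show r + 1 < p by omega) hi hr
  have h4 : IsFormModPow p 2 (d + 1 + 2 * i) ((p : (pIntegral p)⟦X⟧) ^ 2 * x) :=
    isFormModPow_of_dvd (dvd_mul_right _ _) _
  refine ⟨S + _, T + S', h1.add h4, (h2.raise hp5 d (by ring)).add hS2, ?_⟩
  rw [hS, h3] at hx
  linear_combination hx

end ThetaDerivativesModuloSquare

/-! ### Upper and lower bounds by position in the segment -/

section FinalBounds
variable {p : ℕ} [hp : Fact p.Prime] {d m r i : ℕ} {f : (pIntegral p)⟦X⟧}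

theorem isFormModPow_of_dvd_coefficient (hp5 : 5 ≤ p) (hf : IsIntegralForm p (d + 1) f)
    (hr : d + (r + 1) < p) (hi : i = (m + 1) * p + (r + 1))
    (hΛ : (p : ℤ) ∣ ((i * (d + i) : ℕ) : ℤ) - (m + 1) ^ 2) :
    IsFormModPow p 2 (d + 1 + 2 * i + p * (p - 1)) (thetaOp^[i] f) := by
  obtain ⟨S, hS, hSe⟩ := exists_isFormModPow_add hp5 hf hr hi
  obtain ⟨c, hc⟩ := hΛ
  refine hS.congr ⟨(c : (pIntegral p)⟦X⟧) * (twelfthE2 (pIntegral p) ^ p *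
    thetaOp^[m + 1 + r] f), ?_⟩
  rw [hSe, hc]
  push_cast
  ring

theorem isFormModPow_of_isFormModPow (hp5 : 5 ≤ p) (hf : IsIntegralForm p (d + 1) f)
    (hr : d + (r + 1) < p) (hi : i = (m + 1) * p + (r + 1))
    (h : IsFormModPow p 1 (d + 1 + 2 * i + p * (p - 1))
      (twelfthE2 (pIntegral p) ^ p * thetaOp^[m + 1 + r] f)) :
    IsFormModPow p 2 (d + 1 + 2 * i + p * (p - 1)) (thetaOp^[i] f) := by
  obtain ⟨S, hS, hSe⟩ := exists_isFormModPow_add hp5 hf hr hi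
  rw [hSe]
  exact hS.add (h.intCast_mul _).prime_mul

/-- The bound when the order of the theta derivative is large. -/
theorem isFormModPow_of_large (hp5 : 5 ≤ p) (hf : IsIntegralForm p (d + 1) f)
    (hr : d + (r + 1) < p) (hi : i = (m + 1) * p + (r + 1)) (hlarge : p - d ≤ m + 1 + r) :
    IsFormModPow p 2 (d + 1 + 2 * i + p * (p - 1)) (thetaOp^[i] f) := by
  refine isFormModPow_of_isFormModPow hp5 hf hr hi ?_
  obtain ⟨a, ha⟩ := Nat.exists_eq_add_of_le' hlarge
  rw [ha]
  -- The correction exceeds the target by r + 1 - m multiples of p - 1, and the drop of θ^(p-d) f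
  -- saves p - d of them, leaving this many to fill up.
  refine ((((isFormModPow_twelfthE2 hp5).pow p).mul
    (isFormModPow_iterate_thetaOp_of_ge hp5 hf (by omega) a))).raise hp5
      (m + (p - d - (r + 1))) ?_
  obtain ⟨q, rfl⟩ := Nat.exists_eq_add_of_le' hr
  rw [hi]
  have e1 : q + (d + (r + 1)).succ - d = q + r + 2 := by omega
  have e2 : q + (d + (r + 1)).succ - d - (r + 1) = q + 1 := by omega
  have e3 : q + (d + (r + 1)).succ - 1 = q + d + r + 1 := by omega
  rw [e1] at ha
  obtain rfl : m = a + q + 1 := by omega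
  rw [e2, e1, e3]
  push_cast [Nat.succ_eq_add_one]
  ring

/-- The weight of the correction lies m - (r+1) multiples of p - 1 below the target. -/
theorem isFormModPow_of_lt (hp5 : 5 ≤ p) (hf : IsIntegralForm p (d + 1) f)
    (hr : d + (r + 1) < p) (hi : i = (m + 1) * p + (r + 1)) (hrm : r + 1 ≤ m) :
    IsFormModPow p 2 (d + 1 + 2 * i + p * (p - 1)) (thetaOp^[i] f) := by
  refine isFormModPow_of_isFormModPow hp5 hf hr hi
    (isFormModPow_twelfthE2_pow_mul hp5 hf (t := m - (r + 1)) ?_)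
  obtain ⟨u, rfl⟩ := Nat.exists_eq_add_of_le hrm
  obtain ⟨q, rfl⟩ := Nat.exists_eq_add_of_le' (show 1 ≤ p by omega)
  rw [hi, Nat.add_sub_cancel_left, Nat.add_sub_cancel]
  ring

/-- The correction exceeds the weight of the main form by r + 1 - m multiples of p - 1, which is
positive. Modulo p² the main form can only be raised in steps of p(p-1), and one step suffices. -/
theorem isFormModPow_of_ge (hp5 : 5 ≤ p) (hf : IsIntegralForm p (d + 1) f)
    (hr : d + (r + 1) < p) (hi : i = (m + 1) * p + (r + 1)) (hrm : m ≤ r) :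
    IsFormModPow p 2 (d + 1 + 2 * i + 2 * p * (p - 1)) (thetaOp^[i] f) := by
  obtain ⟨S, hS, hSe⟩ := exists_isFormModPow_add hp5 hf hr hi
  rw [hSe]
  refine (hS.raise_sq hp5 1 (by ring)).add (IsFormModPow.prime_mul (IsFormModPow.intCast_mul _
    (isFormModPow_twelfthE2_pow_mul hp5 hf (t := p - (r + 1 - m)) ?_)))
  obtain ⟨u, rfl⟩ := Nat.exists_eq_add_of_le hrm
  obtain ⟨q, rfl⟩ := Nat.exists_eq_add_of_le' hr
  have e1 : q + (d + (m + u + 1)).succ - (m + u + 1 - m) = q + d + m + 1 := by omega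
  have e3 : q + (d + (m + u + 1)).succ - 1 = q + d + m + u + 1 := by omega
  rw [hi, e1, e3]
  push_cast [Nat.succ_eq_add_one]
  ring

variable {F π : MvPolynomial (Fin 2) (ZMod p)}

/-- The lower bound when the residue is small compared to the segment. -/
theorem not_isFormModPow_of_lt (hp5 : 5 ≤ p) (hf : IsIntegralForm p (d + 1) f)
    (hF : IsGraded F (d + 1))
    (hFe : evalEisenstein p F = PowerSeries.map (pIntegralReduction p) f) (hπ : Prime π)
    (hd : π ∣ hassePoly hp5) (hπF : ¬ π ∣ F)
    (hr : d + (r + 1) + (m + 1) ≤ p) (hi : i = (m + 1) * p + (r + 1)) (hrm : r + 1 ≤ m)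
    (hΛ : ¬ (p : ℤ) ∣ ((i * (d + i) : ℕ) : ℤ) - (m + 1) ^ 2) {v : ℕ}
    (hv : v < d + 1 + 2 * i + p * (p - 1)) : ¬ IsFormModPow p 2 v (thetaOp^[i] f) := by
  intro h
  have hr' : d + (r + 1) < p := by omega
  have h0 := not_dvd_iterate_thetaOp hp5 (natCast_zmod_ne_zero_of_lt (by omega) (by omega))
    hF hFe hπ hd hπF i
  obtain ⟨t, ht⟩ := exists_weight_eq_add_mul hp5 h (isFormModPow_of_lt hp5 hf hr' hi hrm) hv h0
  -- A smaller weight is smaller by a positive multiple of p(p-1), so it can be raised to exactly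
  -- one step below the bound.
  have h1 : IsFormModPow p 2 (d + 1 + 2 * i) (thetaOp^[i] f) :=
    h.raise_sq hp5 t (by linarith)
  obtain ⟨S, T, hS, hT, hST⟩ := exists_isFormModPow_add_prime_mul_add hp5 hf hr' hi hrm
  have h2 := h1.sub hS
  rw [hST, add_assoc S, add_sub_cancel_left, ← mul_add] at h2
  have h3 := (h2.of_prime_mul.raise hp5 (d + (r + 1)) rfl).sub hT
  rw [add_sub_cancel_left] at h3
  -- By `hr` the weights k, …, k + a - 1 lie between 0 and p, so the derivatives do not drop. The
  -- weight forced on the correction is too small by p + 1 - d - n > 0 multiples of p - 1.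
  refine not_isFormModPow_twelfthE2_pow_mul hp5 hF hFe hπ hd hπF (a := m + 1 + r)
    (t := p + 1 - (d + (m + 1))) (fun j hj => natCast_zmod_ne_zero_of_lt (by omega) (by omega))
    (by omega) ?_ (h3.of_intCast_mul hΛ)
  obtain ⟨q, rfl⟩ := Nat.exists_eq_add_of_le' hr
  have e1 : q + (d + (r + 1) + (m + 1)) + 1 - (d + (m + 1)) = q + r + 2 := by omega
  have e3 : q + (d + (r + 1) + (m + 1)) - 1 = q + d + r + m + 1 := by omega
  rw [hi, e1, e3]
  ring

/-- The lower bound when the residue is large compared to the segment. -/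
theorem not_isFormModPow_of_ge (hp5 : 5 ≤ p) (hf : IsIntegralForm p (d + 1) f)
    (hF : IsGraded F (d + 1))
    (hFe : evalEisenstein p F = PowerSeries.map (pIntegralReduction p) f) (hπ : Prime π)
    (hd : π ∣ hassePoly hp5) (hπF : ¬ π ∣ F)
    (hr : d + (r + 1) + (m + 1) ≤ p) (hi : i = (m + 1) * p + (r + 1)) (hrm : m ≤ r)
    (hΛ : ¬ (p : ℤ) ∣ ((i * (d + i) : ℕ) : ℤ) - (m + 1) ^ 2) {v : ℕ}
    (hv : v < d + 1 + 2 * i + 2 * p * (p - 1)) : ¬ IsFormModPow p 2 v (thetaOp^[i] f) := by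
  intro h
  have hr' : d + (r + 1) < p := by omega
  have h0 := not_dvd_iterate_thetaOp hp5 (natCast_zmod_ne_zero_of_lt (by omega) (by omega))
    hF hFe hπ hd hπF i
  obtain ⟨t, ht⟩ := exists_weight_eq_add_mul hp5 h (isFormModPow_of_ge hp5 hf hr' hi hrm) hv h0
  have h1 : IsFormModPow p 2 (d + 1 + 2 * i + p * (p - 1)) (thetaOp^[i] f) :=
    h.raise_sq hp5 t (by linarith)
  obtain ⟨S, hS, hSe⟩ := exists_isFormModPow_add hp5 hf hr' hi
  have h2 := h1.sub hS
  rw [hSe, add_sub_cancel_left] at h2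
  -- The correction would have weight k + 2i + p(p-1), which is i' - n + 1 > 0 multiples of p - 1
  -- too small.
  refine not_isFormModPow_twelfthE2_pow_mul hp5 hF hFe hπ hd hπF (a := m + 1 + r)
    (t := r + 1 - m) (fun j hj => natCast_zmod_ne_zero_of_lt (by omega) (by omega))
    (by omega) ?_ (h2.of_prime_mul.of_intCast_mul hΛ)
  obtain ⟨u, rfl⟩ := Nat.exists_eq_add_of_le hrm
  obtain ⟨q, rfl⟩ := Nat.exists_eq_add_of_le' (show 1 ≤ p by omega)
  have e1 : m + u + 1 - m = u + 1 := by omega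
  rw [hi, e1, Nat.add_sub_cancel]
  ring

end FinalBounds

/-! ### The theorem: sorting the cases of i' -/

theorem theoremC (p : ℕ) [Fact p.Prime] (hp : 5 ≤ p) (k : ℕ) (hk0 : 0 < k) (hkp : k < p)
    (f : (pIntegral p)⟦X⟧) (hf : f ∈ modularExpansions p k)
    (hω : weightFiltration p 1 f = (k : ℕ∞))
    (n i : ℕ) (hn1 : 1 ≤ n) (hnp : n < p) (i' : ℤ) (hi' : i' = (i : ℤ) - n * p)
    (hi'0 : 0 ≤ i') (hi'1 : i' ≤ (p : ℤ) - k + 1) :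
    (IsExceptionalIndex p k n i →
      weightFiltration p 2 (thetaOp^[i] f) ≤ ((k + 2 * i + p * (p - 1) : ℕ) : ℕ∞)) ∧
    (¬ IsExceptionalIndex p k n i →
      (i' = 0 →
        weightFiltration p 2 (thetaOp^[i] f) ≤ ((k + 2 * i + p * (p - 1) : ℕ) : ℕ∞)) ∧
      (0 < i' ∧ i' < n ∧ i' ≤ (p : ℤ) - k + 1 - n →
        weightFiltration p 2 (thetaOp^[i] f) = ((k + 2 * i + p * (p - 1) : ℕ) : ℕ∞)) ∧
      ((n : ℤ) ≤ i' ∧ i' ≤ (p : ℤ) - k + 1 - n →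
        weightFiltration p 2 (thetaOp^[i] f) = ((k + 2 * i + 2 * p * (p - 1) : ℕ) : ℕ∞)) ∧
      ((p : ℤ) - k + 1 - n < i' ∧ i' < (p : ℤ) - k + 1 →
        weightFiltration p 2 (thetaOp^[i] f) ≤ ((k + 2 * i + p * (p - 1) : ℕ) : ℕ∞)) ∧
      (i' = (p : ℤ) - k + 1 →
        weightFiltration p 2 (thetaOp^[i] f) ≤ ((k + 2 * i + p * (p - 1) : ℕ) : ℕ∞))) := by
  have hform : IsIntegralForm p k f := hf
  obtain ⟨F, π, hF, hFe, hπ, hd, hπF⟩ :=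
    exists_prime_not_dvd_of_weightFiltration hp hk0 hkp hform hω
  obtain ⟨d, rfl⟩ := Nat.exists_eq_add_of_le' (show 1 ≤ k from hk0)
  obtain ⟨m, rfl⟩ := Nat.exists_eq_add_of_le' hn1
  lift i' to ℕ using hi'0
  have hi : i = (m + 1) * p + i' := by
    have : (i : ℤ) = (m + 1) * p + i' := by rw [hi']; push_cast; ring
    exact_mod_cast this
  have hle : d + i' ≤ p := by push_cast at hi'1; omega
  have hexc : IsExceptionalIndex p (d + 1) (m + 1) i ↔
      (p : ℤ) ∣ ((i * (d + i) : ℕ) : ℤ) - (m + 1) ^ 2 := by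
    rw [IsExceptionalIndex, Int.modEq_zero_iff_dvd]
    push_cast
    rw [show (i : ℤ) ^ 2 + ((d : ℤ) + 1 - 1) * i - (m + 1) ^ 2 = i * (d + i) - (m + 1) ^ 2 by ring]
  have hzero : i' = 0 → IsFormModPow p 2 (d + 1 + 2 * i + p * (p - 1)) (thetaOp^[i] f) := by
    rintro rfl
    refine isFormModPow_iterate_thetaOp_of_dvd hp hform (fun s h0 _ => ?_) fun s hs => ?_
    · rw [hi]
      exact prime_dvd_thetaCoeff d _ (by omega) h0
    · rw [hi]
      exact sq_dvd_thetaCoeff_of_prime_lt d _ (by omega) (by omega)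
  have hlast : d + i' = p → IsFormModPow p 2 (d + 1 + 2 * i + p * (p - 1)) (thetaOp^[i] f) := by
    intro h
    have hdvd : p ∣ d + i := ⟨m + 2, by rw [hi, add_left_comm, h]; ring⟩
    exact isFormModPow_iterate_thetaOp_of_dvd hp hform
      (fun s h0 _ => prime_dvd_thetaCoeff_of_dvd_add hdvd h0)
      fun s hs => sq_dvd_thetaCoeff_of_dvd_add hdvd hs
  refine ⟨fun h => ?_, fun h => ⟨fun h0 => ?_, fun h0 => ?_, fun h0 => ?_, fun h0 => ?_,
    fun h0 => ?_⟩⟩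
  · rw [hexc] at h
    refine weightFiltration_le_of_isFormModPow ?_
    rcases Nat.eq_zero_or_pos i' with h1 | h1
    · exact hzero h1
    rcases hle.eq_or_lt with h2 | h2
    · exact hlast h2
    obtain ⟨r, rfl⟩ := Nat.exists_eq_add_of_le' h1
    exact isFormModPow_of_dvd_coefficient hp hform h2 hi h
  · exact weightFiltration_le_of_isFormModPow (hzero (by exact_mod_cast h0))
  · rw [hexc] at h
    push_cast at h0
    obtain ⟨r, rfl⟩ := Nat.exists_eq_add_of_le' (show 1 ≤ i' by omega)
    exact le_antisymm
      (weightFiltration_le_of_isFormModPow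
        (isFormModPow_of_lt hp hform (by omega) hi (by omega)))
      (le_weightFiltration fun v hv =>
        not_isFormModPow_of_lt hp hform hF hFe hπ hd hπF (by omega) hi (by omega) h hv)
  · rw [hexc] at h
    push_cast at h0
    obtain ⟨r, rfl⟩ := Nat.exists_eq_add_of_le' (show 1 ≤ i' by omega)
    exact le_antisymm
      (weightFiltration_le_of_isFormModPow
        (isFormModPow_of_ge hp hform (by omega) hi (by omega)))
      (le_weightFiltration fun v hv =>
        not_isFormModPow_of_ge hp hform hF hFe hπ hd hπF (by omega) hi (by omega) h hv)
  · refine weightFiltration_le_of_isFormModPow ?_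
    push_cast at h0
    rcases Nat.eq_zero_or_pos i' with h1 | h1
    · exact hzero h1
    obtain ⟨r, rfl⟩ := Nat.exists_eq_add_of_le' h1
    push_cast at h0
    -- The condition i' > p - k + 1 - n says precisely that a = n + i' - 1 reaches p - d.
    exact isFormModPow_of_large hp hform (by omega) hi (by omega)
  · refine weightFiltration_le_of_isFormModPow (hlast ?_)
    push_cast at h0
    omega
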